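/- Let $p,q\ge 1$ be integers with $p+q$ even, let $V=\mathbb R^p\times\mathbb R^q$ with coordinates $(x,y)$, let $\mathfrak g=\mathfrak o(p,q)\otimes\mathbb C$ (matrices $X$ with ${}^tX I_{p,q}+I_{p,q}X=0$) and $K=\mathrm O(p)\times \mathrm O(q)$. The group $K$ acts on $C^\infty(V)$ by $(kf)(v)=f(k^{-1}v)$, and $\mathfrak g$ acts by the linear map $\pi$ with $$\pi(E_{i,j}-E_{j,i})=-x_j\partial_{x_i}+x_i\partial_{x_j},\quad \pi(E_{p+i,p+j}-E_{p+j,p+i})=-y_j\partial_{y_i}+y_i\partial_{y_j},\quad \pi(E_{i,p+j}+E_{p+j,i})=\sqrt{-1}\,(x_iy_j+\partial_{x_i}\partial_{y_j}).$$ Put $\rho_x=\frac12\sum_i x_i^2$, $\rho_y=\frac12\sum_j y_j^2$ and $$H=-\sum_i x_i\partial_{x_i}-\tfrac p2+\sum_j y_j\partial_{y_j}+\tfrac q2,\qquad X^+=-\tfrac12\Big(\sum_i\partial_{x_i}^2+\sum_j y_j^2\Big),\qquad X^-=\tfrac12\Big(\sum_i x_i^2+\sum_j\partial_{y_j}^2\Big).$$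 Let $\mathscr H^d(\mathbb R^n)$ be the space of complex homogeneous harmonic polynomials of degree $d$ on $\mathbb R^n$, on which $\mathrm O(n)$ acts by $(gh)(x)=h(g^{-1}x)$. For $\alpha\in\mathbb C\setminus\{0,-1,-2,\dots\}$ let $\Psi_\alpha(u)=\sum_{n\ge0}\frac{(-1)^n}{n!\,(\alpha)_n}u^n$, where $(\alpha)_n=\alpha(\alpha+1)\cdots(\alpha+n-1)$. Let $\mathscr E\subset C^\infty(V)$ be the linear span of all functions $h_1(x)h_2(y)\rho_x^a\rho_y^b\Psi_\alpha(\rho_x\rho_y)$ with $h_1\in\mathscr H^k(\mathbb R^p)$, $h_2\in\mathscr H^l(\mathbb R^q)$, $k,l,a,b\in\mathbb Z_{\ge0}$ and $\alpha\in\mathbb C\setminus\{0,-1,-2,\dots\}$. For an integer $m\ge0$ let $M_m^{\pm}$ consist of $0$ and of all $f\in\mathscr E$ with $$Hf=\pm mf,\qquad X^{\pm}f=0,\qquad (X^{\mp})^jf\ne0\ (1\le j\le m),\qquad (X^{\mp})^{m+1}f=0 .$$ Assume $m+3\le (p+q)/2$. Then $M_m^+$ and $M_m^-$ are linear subspaces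 of $C^\infty(V)$ and, under the above actions, $(\mathfrak g,K)$-modules, and the following hold. (1) As representations of $K$, $$M_m^{\pm}\big|_K\;\simeq\bigoplus_{\substack{k,l\ge0\\ k-l+\frac{p-q}2\in\Lambda_m}}\mathscr H^k(\mathbb R^p)\otimes\mathscr H^l(\mathbb R^q),\qquad \Lambda_m=\{-m,-m+2,\dots,m-2,m\},$$ and this decomposition is multiplicity-free: its nonzero summands are irreducible and pairwise inequivalent. (2) If moreover $p,q\ge2$, then $M_m^+$ and $M_m^-$ are irreducible $(\mathfrak g,K)$-modules. -/

import Mathlib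

open scoped ContDiff DirectSum TensorProduct

noncomputable section

namespace OpqModule

/-! ### Harmonic polynomials as representations of the orthogonal group -/

/-- The Laplacian `∑ ∂ᵢ²` on complex polynomials in `n` variables. -/
def polyLaplacian (n : ℕ) :
    MvPolynomial (Fin n) ℂ →ₗ[ℂ] MvPolynomial (Fin n) ℂ :=
  ∑ i, (MvPolynomial.pderiv i).toLinearMap ∘ₗ (MvPolynomial.pderiv i).toLinearMap

/-- `Harm d n` is the space of homogeneous harmonic polynomials of degree `d` on `ℝⁿ`
(with complex coefficients). -/
def Harm (d n : ℕ) : Submodule ℂ (MvPolynomial (Fin n) ℂ) :=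
  MvPolynomial.homogeneousSubmodule (Fin n) ℂ d ⊓ LinearMap.ker (polyLaplacian n)

/-- The real orthogonal group `O(n)`. -/
abbrev Orth (n : ℕ) := Matrix.orthogonalGroup (Fin n) ℝ

/-- `(polySubst g f)(x) = f(gᵀ x)`; for orthogonal `g` this is `f(g⁻¹ x)`. -/
def polySubst {n : ℕ} (g : Matrix (Fin n) (Fin n) ℝ) :
    MvPolynomial (Fin n) ℂ →ₐ[ℂ] MvPolynomial (Fin n) ℂ :=
  MvPolynomial.aeval fun i => ∑ j, MvPolynomial.C ((g j i : ℝ) : ℂ) * MvPolynomial.X j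

theorem polySubst_X {n : ℕ} (g : Matrix (Fin n) (Fin n) ℝ) (i : Fin n) :
    polySubst g (MvPolynomial.X i) =
      ∑ j, MvPolynomial.C ((g j i : ℝ) : ℂ) * MvPolynomial.X j := by
  simp [polySubst]

theorem polySubst_one (n : ℕ) :
    polySubst (1 : Matrix (Fin n) (Fin n) ℝ) = AlgHom.id ℂ _ := by
  apply MvPolynomial.algHom_ext
  intro i
  rw [polySubst_X, Finset.sum_eq_single i]
  · simp
  · intro j _ hj
    simp [Matrix.one_apply_ne hj]
  · simp

theorem polySubst_mul {n : ℕ} (g h : Matrix (Fin n) (Fin n) ℝ) :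
    polySubst (g * h) = (polySubst g).comp (polySubst h) := by
  apply MvPolynomial.algHom_ext
  intro i
  have hC : ∀ c : ℂ, polySubst g (MvPolynomial.C c) = MvPolynomial.C c := fun c => by
    simp [polySubst]
  simp only [AlgHom.comp_apply, polySubst_X, map_sum, map_mul, hC, Finset.mul_sum,
    Matrix.mul_apply, Complex.ofReal_sum, Complex.ofReal_mul, Finset.sum_mul]
  rw [Finset.sum_comm]
  refine Finset.sum_congr rfl fun j _ => Finset.sum_congr rfl fun k _ => ?_
  ring

theorem pderiv_polySubst {n : ℕ} (g : Matrix (Fin n) (Fin n) ℝ) (j : Fin n)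
    (f : MvPolynomial (Fin n) ℂ) :
    MvPolynomial.pderiv j (polySubst g f) =
      ∑ i, MvPolynomial.C ((g j i : ℝ) : ℂ) * polySubst g (MvPolynomial.pderiv i f) := by
  induction f using MvPolynomial.induction_on with
  | C a => simp [polySubst]
  | add f₁ f₂ h₁ h₂ => simp [h₁, h₂, mul_add, Finset.sum_add_distrib]
  | mul_X f i h =>
    have hX : MvPolynomial.pderiv j (polySubst g (MvPolynomial.X i)) =
        MvPolynomial.C ((g j i : ℝ) : ℂ) := by
      rw [polySubst_X, map_sum, Finset.sum_eq_single j]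
      · simp
      · intro k _ hk
        simp [MvPolynomial.pderiv_X_of_ne hk]
      · simp
    rw [map_mul, Derivation.leibniz, h, hX]
    simp only [Derivation.leibniz, smul_eq_mul, map_add, map_mul, mul_add,
      Finset.sum_add_distrib]
    congr 1
    · rw [Finset.sum_eq_single i]
      · simp; ring
      · intro k _ hk
        simp [MvPolynomial.pderiv_X_of_ne hk.symm]
      · simp
    · rw [Finset.mul_sum]
      exact Finset.sum_congr rfl fun k _ => by ring

theorem polyLaplacian_polySubst {n : ℕ} (g : Orth n) (f : MvPolynomial (Fin n) ℂ) :
    polyLaplacian n (polySubst g.1 f) = polySubst g.1 (polyLaplacian n f) := by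
  have hg : ∀ i k : Fin n, ∑ j, ((g.1 j i : ℝ) : ℂ) * ((g.1 j k : ℝ) : ℂ) =
      if i = k then 1 else 0 := by
    intro i k
    have h := congrFun (congrFun (Matrix.mem_orthogonalGroup_iff' (Fin n) ℝ |>.1 g.2) i) k
    simp only [Matrix.mul_apply, Matrix.one_apply, Matrix.transpose_apply] at h
    have h' := congrArg (fun x : ℝ => (x : ℂ)) h
    simpa [apply_ite] using h'
  simp only [polyLaplacian, LinearMap.sum_apply, LinearMap.comp_apply,
    Derivation.coeFn_coe, pderiv_polySubst, map_sum,
    Derivation.leibniz, smul_eq_mul, MvPolynomial.pderiv_C, mul_zero, add_zero,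
    Finset.mul_sum]
  rw [Finset.sum_comm]
  refine Finset.sum_congr rfl fun i _ => ?_
  rw [Finset.sum_comm, Finset.sum_eq_single i]
  · simp only [← mul_assoc, ← Finset.sum_mul, ← map_mul, ← map_sum]
    rw [hg]
    simp
  · intro k _ hk
    simp only [← mul_assoc, ← Finset.sum_mul, ← map_mul, ← map_sum]
    rw [hg]
    simp [hk.symm]
  · simp

theorem polySubst_mem_Harm {d n : ℕ} (g : Orth n) {f : MvPolynomial (Fin n) ℂ}
    (hf : f ∈ Harm d n) : polySubst g.1 f ∈ Harm d n := by
  obtain ⟨h₁, h₂⟩ := Submodule.mem_inf.1 hf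
  refine Submodule.mem_inf.2 ⟨?_, ?_⟩
  · rw [MvPolynomial.mem_homogeneousSubmodule] at h₁ ⊢
    have := h₁.aeval (fun i => ∑ j, MvPolynomial.C ((g.1 j i : ℝ) : ℂ) * MvPolynomial.X j)
      (n := 1) (fun i => MvPolynomial.IsHomogeneous.sum _ _ _ fun j _ => by
        simpa using (MvPolynomial.isHomogeneous_C (Fin n) ((g.1 j i : ℝ) : ℂ)).mul
          (MvPolynomial.isHomogeneous_X ℂ j))
    simpa [polySubst] using this
  · rw [LinearMap.mem_ker] at h₂ ⊢
    rw [polyLaplacian_polySubst, h₂, map_zero]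

/-- The representation of `O(n)` on `Harm d n`, `(g • h)(x) = h(g⁻¹ x)`. -/
def harmRep (d n : ℕ) : Representation ℂ (Orth n) (Harm d n) where
  toFun g := (polySubst g.1).toLinearMap.restrict fun _ hf => polySubst_mem_Harm g hf
  map_one' := by
    ext1 f
    apply Subtype.ext
    change polySubst (1 : Matrix (Fin n) (Fin n) ℝ) f.1 = f.1
    rw [polySubst_one]
    rfl
  map_mul' g h := by
    ext1 f
    apply Subtype.ext
    change polySubst (g.1 * h.1) f.1 = polySubst g.1 (polySubst h.1 f.1)
    rw [polySubst_mul]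
    rfl

/-- The maximal compact subgroup `K = O(p) × O(q)` of `O(p,q)`. -/
abbrev K (p q : ℕ) := Orth p × Orth q

/-- The representation of `K` on `Harm k p ⊗ Harm l q` (external tensor product). -/
def kTypeRep (p q k l : ℕ) : Representation ℂ (K p q) (Harm k p ⊗[ℂ] Harm l q) :=
  Representation.tprod ((harmRep k p).comp (MonoidHom.fst _ _))
    ((harmRep l q).comp (MonoidHom.snd _ _))

/-! ### The Lie algebra `𝔤 = 𝔬(p,q) ⊗ ℂ` and the group `K` -/

/-- The complexification of `𝔬(p,q)`: complex matrices `X` with `Xᵀ I_{p,q} + I_{p,q} X = 0`. -/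
abbrev 𝔤 (p q : ℕ) := LieAlgebra.Orthogonal.so' (Fin p) (Fin q) ℂ

/-- The Lie algebra `𝔨₀ = 𝔬(p) × 𝔬(q)` of `K`: pairs of real skew-symmetric matrices. -/
abbrev 𝔨₀ (p q : ℕ) :=
  LieAlgebra.Orthogonal.so (Fin p) ℝ × LieAlgebra.Orthogonal.so (Fin q) ℝ

/-- The block matrix `diag(a, d)`, with entries regarded as complex numbers. -/
def blockDiag {p q : ℕ} (a : Matrix (Fin p) (Fin p) ℝ) (d : Matrix (Fin q) (Fin q) ℝ) :
    Matrix (Fin p ⊕ Fin q) (Fin p ⊕ Fin q) ℂ :=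
  Matrix.fromBlocks (a.map Complex.ofReal) 0 0 (d.map Complex.ofReal)

theorem indefiniteDiagonal_eq (p q : ℕ) :
    LieAlgebra.Orthogonal.indefiniteDiagonal (Fin p) (Fin q) ℂ =
      Matrix.fromBlocks 1 0 0 (-1) := by
  rw [← Matrix.diagonal_one, ← Matrix.diagonal_one, Matrix.diagonal_neg,
    Matrix.fromBlocks_diagonal]
  rfl

theorem mem_𝔤_iff {p q : ℕ} (X : Matrix (Fin p ⊕ Fin q) (Fin p ⊕ Fin q) ℂ) :
    X ∈ LieAlgebra.Orthogonal.so' (Fin p) (Fin q) ℂ ↔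
      X.transpose * Matrix.fromBlocks 1 0 0 (-1) = Matrix.fromBlocks 1 0 0 (-1) * (-X) := by
  rw [LieAlgebra.Orthogonal.so', mem_skewAdjointMatricesLieSubalgebra,
    mem_skewAdjointMatricesSubmodule, indefiniteDiagonal_eq]
  rfl

/-- The inclusion `𝔨₀ ⊆ 𝔤`. -/
def kToG {p q : ℕ} (X : 𝔨₀ p q) : 𝔤 p q :=
  ⟨blockDiag X.1.1 X.2.1, by
    have h₁ := (LieAlgebra.Orthogonal.mem_so (Fin p) ℝ _).1 X.1.2
    have h₂ := (LieAlgebra.Orthogonal.mem_so (Fin q) ℝ _).1 X.2.2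
    rw [mem_𝔤_iff, blockDiag, Matrix.fromBlocks_transpose, Matrix.fromBlocks_neg,
      Matrix.fromBlocks_multiply, Matrix.fromBlocks_multiply, ← Matrix.transpose_map,
      ← Matrix.transpose_map, h₁, h₂]
    congr 1 <;> ext <;> simp⟩

/-- The adjoint action of `K` on `𝔤`, `Ad(k) X = k X k⁻¹`. -/
def Ad {p q : ℕ} (k : K p q) (X : 𝔤 p q) : 𝔤 p q :=
  ⟨blockDiag k.1.1 k.2.1 * X.1 * blockDiag k⁻¹.1.1 k⁻¹.2.1, by
    have hX := (mem_𝔤_iff X.1).1 X.2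
    have e₁ : (blockDiag k⁻¹.1.1 k⁻¹.2.1).transpose = blockDiag k.1.1 k.2.1 := by
      rw [blockDiag, blockDiag, Matrix.fromBlocks_transpose]
      congr 1
    have e₂ : (blockDiag k.1.1 k.2.1).transpose = blockDiag k⁻¹.1.1 k⁻¹.2.1 := by
      rw [← e₁, Matrix.transpose_transpose]
    have c : ∀ k : K p q, blockDiag k.1.1 k.2.1 * Matrix.fromBlocks 1 0 0 (-1) =
        Matrix.fromBlocks 1 0 0 (-1) * blockDiag k.1.1 k.2.1 := by
      intro k
      simp [blockDiag, Matrix.fromBlocks_multiply]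
    rw [mem_𝔤_iff, Matrix.transpose_mul, Matrix.transpose_mul, e₁, e₂]
    calc _ = blockDiag k.1.1 k.2.1 * (X.1.transpose *
            (blockDiag k⁻¹.1.1 k⁻¹.2.1 * Matrix.fromBlocks 1 0 0 (-1))) := by
          simp only [mul_assoc]
      _ = blockDiag k.1.1 k.2.1 * (X.1.transpose * Matrix.fromBlocks 1 0 0 (-1)) *
            blockDiag k⁻¹.1.1 k⁻¹.2.1 := by
          rw [c]; simp only [mul_assoc]
      _ = blockDiag k.1.1 k.2.1 * Matrix.fromBlocks 1 0 0 (-1) * (-X.1) *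
            blockDiag k⁻¹.1.1 k⁻¹.2.1 := by
          rw [hX]; simp only [mul_assoc]
      _ = _ := by
          rw [c]; simp only [mul_assoc, neg_mul, mul_neg]⟩

theorem exp_mem_orthogonalGroup {n : ℕ} (A : LieAlgebra.Orthogonal.so (Fin n) ℝ) :
    NormedSpace.exp A.1 ∈ Matrix.orthogonalGroup (Fin n) ℝ := by
  have h := (LieAlgebra.Orthogonal.mem_so (Fin n) ℝ _).1 A.2
  rw [Matrix.mem_orthogonalGroup_iff]
  rw [← Matrix.exp_transpose, h, Matrix.exp_neg]
  exact Matrix.mul_nonsing_inv _ ((Matrix.isUnit_iff_isUnit_det _).1 (Matrix.isUnit_exp A.1))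

/-- The exponential map `𝔨₀ → K`. -/
def expK {p q : ℕ} (X : 𝔨₀ p q) : K p q :=
  (⟨NormedSpace.exp X.1.1, exp_mem_orthogonalGroup X.1⟩,
    ⟨NormedSpace.exp X.2.1, exp_mem_orthogonalGroup X.2⟩)

/-! ### `(𝔤, K)`-modules -/

section GK

variable {p q : ℕ} {W : Type*} [AddCommGroup W] [Module ℂ W]

/-- The subspace `N` is stable under the operators of `𝔤` and of `K`. -/
def IsGKStable (π : 𝔤 p q →ₗ[ℂ] Module.End ℂ W) (σ : Representation ℂ (K p q) W)
    (N : Submodule ℂ W) : Prop :=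
  (∀ X, ∀ f ∈ N, π X f ∈ N) ∧ (∀ k, ∀ f ∈ N, σ k f ∈ N)

/-- The subspace `M` of `W`, with the operators `π X` and `σ k` restricted to it, is a
`(𝔤, K)`-module. Since `K`-orbits span finite-dimensional spaces, continuity and
differentiability are expressed by linear functionals. -/
structure IsGKModule (π : 𝔤 p q →ₗ[ℂ] Module.End ℂ W) (σ : Representation ℂ (K p q) W)
    (M : Submodule ℂ W) : Prop where
  stable : IsGKStable π σ M
  /-- `M` is a representation of the Lie algebra `𝔤`. -/
  lie : ∀ X Y, ∀ f ∈ M, π ⁅X, Y⁆ f = π X (π Y f) - π Y (π X f)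
  /-- Every vector is `K`-finite. -/
  finite : ∀ f ∈ M, FiniteDimensional ℂ (Submodule.span ℂ (Set.range fun k => σ k f))
  /-- `K` acts continuously. -/
  cont : ∀ f ∈ M, ∀ φ : Module.Dual ℂ W, Continuous fun k => φ (σ k f)
  /-- The differential of the action of `K` is the action of `𝔨₀ ⊆ 𝔤`. -/
  deriv : ∀ f ∈ M, ∀ φ : Module.Dual ℂ W, ∀ X : 𝔨₀ p q,
    HasDerivAt (fun t : ℝ => φ (σ (expK (t • X)) f)) (φ (π (kToG X) f)) 0
  /-- The two actions are compatible. -/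
  compat : ∀ k X, ∀ f ∈ M, σ k (π X f) = π (Ad k X) (σ k f)

/-- `M` is an irreducible `(𝔤, K)`-module. -/
def IsIrreducibleGKModule (π : 𝔤 p q →ₗ[ℂ] Module.End ℂ W)
    (σ : Representation ℂ (K p q) W) (M : Submodule ℂ W) : Prop :=
  IsGKModule π σ M ∧ M ≠ ⊥ ∧
    ∀ N : Submodule ℂ W, N ≤ M → IsGKStable π σ N → N = ⊥ ∨ N = M

end GK

/-! ### Smooth functions on `V = ℝ^p × ℝ^q` and differential operators -/

/-- The space `V`, with coordinates `(x, y)`. -/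
abbrev V (p q : ℕ) := (Fin p → ℝ) × (Fin q → ℝ)

/-- `C^∞(V)`, the complex valued smooth functions on `V`. -/
def Smooth (p q : ℕ) : Submodule ℂ (V p q → ℂ) where
  carrier := {f | ContDiff ℝ ∞ f}
  add_mem' hf hg := ContDiff.add (Set.mem_ofPred.1 hf) (Set.mem_ofPred.1 hg)
  zero_mem' := Set.mem_ofPred.2 contDiff_const
  smul_mem' c _ hf := Set.mem_ofPred.2 (ContDiff.const_smul c (Set.mem_ofPred.1 hf))

theorem Smooth.contDiff {p q : ℕ} (f : Smooth p q) : ContDiff ℝ ∞ f.1 := Set.mem_ofPred.1 f.2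

theorem Smooth.differentiableAt {p q : ℕ} (f : Smooth p q) (v : V p q) :
    DifferentiableAt ℝ f.1 v :=
  ((Smooth.contDiff f).differentiable (by simp)).differentiableAt

section Operators

variable {p q : ℕ}

/-- The derivative in the constant direction `u`. -/
def dirDeriv (u : V p q) : Module.End ℂ (Smooth p q) where
  toFun f := ⟨fun v => fderiv ℝ f.1 v u,
    Set.mem_ofPred.2
      ((ContDiff.fderiv_right (m := ∞) (Smooth.contDiff f) (by simp)).clm_apply contDiff_const)⟩
  map_add' f g := by
    apply Subtype.ext
    funext v
    have hf : DifferentiableAt ℝ f.1 v := Smooth.differentiableAt f v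
    have hg : DifferentiableAt ℝ g.1 v := Smooth.differentiableAt g v
    change fderiv ℝ (f.1 + g.1) v u = fderiv ℝ f.1 v u + fderiv ℝ g.1 v u
    rw [fderiv_add hf hg]
    rfl
  map_smul' c f := by
    apply Subtype.ext
    funext v
    have hf : DifferentiableAt ℝ f.1 v := Smooth.differentiableAt f v
    change fderiv ℝ (c • f.1) v u = c • fderiv ℝ f.1 v u
    rw [fderiv_const_smul hf]
    rfl

/-- `∂/∂xᵢ`. -/
def dx (i : Fin p) : Module.End ℂ (Smooth p q) := dirDeriv (Pi.single i 1, 0)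

/-- `∂/∂yⱼ`. -/
def dy (j : Fin q) : Module.End ℂ (Smooth p q) := dirDeriv (0, Pi.single j 1)

/-- Multiplication by a real valued smooth function. -/
def mulOp (a : V p q → ℝ) (ha : ContDiff ℝ ∞ a) : Module.End ℂ (Smooth p q) where
  toFun f := ⟨fun v => (a v : ℂ) * f.1 v,
    Set.mem_ofPred.2 ((Complex.ofRealCLM.contDiff.comp ha).mul (Smooth.contDiff f))⟩
  map_add' f g := by
    apply Subtype.ext
    funext v
    exact mul_add _ _ _
  map_smul' c f := by
    apply Subtype.ext
    funext v
    exact mul_left_comm _ _ _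

/-- Multiplication by `xᵢ`. -/
def mx (i : Fin p) : Module.End ℂ (Smooth p q) := mulOp (fun v => v.1 i) (by fun_prop)

/-- Multiplication by `yⱼ`. -/
def my (j : Fin q) : Module.End ℂ (Smooth p q) := mulOp (fun v => v.2 j) (by fun_prop)

variable (p q)

/-- The representation `π` of `𝔤` on `C^∞(V)`: the linear map with
`π(E_{i,j} - E_{j,i}) = - xⱼ ∂_{xᵢ} + xᵢ ∂_{xⱼ}` for `i, j ≤ p`,
`π(E_{p+i,p+j} - E_{p+j,p+i}) = - yⱼ ∂_{yᵢ} + yᵢ ∂_{yⱼ}` for `i, j ≤ q`, and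
`π(E_{i,p+j} + E_{p+j,i}) = √-1 (xᵢ yⱼ + ∂_{xᵢ} ∂_{yⱼ})` for `i ≤ p`, `j ≤ q`. -/
def piG : 𝔤 p q →ₗ[ℂ] Module.End ℂ (Smooth p q) where
  toFun X :=
    ∑ i, ∑ j, X.1 (Sum.inl i) (Sum.inl j) • (mx i * dx j) +
    ∑ i, ∑ j, X.1 (Sum.inr i) (Sum.inr j) • (my i * dy j) +
    ∑ i, ∑ j, (X.1 (Sum.inl i) (Sum.inr j) * Complex.I) • (mx i * my j + dx i * dy j)
  map_add' X Y := by
    simp only [AddMemClass.coe_add, Matrix.add_apply, add_smul, add_mul,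
      Finset.sum_add_distrib]
    abel
  map_smul' c X := by
    simp only [SetLike.val_smul, Matrix.smul_apply, smul_eq_mul, mul_smul, mul_assoc,
      smul_add, Finset.smul_sum, RingHom.id_apply]

/-- The action of `K` on `C^∞(V)`, `(k • f)(v) = f(k⁻¹ v)`. -/
def piK : Representation ℂ (K p q) (Smooth p q) where
  toFun k :=
    { toFun := fun f =>
        ⟨fun v => f.1 (k⁻¹.1.1.mulVec v.1, k⁻¹.2.1.mulVec v.2), by
          refine Set.mem_ofPred.2 (ContDiff.comp (Smooth.contDiff f) (ContDiff.prodMk ?_ ?_))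
          · exact (Matrix.mulVecLin k⁻¹.1.1).toContinuousLinearMap.contDiff.comp contDiff_fst
          · exact (Matrix.mulVecLin k⁻¹.2.1).toContinuousLinearMap.contDiff.comp contDiff_snd⟩
      map_add' := fun _ _ => rfl
      map_smul' := fun _ _ => rfl }
  map_one' := by
    ext1 f
    apply Subtype.ext
    funext v
    change f.1 _ = f.1 v
    simp
  map_mul' k l := by
    ext1 f
    apply Subtype.ext
    funext v
    change f.1 _ = f.1 _
    simp [mul_inv_rev, Matrix.mulVec_mulVec]

/-! ### The commuting `𝔰𝔩₂` -/

/-- `H = - E_x - p/2 + E_y + q/2` with the Euler operators `E_x`, `E_y`. -/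
def opH : Module.End ℂ (Smooth p q) :=
  -(∑ i, mx i * dx i) - ((p : ℂ) / 2) • 1 + (∑ j, my j * dy j) + ((q : ℂ) / 2) • 1

/-- `X⁺ = -(Δ_x + r_y²)/2`. -/
def opXp : Module.End ℂ (Smooth p q) :=
  -((1 : ℂ) / 2) • ((∑ i, dx i * dx i) + ∑ j, my j * my j)

/-- `X⁻ = (r_x² + Δ_y)/2`. -/
def opXm : Module.End ℂ (Smooth p q) :=
  ((1 : ℂ) / 2) • ((∑ i, mx i * mx i) + ∑ j, dy j * dy j)

/-! ### The function space `ℰ` and the modules `M^±_m` -/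

/-- `Ψ_α(u) = ∑ (-1)ⁿ uⁿ / (n! (α)_n)` with the rising factorial `(α)_n`. -/
def Psi (α u : ℂ) : ℂ :=
  ∑' n : ℕ, (-1) ^ n / ((n.factorial : ℂ) * (ascPochhammer ℂ n).eval α) * u ^ n

/-- `ρ = (∑ xᵢ²) / 2`. -/
def rho {n : ℕ} (x : Fin n → ℝ) : ℝ := (∑ i, x i ^ 2) / 2

/-- The function `h₁(x) h₂(y) ρ_x^a ρ_y^b ψ_α`, where `ψ_α = Ψ_α(r_x² r_y² / 4) = Ψ_α(ρ_x ρ_y)`. -/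
def genFun (h₁ : MvPolynomial (Fin p) ℂ) (h₂ : MvPolynomial (Fin q) ℂ) (a b : ℕ) (α : ℂ) :
    V p q → ℂ := fun v =>
  MvPolynomial.eval (fun i => (v.1 i : ℂ)) h₁ * MvPolynomial.eval (fun j => (v.2 j : ℂ)) h₂ *
    (rho v.1 : ℂ) ^ a * (rho v.2 : ℂ) ^ b * Psi α ((rho v.1 : ℂ) * (rho v.2 : ℂ))

/-- The space `ℰ` spanned by the functions `h₁(x) h₂(y) ρ_x^a ρ_y^b ψ_α` with `h₁`, `h₂`
homogeneous harmonic, `a, b ∈ ℕ` and `α ∈ ℂ ∖ (-ℕ)`; these functions are smooth since `Ψ_α`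
is entire, and `ℰ` is taken inside `C^∞(V)`. -/
def spaceE : Submodule ℂ (Smooth p q) :=
  (Submodule.span ℂ {F : V p q → ℂ | ∃ (k l : ℕ) (h₁ : MvPolynomial (Fin p) ℂ)
      (h₂ : MvPolynomial (Fin q) ℂ) (a b : ℕ) (α : ℂ),
      h₁ ∈ Harm k p ∧ h₂ ∈ Harm l q ∧ (∀ n : ℕ, α ≠ -(n : ℂ)) ∧
      F = genFun p q h₁ h₂ a b α}).comap (Smooth p q).subtype

/-- The `f ∈ ℰ` with `H f = m f`, `X⁺ f = 0`, `(X⁻)^j f ≠ 0` for `1 ≤ j ≤ m` and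
`(X⁻)^{m+1} f = 0`. -/
def setPlus (m : ℕ) : Set (Smooth p q) :=
  {f | f ∈ spaceE p q ∧ opH p q f = (m : ℂ) • f ∧ opXp p q f = 0 ∧
    (∀ j : ℕ, 1 ≤ j → j ≤ m → (opXm p q ^ j) f ≠ 0) ∧ (opXm p q ^ (m + 1)) f = 0}

/-- The `f ∈ ℰ` with `H f = -m f`, `X⁻ f = 0`, `(X⁺)^j f ≠ 0` for `1 ≤ j ≤ m` and
`(X⁺)^{m+1} f = 0`. -/
def setMinus (m : ℕ) : Set (Smooth p q) :=
  {f | f ∈ spaceE p q ∧ opH p q f = (-(m : ℂ)) • f ∧ opXm p q f = 0 ∧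
    (∀ j : ℕ, 1 ≤ j → j ≤ m → (opXp p q ^ j) f ≠ 0) ∧ (opXp p q ^ (m + 1)) f = 0}

/-- The module `M⁺_m`, as the linear span of `setPlus`. -/
def modPlus (m : ℕ) : Submodule ℂ (Smooth p q) := Submodule.span ℂ (setPlus p q m)

/-- The module `M⁻_m`, as the linear span of `setMinus`. -/
def modMinus (m : ℕ) : Submodule ℂ (Smooth p q) := Submodule.span ℂ (setMinus p q m)

/-! ### The `K`-types -/

/-- `Λ_m = {-m, -m+2, …, m-2, m}`. -/
def Lam (m : ℕ) : Set ℚ := {t | ∃ j : ℕ, j ≤ m ∧ t = -(m : ℚ) + 2 * j}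

/-- The pairs `(k, l)` of natural numbers with `k - l + (p - q)/2 ∈ Λ_m`. -/
def KIndex (m : ℕ) : Set (ℕ × ℕ) :=
  {i | (i.1 : ℚ) - i.2 + ((p : ℚ) - q) / 2 ∈ Lam m}

/-- The representation `⨁ Harm k p ⊗ Harm l q` of `K`, the sum over all `(k, l)` in
`KIndex p q m`. -/
def kTypeSum (m : ℕ) :
    Representation ℂ (K p q) (⨁ i : KIndex p q m, Harm i.1.1 p ⊗[ℂ] Harm i.1.2 q) :=
  Representation.directSum fun i : KIndex p q m => kTypeRep p q i.1.1 i.1.2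

/-- `M`, restricted to `K`, is isomorphic to `kTypeSum p q m`. -/
def HasKTypeFormula (m : ℕ) (M : Submodule ℂ (Smooth p q)) : Prop :=
  ∃ e : (⨁ i : KIndex p q m, Harm i.1.1 p ⊗[ℂ] Harm i.1.2 q) ≃ₗ[ℂ] M,
    ∀ k w, (e (kTypeSum p q m k w) : Smooth p q) = piK p q k (e w)

/-- The nonzero summands of `kTypeSum p q m` are irreducible and pairwise inequivalent. -/
def MultiplicityFree (m : ℕ) : Prop :=
  (∀ i ∈ KIndex p q m, Nontrivial (Harm i.1 p ⊗[ℂ] Harm i.2 q) →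
    Representation.IsIrreducible (k := ℂ) (V := Harm i.1 p ⊗[ℂ] Harm i.2 q)
      (kTypeRep p q i.1 i.2)) ∧
  ∀ i ∈ KIndex p q m, ∀ j ∈ KIndex p q m, i ≠ j →
    Nontrivial (Harm i.1 p ⊗[ℂ] Harm i.2 q) →
    IsEmpty ((kTypeRep p q i.1 i.2).Equiv (kTypeRep p q j.1 j.2))

end Operators

end OpqModule

end

/-! The operators x_i, √-1 ∂_{y_j} (creation) and ∂_{x_i}, √-1 y_j (annihilation) satisfy the
canonical commutation relations (`isWeyl`). In these generators 𝔤 acts by the quadratic elements ∑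
X_{ab} u_a w_b (`piG_eq`), X⁻ and X⁺ are multiples of the invariant forms ∑ ε_a u_a² and ∑ ε_a w_a²,
and H is -∑ u_a w_a up to a constant. So 𝔤 and K commute with a copy of 𝔰𝔩₂, and every space cut out
by 𝔰𝔩₂-conditions is stable under them.

K-types. The functions P(x,y) χ(ρ_x ρ_y), P polynomial and χ entire, span a space `bigE` containing
ℰ and visibly stable under 𝔤 and K. Fischer's decomposition reduces P to h₁(x) h₂(y) ρ_x^a ρ_y^b
with h₁, h₂ harmonic of degrees k, l. Casimir operators and parities separate the pairs (k,l), and H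
separates the differences δ = b - a. On such a component X⁺ acts, up to a factor -ρ_y, through χ ↦
zχ'' + κχ' + χ with κ = k + p/2, whose entire solutions are the multiples of Ψ_κ (`eq_smul_psiE`).
Hence X⁺f = 0 forces f = 0 when δ < 0 (`primitive_piece_neg`) and f = h ρ_y^d Ψ_κ when δ = d ≥ 0
(`primitive_piece_nonneg`). For such an f of weight m, (X⁻)^{m+1} f is again killed by X⁺ and has δ
= d - m - 1, so it vanishes if d ≤ m; if d > m its leading coefficient survives (`opXm_pow_G`).
Weight m means k - l + (p-q)/2 = -m + 2d, so 0 ≤ d ≤ m is exactly membership in Λ_m. The conditions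
(X⁻)^j f ≠ 0 are automatic for f ≠ 0. Everything passes to M⁻ along (X⁻)^m, whose inverse is (X⁺)^m
up to a nonzero scalar.

Multiplicity one. A functional on harmonic polynomials fixed by the stabilizer of a point of the
sphere is a multiple of evaluation there (`exists_eq_evalR`). An intertwining map is therefore
multiplication by a constant on the sphere, which gives Schur's lemma, irreducibility and
inequivalence for O(n); Burnside's theorem handles the external tensor products.

Irreducibility. A nonzero stable subspace contains a whole K-type. The elements E_{i,p+j} +
E_{p+j,i} send the type (k,l) to the types (k±1, l±1) with explicit coefficients (`piG_boost_G`).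
Those raising or lowering d vanish only at the ends d = m and d = 0, and the assumption m + 3 ≤
(p+q)/2 rules out an accidental zero in the step to (k+1, l+1) (`Full.plus_plus`). So all types are
reached from any one of them (`Full.all`). -/

noncomputable section

namespace OpqModule

set_option linter.unusedSectionVars false

/-! ### Quadratic elements of a Weyl algebra -/

section Weyl

variable {ι A : Type*} [DecidableEq ι] [Semiring A] [Algebra ℂ A]

/-- Families `u`, `w` satisfying the canonical commutation relations `[w a, u b] = δ_{ab}`. -/
structure IsWeyl (u w : ι → A) : Prop where
  uu : ∀ a b, u a * u b = u b * u a
  ww : ∀ a b, w a * w b = w b * w a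
  wu : ∀ a b, w a * u b = u b * w a + if a = b then 1 else 0

variable [Fintype ι]

/-- The element `∑ X a b • u a * w b`. -/
def quad (u w : ι → A) (X : Matrix ι ι ℂ) : A := ∑ a, ∑ b, X a b • (u a * w b)

/-- The element `∑ ε a • u a ^ 2`. -/
def sqForm (ε : ι → ℂ) (u : ι → A) : A := ∑ a, ε a • (u a * u a)

variable {u w : ι → A}

theorem quad_one : quad u w (1 : Matrix ι ι ℂ) = ∑ a, u a * w a := by
  refine Finset.sum_congr rfl fun a _ => ?_
  rw [Finset.sum_eq_single a]
  · simp
  · intro b _ hb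
    simp [Matrix.one_apply_ne hb.symm]
  · simp

/-- The commutator with a quadratic element is the linear action of `X` on the span of the `u`. This
rule and its dual `IsWeyl.w_mul_quad` produce all the relations below. -/
theorem IsWeyl.quad_mul_u (h : IsWeyl u w) (X : Matrix ι ι ℂ) (c : ι) :
    quad u w X * u c = u c * quad u w X + ∑ a, X a c • u a := by
  simp only [quad, Finset.sum_mul, Finset.mul_sum, ← Finset.sum_add_distrib]
  refine Finset.sum_congr rfl fun a _ => ?_
  have : X a c • u a = ∑ b, X a b • (u a * if b = c then 1 else 0) := by
    simp
  rw [this, ← Finset.sum_add_distrib]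
  refine Finset.sum_congr rfl fun b _ => ?_
  rw [smul_mul_assoc, mul_smul_comm, ← smul_add, mul_assoc, h.wu, mul_add, ← mul_assoc,
    h.uu a c, mul_assoc]

theorem IsWeyl.w_mul_quad (h : IsWeyl u w) (X : Matrix ι ι ℂ) (c : ι) :
    w c * quad u w X = quad u w X * w c + ∑ b, X c b • w b := by
  have : ∑ b, X c b • w b = ∑ a, ∑ b, X a b • ((if c = a then 1 else 0) * w b) := by
    simp
  rw [this]
  simp only [quad, Finset.sum_mul, Finset.mul_sum, ← Finset.sum_add_distrib]
  refine Finset.sum_congr rfl fun a _ => Finset.sum_congr rfl fun b _ => ?_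
  rw [smul_mul_assoc, mul_smul_comm, ← smul_add, ← mul_assoc, h.wu, add_mul, mul_assoc,
    h.ww c b, mul_assoc]

/-- Moving `quad u w X` past the `u c` from the left, or past the `w d` from the right, leads to the
same middle term ∑ Y_{cd} u_c (quad X) w_d; only the correction terms differ. The bracket relation
is written additively because `A` is only a semiring. -/
theorem IsWeyl.quad_lie (h : IsWeyl u w) (X Y : Matrix ι ι ℂ) :
    quad u w X * quad u w Y + quad u w (Y * X) = quad u w Y * quad u w X + quad u w (X * Y) := by
  have h₁ : quad u w X * quad u w Y =
      ∑ c, ∑ d, Y c d • (u c * quad u w X * w d) + quad u w (X * Y) := by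
    have e : quad u w (X * Y) = ∑ c, ∑ d, Y c d • ((∑ a, X a c • u a) * w d) := by
      simp only [quad, Matrix.mul_apply, Finset.sum_smul, Finset.sum_mul, Finset.smul_sum]
      rw [Finset.sum_comm_cycle]
      refine Finset.sum_congr rfl fun c _ => ?_
      rw [Finset.sum_comm]
      refine Finset.sum_congr rfl fun d _ => Finset.sum_congr rfl fun a _ => ?_
      rw [smul_mul_assoc, smul_smul, mul_comm]
    rw [e]
    conv_lhs => rw [quad.eq_1 u w Y]
    simp only [Finset.mul_sum, ← Finset.sum_add_distrib]
    refine Finset.sum_congr rfl fun c _ => Finset.sum_congr rfl fun d _ => ?_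
    rw [mul_smul_comm, ← smul_add, ← mul_assoc, h.quad_mul_u, add_mul]
  have h₂ : quad u w Y * quad u w X =
      ∑ c, ∑ d, Y c d • (u c * quad u w X * w d) + quad u w (Y * X) := by
    have e : quad u w (Y * X) = ∑ c, ∑ d, Y c d • (u c * (∑ a, X d a • w a)) := by
      simp only [quad, Matrix.mul_apply, Finset.sum_smul, Finset.mul_sum, Finset.smul_sum]
      refine Finset.sum_congr rfl fun c _ => ?_
      rw [Finset.sum_comm]
      refine Finset.sum_congr rfl fun d _ => Finset.sum_congr rfl fun a _ => ?_
      rw [mul_smul_comm, smul_smul]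
    rw [e]
    conv_lhs => rw [quad.eq_1 u w Y]
    simp only [Finset.sum_mul, ← Finset.sum_add_distrib]
    refine Finset.sum_congr rfl fun c _ => Finset.sum_congr rfl fun d _ => ?_
    rw [smul_mul_assoc, ← smul_add, mul_assoc, h.w_mul_quad, mul_add, mul_assoc]
  rw [h₁, h₂, add_right_comm]

theorem IsWeyl.quad_mul_sqForm (h : IsWeyl u w) (X : Matrix ι ι ℂ) (ε : ι → ℂ) :
    quad u w X * sqForm ε u =
      sqForm ε u * quad u w X + (2 : ℂ) • ∑ a, ∑ c, (X a c * ε c) • (u a * u c) := by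
  have e : (2 : ℂ) • ∑ a, ∑ c, (X a c * ε c) • (u a * u c) =
      ∑ c, ε c • (u c * (∑ a, X a c • u a) + (∑ a, X a c • u a) * u c) := by
    rw [Finset.sum_comm, Finset.smul_sum]
    refine Finset.sum_congr rfl fun c _ => ?_
    simp only [Finset.mul_sum, Finset.sum_mul, ← Finset.sum_add_distrib, Finset.smul_sum]
    refine Finset.sum_congr rfl fun a _ => ?_
    rw [mul_smul_comm, smul_mul_assoc, h.uu c a, ← two_smul ℂ (X a c • _), smul_smul, smul_smul,
      smul_smul]
    congr 1
    ring
  rw [e, sqForm, Finset.mul_sum, Finset.sum_mul, ← Finset.sum_add_distrib]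
  refine Finset.sum_congr rfl fun c _ => ?_
  rw [mul_smul_comm, smul_mul_assoc, ← smul_add, ← mul_assoc, h.quad_mul_u, add_mul, mul_assoc,
    h.quad_mul_u, mul_add, mul_assoc, add_assoc]

theorem IsWeyl.sqForm_mul_quad (h : IsWeyl u w) (X : Matrix ι ι ℂ) (ε : ι → ℂ) :
    sqForm ε w * quad u w X =
      quad u w X * sqForm ε w + (2 : ℂ) • ∑ a, ∑ c, (ε a * X a c) • (w a * w c) := by
  have e : (2 : ℂ) • ∑ a, ∑ c, (ε a * X a c) • (w a * w c) =
      ∑ a, ε a • ((∑ c, X a c • w c) * w a + w a * (∑ c, X a c • w c)) := by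
    rw [Finset.smul_sum]
    refine Finset.sum_congr rfl fun a _ => ?_
    simp only [Finset.mul_sum, Finset.sum_mul, ← Finset.sum_add_distrib, Finset.smul_sum]
    refine Finset.sum_congr rfl fun c _ => ?_
    rw [mul_smul_comm, smul_mul_assoc, h.ww c a, ← two_smul ℂ (X a c • _), smul_smul, smul_smul,
      smul_smul]
    congr 1
    ring
  rw [e, sqForm, Finset.mul_sum, Finset.sum_mul, ← Finset.sum_add_distrib]
  refine Finset.sum_congr rfl fun c _ => ?_
  rw [mul_smul_comm, smul_mul_assoc, ← smul_add, mul_assoc, h.w_mul_quad, mul_add, ← mul_assoc,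
    h.w_mul_quad, add_mul, mul_assoc, add_assoc]

/-- Interchanging the two indices pairs each term with its negative, so twice the sum is zero. -/
theorem sum_skew_eq_zero (Y : Matrix ι ι ℂ) (hY : ∀ a c, Y a c = -Y c a)
    (hu : ∀ a b, u a * u b = u b * u a) : ∑ a, ∑ c, Y a c • (u a * u c) = 0 := by
  have h2 : (2 : ℂ) • ∑ a, ∑ c, Y a c • (u a * u c) = 0 := by
    rw [two_smul]
    nth_rw 1 [Finset.sum_comm]
    simp only [← Finset.sum_add_distrib]
    refine Finset.sum_eq_zero fun a _ => Finset.sum_eq_zero fun c _ => ?_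
    rw [hY a c, hu a c, ← add_smul, add_neg_cancel, zero_smul]
  rw [← one_smul ℂ (∑ a, ∑ c, Y a c • (u a * u c)), ← inv_mul_cancel₀ (two_ne_zero' ℂ), mul_smul,
    h2, smul_zero]

/-- The hypothesis says that `X` preserves the form `ε` infinitesimally. It makes the coefficients
of the correction term in `IsWeyl.quad_mul_sqForm` antisymmetric, and the `u` commute. -/
theorem IsWeyl.commute_quad_sqForm_u (h : IsWeyl u w) {X : Matrix ι ι ℂ} {ε : ι → ℂ}
    (hX : ∀ a c, X a c * ε c = -(X c a * ε a)) : Commute (quad u w X) (sqForm ε u) := by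
  rw [Commute, SemiconjBy, h.quad_mul_sqForm, sum_skew_eq_zero (fun a c => X a c * ε c) hX h.uu,
    smul_zero, add_zero]

theorem IsWeyl.commute_quad_sqForm_w (h : IsWeyl u w) {X : Matrix ι ι ℂ} {ε : ι → ℂ}
    (hX : ∀ a c, ε a * X a c = -(ε c * X c a)) : Commute (quad u w X) (sqForm ε w) := by
  rw [Commute, SemiconjBy, h.sqForm_mul_quad, sum_skew_eq_zero (fun a c => ε a * X a c) hX h.ww,
    smul_zero, add_zero]

/-- `quad u w 1` is the degree operator, and `quad u w X` has degree zero. -/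
theorem IsWeyl.commute_quad_one (h : IsWeyl u w) (X : Matrix ι ι ℂ) :
    Commute (quad u w X) (quad u w 1) := by
  have : quad u w X * quad u w 1 = quad u w 1 * quad u w X := by
    have e : quad u w X * quad u w 1 = ∑ c, u c * quad u w X * w c + quad u w X := by
      rw [quad_one, Finset.mul_sum]
      have : quad u w X = ∑ c, (∑ a, X a c • u a) * w c := by
        rw [quad, Finset.sum_comm]
        simp [Finset.sum_mul]
      nth_rw 3 [this]
      rw [← Finset.sum_add_distrib]
      exact Finset.sum_congr rfl fun c _ => by rw [← mul_assoc, h.quad_mul_u, add_mul]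
    have e' : quad u w 1 * quad u w X = ∑ c, u c * quad u w X * w c + quad u w X := by
      rw [quad_one, Finset.sum_mul]
      have : quad u w X = ∑ c, u c * (∑ a, X c a • w a) := by
        rw [quad]
        simp [Finset.mul_sum]
      nth_rw 3 [this]
      rw [← Finset.sum_add_distrib]
      exact Finset.sum_congr rfl fun c _ => by
        rw [mul_assoc, h.w_mul_quad, mul_add, mul_assoc]
    rw [e, e']
  exact this

theorem IsWeyl.quad_one_mul_sqForm (h : IsWeyl u w) (ε : ι → ℂ) :
    quad u w 1 * sqForm ε u = sqForm ε u * quad u w 1 + (2 : ℂ) • sqForm ε u := by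
  rw [h.quad_mul_sqForm]
  congr 2
  refine Finset.sum_congr rfl fun a _ => ?_
  rw [Finset.sum_eq_single a]
  · simp
  · intro b _ hb
    simp [Matrix.one_apply_ne hb.symm]
  · simp

theorem IsWeyl.sqForm_mul_quad_one (h : IsWeyl u w) (ε : ι → ℂ) :
    sqForm ε w * quad u w 1 = quad u w 1 * sqForm ε w + (2 : ℂ) • sqForm ε w := by
  rw [h.sqForm_mul_quad]
  congr 2
  refine Finset.sum_congr rfl fun a _ => ?_
  rw [Finset.sum_eq_single a]
  · simp
  · intro b _ hb
    simp [Matrix.one_apply_ne hb.symm]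
  · simp

theorem IsWeyl.sqForm_mul_u (h : IsWeyl u w) (ε : ι → ℂ) (c : ι) :
    sqForm ε w * u c = u c * sqForm ε w + ((2 : ℂ) * ε c) • w c := by
  have : ((2 : ℂ) * ε c) • w c = ∑ a, ε a • ((if a = c then (2 : ℂ) else 0) • w a) := by
    simp [mul_comm, smul_smul]
  rw [this, sqForm, Finset.sum_mul, Finset.mul_sum, ← Finset.sum_add_distrib]
  refine Finset.sum_congr rfl fun a _ => ?_
  rw [smul_mul_assoc, mul_smul_comm, ← smul_add]
  congr 1
  rw [mul_assoc, h.wu, mul_add, ← mul_assoc, h.wu]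
  split_ifs with hac
  · subst hac
    rw [add_mul, mul_one, one_mul, two_smul, mul_assoc, add_assoc]
  · simp [mul_assoc]

/-- The source of [X⁺, X⁻] = H. Each index meets its sign twice, so the signs cancel by `hε`; the
constant counts the relations [w_a, u_a] = 1 and becomes the shift (p+q)/2 in H. -/
theorem IsWeyl.sqForm_mul_sqForm (h : IsWeyl u w) {ε : ι → ℂ} (hε : ∀ a, ε a * ε a = 1) :
    sqForm ε w * sqForm ε u = sqForm ε u * sqForm ε w + (4 : ℂ) • quad u w 1 +
      ((2 : ℂ) * Fintype.card ι) • 1 := by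
  have e : (4 : ℂ) • quad u w 1 + ((2 : ℂ) * Fintype.card ι) • (1 : A) =
      ∑ c, ((4 : ℂ) • (u c * w c) + (2 : ℂ) • 1) := by
    rw [Finset.sum_add_distrib, quad_one, Finset.smul_sum]
    simp [mul_comm, ← Nat.cast_smul_eq_nsmul ℂ, smul_smul]
  rw [add_assoc, e]
  conv_lhs => rw [sqForm.eq_1 ε u]
  conv_rhs => rw [sqForm.eq_1 ε u]
  rw [Finset.sum_mul, Finset.mul_sum, ← Finset.sum_add_distrib]
  refine Finset.sum_congr rfl fun c _ => ?_
  have e2 : sqForm ε w * (u c * u c) =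
      u c * u c * sqForm ε w + ((2 : ℂ) * ε c) • ((2 : ℂ) • (u c * w c) + 1) := by
    rw [← mul_assoc, h.sqForm_mul_u, add_mul, mul_assoc, h.sqForm_mul_u, mul_add, smul_mul_assoc,
      h.wu, if_pos rfl, mul_smul_comm, add_assoc, ← smul_add, two_smul, mul_assoc, add_assoc]
  rw [mul_smul_comm, e2, smul_add, smul_mul_assoc, smul_smul, smul_add, smul_smul]
  have h1 : ε c * (2 * ε c) = 2 := by linear_combination 2 * hε c
  rw [h1]
  norm_num

/-- An element implementing the linear substitution `g` on the generators. -/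
theorem semiconj_quad {s : A} {g : Matrix ι ι ℂ} (hu : ∀ a, s * u a = ∑ b, g b a • (u b * s))
    (hw : ∀ a, s * w a = ∑ b, g b a • (w b * s)) (X : Matrix ι ι ℂ) :
    s * quad u w X = quad u w (g * X * g.transpose) * s := by
  have e : ∀ a b, s * (u a * w b) = ∑ c, ∑ d, (g c a * g d b) • (u c * w d * s) := by
    intro a b
    rw [← mul_assoc, hu, Finset.sum_mul]
    refine Finset.sum_congr rfl fun c _ => ?_
    rw [smul_mul_assoc, mul_assoc, hw, Finset.mul_sum, Finset.smul_sum]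
    refine Finset.sum_congr rfl fun d _ => ?_
    rw [mul_smul_comm, smul_smul, mul_assoc]
  simp only [quad, Finset.mul_sum, mul_smul_comm, e, Finset.sum_mul, Matrix.mul_apply,
    Matrix.transpose_apply, Finset.sum_smul, smul_mul_assoc, Finset.smul_sum, smul_smul]
  -- What remains is to reorder the fourfold sum from (a, b, c, d) to (c, d, b, a).
  calc _ = ∑ a, ∑ b, ∑ c, ∑ d, (X a b * (g c a * g d b)) • (u c * w d * s) := rfl
    _ = ∑ a, ∑ c, ∑ b, ∑ d, (X a b * (g c a * g d b)) • (u c * w d * s) :=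
        Finset.sum_congr rfl fun a _ => Finset.sum_comm
    _ = ∑ c, ∑ a, ∑ b, ∑ d, (X a b * (g c a * g d b)) • (u c * w d * s) := Finset.sum_comm
    _ = ∑ c, ∑ a, ∑ d, ∑ b, (X a b * (g c a * g d b)) • (u c * w d * s) :=
        Finset.sum_congr rfl fun c _ => Finset.sum_congr rfl fun a _ => Finset.sum_comm
    _ = ∑ c, ∑ d, ∑ a, ∑ b, (X a b * (g c a * g d b)) • (u c * w d * s) :=
        Finset.sum_congr rfl fun c _ => Finset.sum_comm
    _ = ∑ c, ∑ d, ∑ b, ∑ a, (X a b * (g c a * g d b)) • (u c * w d * s) :=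
        Finset.sum_congr rfl fun c _ => Finset.sum_congr rfl fun d _ => Finset.sum_comm
    _ = _ := by
        refine Finset.sum_congr rfl fun c _ => Finset.sum_congr rfl fun d _ =>
          Finset.sum_congr rfl fun b _ => Finset.sum_congr rfl fun a _ => ?_
        congr 1
        ring

/-- `semiconj_quad` applied with both families equal to `u`: the square form is the quadratic
element of the diagonal matrix `ε`, which `g` preserves. -/
theorem commute_sqForm_of_isometry {s : A} {g : Matrix ι ι ℂ} {ε : ι → ℂ}
    (hu : ∀ a, s * u a = ∑ b, g b a • (u b * s))
    (hg : g * Matrix.diagonal ε * g.transpose = Matrix.diagonal ε) :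
    Commute s (sqForm ε u) := by
  have h := semiconj_quad hu hu (Matrix.diagonal ε)
  have e : quad u u (Matrix.diagonal ε) = sqForm ε u := by
    refine Finset.sum_congr rfl fun a _ => ?_
    rw [Finset.sum_eq_single a]
    · simp
    · intro b _ hb
      simp [Matrix.diagonal_apply_ne _ hb.symm]
    · simp
  rw [hg, e] at h
  exact h

end Weyl

/-! ### Differential operators with polynomial coefficients on `C^∞(V)` -/

section PolyOps

variable {p q : ℕ}

/-- Complex polynomials on `V = ℝ^p × ℝ^q`. -/
abbrev Pol (p q : ℕ) := MvPolynomial (Fin p ⊕ Fin q) ℂ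

/-- The coordinates of a vector, as complex numbers. -/
def coordC (v : V p q) : Fin p ⊕ Fin q → ℂ :=
  Sum.elim (fun i => (v.1 i : ℂ)) (fun j => (v.2 j : ℂ))

/-- Evaluation of polynomials at a real point. -/
def evalV (v : V p q) : Pol p q →ₐ[ℂ] ℂ := MvPolynomial.aeval (coordC v)

theorem contDiff_coordC (a : Fin p ⊕ Fin q) : ContDiff ℝ ∞ fun v : V p q => coordC v a := by
  rcases a with i | j
  · exact Complex.ofRealCLM.contDiff.comp (by fun_prop : ContDiff ℝ ∞ fun v : V p q => v.1 i)
  · exact Complex.ofRealCLM.contDiff.comp (by fun_prop : ContDiff ℝ ∞ fun v : V p q => v.2 j)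

theorem contDiff_evalV (P : Pol p q) : ContDiff ℝ ∞ fun v : V p q => evalV v P := by
  induction P using MvPolynomial.induction_on with
  | C a => simpa [evalV] using contDiff_const
  | add f g hf hg => simpa using hf.add hg
  | mul_X f a hf =>
    simp only [map_mul]
    refine hf.mul ?_
    simpa [evalV] using contDiff_coordC a

/-- Multiplication by a polynomial. -/
def polyMul : Pol p q →ₐ[ℂ] Module.End ℂ (Smooth p q) where
  toFun P :=
    { toFun := fun f => ⟨fun v => evalV v P * f.1 v,
        Set.mem_ofPred.2 ((contDiff_evalV P).mul (Smooth.contDiff f))⟩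
      map_add' := fun f g => Subtype.ext (funext fun v => mul_add _ _ _)
      map_smul' := fun c f => Subtype.ext (funext fun v => mul_left_comm _ _ _) }
  map_one' := by
    ext1 f
    exact Subtype.ext (funext fun v => by
      change evalV v 1 * f.1 v = f.1 v
      simp)
  map_mul' P Q := by
    ext1 f
    exact Subtype.ext (funext fun v => by
      change evalV v (P * Q) * f.1 v = evalV v P * (evalV v Q * f.1 v)
      rw [map_mul, mul_assoc])
  map_zero' := by
    ext1 f
    exact Subtype.ext (funext fun v => by
      change evalV v 0 * f.1 v = 0
      simp)
  map_add' P Q := by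
    ext1 f
    exact Subtype.ext (funext fun v => by
      change evalV v (P + Q) * f.1 v = evalV v P * f.1 v + evalV v Q * f.1 v
      rw [map_add, add_mul])
  commutes' c := by
    ext1 f
    exact Subtype.ext (funext fun v => by
      change evalV v (algebraMap ℂ _ c) * f.1 v = c * f.1 v
      rw [AlgHom.commutes]
      rfl)

theorem polyMul_apply (P : Pol p q) (f : Smooth p q) (v : V p q) :
    (polyMul P f).1 v = evalV v P * f.1 v := rfl

theorem smooth_ext {f g : Smooth p q} (h : ∀ v, f.1 v = g.1 v) : f = g :=
  Subtype.ext (funext h)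

/-- The coordinate derivatives. -/
def dd : Fin p ⊕ Fin q → Module.End ℂ (Smooth p q) := Sum.elim dx dy

/-- The coordinate vector fields. -/
def basisV : Fin p ⊕ Fin q → V p q :=
  Sum.elim (fun i => (Pi.single i 1, 0)) (fun j => (0, Pi.single j 1))

theorem dd_eq (a : Fin p ⊕ Fin q) : dd a = dirDeriv (basisV a : V p q) := by
  rcases a with i | j <;> rfl

theorem dirDeriv_apply (u : V p q) (f : Smooth p q) (v : V p q) :
    (dirDeriv u f).1 v = fderiv ℝ f.1 v u := rfl

theorem mx_eq (i : Fin p) : (mx i : Module.End ℂ (Smooth p q)) =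
    polyMul (MvPolynomial.X (Sum.inl i)) := by
  ext1 f
  refine smooth_ext fun v => ?_
  rw [polyMul_apply]
  simp only [evalV, MvPolynomial.aeval_X]
  rfl

theorem my_eq (j : Fin q) : (my j : Module.End ℂ (Smooth p q)) =
    polyMul (MvPolynomial.X (Sum.inr j)) := by
  ext1 f
  refine smooth_ext fun v => ?_
  rw [polyMul_apply]
  simp only [evalV, MvPolynomial.aeval_X]
  rfl

theorem dirDeriv_comm (u v : V p q) : Commute (dirDeriv u) (dirDeriv v) := by
  ext1 f
  refine smooth_ext fun x => ?_
  have hd : DifferentiableAt ℝ (fderiv ℝ f.1) x :=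
    ((ContDiff.fderiv_right (m := ∞) (Smooth.contDiff f) (by simp)).differentiable
      (by simp)).differentiableAt
  have h : ∀ a b : V p q, ((dirDeriv a * dirDeriv b) f).1 x = fderiv ℝ (fderiv ℝ f.1) x a b := by
    intro a b
    change fderiv ℝ (fun y => fderiv ℝ f.1 y b) x a = _
    rw [fderiv_clm_apply hd (differentiableAt_const b)]
    simp
  rw [h, h]
  have hs : IsSymmSndFDerivAt ℝ f.1 x :=
    (Smooth.contDiff f).contDiffAt.isSymmSndFDerivAt (by
      simpa using WithTop.coe_le_coe.2 (le_top : (2 : ℕ∞) ≤ ⊤))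
  exact hs.eq u v

theorem fderiv_coordC (a b : Fin p ⊕ Fin q) (v : V p q) :
    fderiv ℝ (fun v : V p q => coordC v b) v (basisV a) = if a = b then 1 else 0 := by
  have h : ∀ L : V p q →L[ℝ] ℂ, (fun v : V p q => coordC v b) = L →
      fderiv ℝ (fun v : V p q => coordC v b) v (basisV a) = coordC (basisV a) b := by
    intro L hL
    rw [hL, L.fderiv, ← hL]
  have e : coordC (basisV a : V p q) b = if a = b then 1 else 0 := by
    rcases a with i | i <;> rcases b with j | j <;>
      simp [coordC, basisV, Pi.single_apply, eq_comm] <;> split_ifs <;> simp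
  rw [← e]
  rcases b with j | j
  · exact h (Complex.ofRealCLM ∘L (ContinuousLinearMap.proj j) ∘L
      ContinuousLinearMap.fst ℝ _ _) rfl
  · exact h (Complex.ofRealCLM ∘L (ContinuousLinearMap.proj j) ∘L
      ContinuousLinearMap.snd ℝ _ _) rfl

theorem dd_polyMul_X (a b : Fin p ⊕ Fin q) :
    (dd a * polyMul (MvPolynomial.X b) : Module.End ℂ (Smooth p q)) =
      polyMul (MvPolynomial.X b) * dd a + if a = b then 1 else 0 := by
  ext1 f
  refine smooth_ext fun v => ?_
  have e : (polyMul (MvPolynomial.X b) f).1 = fun v => coordC v b * f.1 v := by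
    funext v
    rw [polyMul_apply]
    simp [evalV]
  have h : ((dd a * polyMul (MvPolynomial.X b)) f).1 v =
      coordC v b * fderiv ℝ f.1 v (basisV a) + (if a = b then 1 else 0) * f.1 v := by
    rw [dd_eq]
    change fderiv ℝ (polyMul (MvPolynomial.X b) f).1 v (basisV a) = _
    rw [e, fderiv_fun_mul ((contDiff_coordC b).differentiable (by simp)).differentiableAt
      (Smooth.differentiableAt f v)]
    simp only [add_apply, smul_apply, fderiv_coordC,
      smul_eq_mul]
    ring
  rw [h]
  have h2 : ((polyMul (MvPolynomial.X b) * dd a + if a = b then 1 else 0 :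
      Module.End ℂ (Smooth p q)) f).1 v =
      (polyMul (MvPolynomial.X b) (dd a f)).1 v +
        ((if a = b then 1 else 0 : Module.End ℂ (Smooth p q)) f).1 v := rfl
  rw [h2, polyMul_apply, dd_eq, dirDeriv_apply]
  congr 1
  · simp [evalV]
  · split_ifs <;> simp

theorem dd_polyMul (a : Fin p ⊕ Fin q) (P : Pol p q) :
    (dd a * polyMul P : Module.End ℂ (Smooth p q)) =
      polyMul P * dd a + polyMul (MvPolynomial.pderiv a P) := by
  induction P using MvPolynomial.induction_on with
  | C c =>
    have : (polyMul (MvPolynomial.C c) : Module.End ℂ (Smooth p q)) = algebraMap ℂ _ c :=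
      polyMul.commutes c
    rw [this, MvPolynomial.pderiv_C, map_zero, add_zero, Algebra.commutes]
  | add f g hf hg => simp only [map_add, mul_add, add_mul, hf, hg]; abel
  | mul_X f b hf =>
    rw [map_mul, ← mul_assoc, hf, add_mul, mul_assoc, dd_polyMul_X, Derivation.leibniz,
      MvPolynomial.pderiv_X, map_add, smul_eq_mul, smul_eq_mul, map_mul, map_mul, mul_add,
      ← mul_assoc, add_assoc]
    congr 1
    have hc : polyMul (MvPolynomial.pderiv a f) * polyMul (MvPolynomial.X b) =
        (polyMul (MvPolynomial.X b) * polyMul (MvPolynomial.pderiv a f) :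
          Module.End ℂ (Smooth p q)) := by
      rw [← map_mul, mul_comm, map_mul]
    rw [hc]
    congr 2
    rw [Pi.single_apply]
    simp only [eq_comm (a := b)]
    split_ifs <;> simp

theorem dd_polyMul_apply (a : Fin p ⊕ Fin q) (P : Pol p q) (f : Smooth p q) :
    dd a (polyMul P f) = polyMul P (dd a f) + polyMul (MvPolynomial.pderiv a P) f :=
  congrArg (fun T : Module.End ℂ (Smooth p q) => T f) (dd_polyMul a P)

theorem dd_comm (a b : Fin p ⊕ Fin q) : Commute (dd a : Module.End ℂ (Smooth p q)) (dd b) := by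
  rw [dd_eq, dd_eq]
  exact dirDeriv_comm _ _

theorem polyMul_comm (P Q : Pol p q) : Commute (polyMul P) (polyMul Q) := by
  rw [Commute, SemiconjBy, ← map_mul, mul_comm, map_mul]

/-! ### The operators in terms of canonical generators -/

/-- The creation operators `x_i`, `√-1 ∂_{y_j}`. -/
def uOp : Fin p ⊕ Fin q → Module.End ℂ (Smooth p q) :=
  Sum.elim (fun i => mx i) (fun j => Complex.I • dy j)

/-- The annihilation operators `∂_{x_i}`, `√-1 y_j`. -/
def wOp : Fin p ⊕ Fin q → Module.End ℂ (Smooth p q) :=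
  Sum.elim (fun i => dx i) (fun j => Complex.I • my j)

/-- The signature of the quadratic form. -/
def sgn : Fin p ⊕ Fin q → ℂ := Sum.elim (fun _ => 1) (fun _ => -1)

theorem dx_eq (i : Fin p) : (dx i : Module.End ℂ (Smooth p q)) = dd (Sum.inl i) := rfl

theorem dy_eq (j : Fin q) : (dy j : Module.End ℂ (Smooth p q)) = dd (Sum.inr j) := rfl

/-- In the y-block position and derivative exchange their roles and both carry a factor √-1, whose
square turns [y, ∂_y] = -1 into +1. This twist lets the compact and noncompact parts of 𝔤 be treated
by one formula. -/
theorem isWeyl : IsWeyl (uOp : Fin p ⊕ Fin q → Module.End ℂ (Smooth p q)) wOp where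
  uu := by
    rintro (i | i) (j | j)
    · simp only [uOp, Sum.elim_inl, mx_eq]
      exact polyMul_comm _ _
    · simp only [uOp, Sum.elim_inl, Sum.elim_inr, mx_eq, dy_eq, mul_smul_comm, smul_mul_assoc,
        dd_polyMul_X]
      simp
    · simp only [uOp, Sum.elim_inl, Sum.elim_inr, mx_eq, dy_eq, mul_smul_comm, smul_mul_assoc,
        dd_polyMul_X]
      simp
    · simp only [uOp, Sum.elim_inr, mul_smul_comm, smul_mul_assoc, dy_eq]
      rw [dd_comm]
  ww := by
    rintro (i | i) (j | j)
    · simp only [wOp, Sum.elim_inl, dx_eq]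
      exact dd_comm _ _
    · simp only [wOp, Sum.elim_inl, Sum.elim_inr, my_eq, dx_eq, mul_smul_comm, smul_mul_assoc,
        dd_polyMul_X]
      simp
    · simp only [wOp, Sum.elim_inl, Sum.elim_inr, my_eq, dx_eq, mul_smul_comm, smul_mul_assoc,
        dd_polyMul_X]
      simp
    · simp only [wOp, Sum.elim_inr, mul_smul_comm, smul_mul_assoc, my_eq]
      rw [polyMul_comm]
  wu := by
    rintro (i | i) (j | j)
    · simp only [uOp, wOp, Sum.elim_inl, mx_eq, dx_eq]
      exact dd_polyMul_X _ _
    · simp only [uOp, wOp, Sum.elim_inl, Sum.elim_inr, dx_eq, dy_eq, mul_smul_comm,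
        smul_mul_assoc]
      rw [dd_comm]
      simp
    · simp only [uOp, wOp, Sum.elim_inl, Sum.elim_inr, mx_eq, my_eq, mul_smul_comm,
        smul_mul_assoc]
      rw [polyMul_comm]
      simp
    · simp only [uOp, wOp, Sum.elim_inr, my_eq, dy_eq, mul_smul_comm, smul_mul_assoc,
        dd_polyMul_X, smul_smul, Complex.I_mul_I, Sum.inr.injEq]
      by_cases h : i = j
      · subst h
        have e : ((-1 : ℂ) • (1 : Module.End ℂ (Smooth p q)) + 1) = 0 := by
          ext1 f
          simp
        rw [if_pos rfl, smul_add, add_assoc, e, add_zero]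
      · simp [h, Ne.symm h]

theorem so_skew {X : Matrix (Fin p ⊕ Fin q) (Fin p ⊕ Fin q) ℂ}
    (hX : X ∈ LieAlgebra.Orthogonal.so' (Fin p) (Fin q) ℂ) (a c : Fin p ⊕ Fin q) :
    X a c * sgn c = -(X c a * sgn a) := by
  have h := (mem_𝔤_iff X).1 hX
  have e : (Matrix.fromBlocks 1 0 0 (-1) : Matrix (Fin p ⊕ Fin q) (Fin p ⊕ Fin q) ℂ) =
      Matrix.diagonal sgn := by
    rw [← Matrix.diagonal_one, ← Matrix.diagonal_one, Matrix.diagonal_neg,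
      Matrix.fromBlocks_diagonal]
    rfl
  rw [e] at h
  have h' := congrFun (congrFun h c) a
  rw [Matrix.mul_diagonal, Matrix.diagonal_mul, Matrix.transpose_apply, Matrix.neg_apply] at h'
  have h2 : ∀ a : Fin p ⊕ Fin q, sgn a * sgn a = 1 := by
    rintro (i | i) <;> simp [sgn]
  linear_combination (sgn a * sgn c) * h' - X a c * sgn c * h2 a - X c a * sgn a * h2 c

/-- In the lower right block the order of y and ∂_y is reversed. The extra term is a diagonal entry,
which is zero by skewness, and the sign from √-1 squared is absorbed by transposing a skew block. In
the mixed block the symmetric entries combine the two halves. -/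
theorem piG_eq (X : 𝔤 p q) : piG p q X = quad uOp wOp X.1 := by
  have h := fun a c => so_skew X.2 a c
  simp only [quad, Fintype.sum_sum_type, uOp, wOp, Sum.elim_inl, Sum.elim_inr]
  have hLR : ∀ i j, X.1 (Sum.inr j) (Sum.inl i) = X.1 (Sum.inl i) (Sum.inr j) := by
    intro i j
    have := h (Sum.inr j) (Sum.inl i)
    simp only [sgn, Sum.elim_inl, Sum.elim_inr, mul_one, mul_neg] at this
    linear_combination this
  have hD : ∑ i, ∑ j, X.1 (Sum.inr i) (Sum.inr j) • (my i * dy j) =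
      (∑ i, ∑ j, X.1 (Sum.inr i) (Sum.inr j) •
        ((Complex.I • dy i) * (Complex.I • my j)) : Module.End ℂ (Smooth p q)) := by
    rw [Finset.sum_comm]
    refine Finset.sum_congr rfl fun i _ => Finset.sum_congr rfl fun j _ => ?_
    have := h (Sum.inr j) (Sum.inr i)
    simp only [sgn, Sum.elim_inr, mul_one, mul_neg, neg_neg] at this
    have h1 : X.1 (Sum.inr j) (Sum.inr i) = -X.1 (Sum.inr i) (Sum.inr j) := by
      linear_combination -this
    rw [h1, smul_mul_assoc, mul_smul_comm, smul_smul Complex.I, Complex.I_mul_I, dy_eq, my_eq,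
      dd_polyMul_X]
    by_cases hij : i = j
    · subst hij
      have : X.1 (Sum.inr i) (Sum.inr i) = 0 := by linear_combination (1 / 2) * h1
      simp [this]
    · simp only [Sum.inr.injEq, hij, if_false, add_zero, smul_smul]
      congr 1
      ring
  have hB : ∑ i, ∑ j, (X.1 (Sum.inl i) (Sum.inr j) * Complex.I) • (mx i * my j + dx i * dy j) =
      (∑ i, ∑ j, X.1 (Sum.inl i) (Sum.inr j) • (mx i * (Complex.I • my j)) +
       ∑ j, ∑ i, X.1 (Sum.inr j) (Sum.inl i) • ((Complex.I • dy j) * dx i) :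
        Module.End ℂ (Smooth p q)) := by
    rw [Finset.sum_comm (f := fun j i => X.1 (Sum.inr j) (Sum.inl i) • _)]
    rw [← Finset.sum_add_distrib]
    refine Finset.sum_congr rfl fun i _ => ?_
    rw [← Finset.sum_add_distrib]
    refine Finset.sum_congr rfl fun j _ => ?_
    rw [hLR, mul_smul_comm, smul_mul_assoc, smul_smul, smul_smul, ← smul_add, dx_eq, dy_eq,
      dd_comm (Sum.inr j)]
  have hE : piG p q X = ∑ i, ∑ j, X.1 (Sum.inl i) (Sum.inl j) • (mx i * dx j) +
    ∑ i, ∑ j, X.1 (Sum.inr i) (Sum.inr j) • (my i * dy j) +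
    ∑ i, ∑ j, (X.1 (Sum.inl i) (Sum.inr j) * Complex.I) • (mx i * my j + dx i * dy j) := rfl
  rw [hE, hD, hB]
  simp only [Finset.sum_add_distrib]
  abel

theorem opXm_eq : opXm p q = ((1 : ℂ) / 2) • sqForm sgn uOp := by
  simp only [opXm, sqForm, Fintype.sum_sum_type, uOp, sgn, Sum.elim_inl, Sum.elim_inr, one_smul,
    smul_mul_assoc, mul_smul_comm, smul_smul]
  congr 3
  ext1 j
  simp

theorem opXp_eq : opXp p q = -((1 : ℂ) / 2) • sqForm sgn wOp := by
  simp only [opXp, sqForm, Fintype.sum_sum_type, wOp, sgn, Sum.elim_inl, Sum.elim_inr, one_smul,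
    smul_mul_assoc, mul_smul_comm, smul_smul]
  congr 3
  ext1 j
  simp

theorem opH_apply (f : Smooth p q) :
    opH p q f = -(∑ i, mx i (dx i f)) - ((p : ℂ) / 2) • f + (∑ j, my j (dy j f)) +
      ((q : ℂ) / 2) • f := by
  simp only [opH, LinearMap.add_apply, LinearMap.sub_apply, LinearMap.neg_apply,
    LinearMap.sum_apply, LinearMap.smul_apply, Module.End.mul_apply, Module.End.one_apply]

/-- Normal ordering in the y-block contributes q, and q - (p+q)/2 = (q-p)/2. -/
theorem opH_eq (f : Smooth p q) :
    opH p q f = -quad uOp wOp 1 f - (((p : ℂ) + q) / 2) • f := by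
  have e : (∑ j, (Complex.I • dy j) * (Complex.I • my j) : Module.End ℂ (Smooth p q)) f =
      (-1 : ℂ) • (∑ j, my j (dy j f)) - (q : ℂ) • f := by
    have : ∀ j, ((Complex.I • dy j) * (Complex.I • my j) : Module.End ℂ (Smooth p q)) f =
        (-1 : ℂ) • my j (dy j f) - f := by
      intro j
      rw [smul_mul_assoc, mul_smul_comm, smul_smul, Complex.I_mul_I, dy_eq, my_eq, dd_polyMul_X,
        if_pos rfl]
      simp only [LinearMap.smul_apply, LinearMap.add_apply, Module.End.mul_apply,
        Module.End.one_apply]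
      module
    rw [LinearMap.sum_apply]
    simp only [this, Finset.sum_sub_distrib, Finset.smul_sum]
    congr 1
    simp [← Nat.cast_smul_eq_nsmul ℂ]
  rw [quad_one, opH_apply]
  simp only [Fintype.sum_sum_type, uOp, wOp, Sum.elim_inl, Sum.elim_inr, LinearMap.add_apply, e]
  simp only [LinearMap.sum_apply, Module.End.mul_apply]
  module

theorem sgn_mul_self (a : Fin p ⊕ Fin q) : sgn a * sgn a = 1 := by
  rcases a with i | i <;> simp [sgn]

theorem opH_opXp (f : Smooth p q) :
    opH p q (opXp p q f) = opXp p q (opH p q f) + (2 : ℂ) • opXp p q f := by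
  have h := congrArg (fun T : Module.End ℂ (Smooth p q) => T f)
    ((isWeyl (p := p) (q := q)).sqForm_mul_quad_one sgn)
  simp only [LinearMap.add_apply, Module.End.mul_apply, LinearMap.smul_apply] at h
  simp only [opH_eq, opXp_eq, LinearMap.smul_apply, map_smul, map_sub, map_neg, h]
  module

theorem opH_opXm (f : Smooth p q) :
    opH p q (opXm p q f) = opXm p q (opH p q f) - (2 : ℂ) • opXm p q f := by
  have h := congrArg (fun T : Module.End ℂ (Smooth p q) => T f)
    ((isWeyl (p := p) (q := q)).quad_one_mul_sqForm sgn)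
  simp only [LinearMap.add_apply, Module.End.mul_apply, LinearMap.smul_apply] at h
  simp only [opH_eq, opXm_eq, LinearMap.smul_apply, map_smul, map_sub, map_neg, h]
  module

theorem opXp_opXm (f : Smooth p q) :
    opXp p q (opXm p q f) = opXm p q (opXp p q f) + opH p q f := by
  have h := congrArg (fun T : Module.End ℂ (Smooth p q) => T f)
    ((isWeyl (p := p) (q := q)).sqForm_mul_sqForm sgn_mul_self)
  simp only [LinearMap.add_apply, Module.End.mul_apply, LinearMap.smul_apply, Fintype.card_sum,
    Fintype.card_fin, Nat.cast_add, Module.End.one_apply] at h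
  simp only [opH_eq, opXm_eq, opXp_eq, LinearMap.smul_apply, map_smul, h]
  module

theorem piG_lie (X Y : 𝔤 p q) (f : Smooth p q) :
    piG p q ⁅X, Y⁆ f = piG p q X (piG p q Y f) - piG p q Y (piG p q X f) := by
  have h := congrArg (fun T : Module.End ℂ (Smooth p q) => T f) (isWeyl.quad_lie X.1 Y.1)
  simp only [LinearMap.add_apply, Module.End.mul_apply] at h
  have e : quad uOp wOp (X.1 * Y.1) f = quad uOp wOp (⁅X, Y⁆ : 𝔤 p q).1 f +
      quad uOp wOp (Y.1 * X.1) f := by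
    have : X.1 * Y.1 = (⁅X, Y⁆ : 𝔤 p q).1 + Y.1 * X.1 := (sub_add_cancel _ _).symm
    rw [this]
    simp [quad, add_smul, Finset.sum_add_distrib]
  rw [piG_eq, piG_eq, piG_eq, eq_sub_iff_add_eq]
  rw [e, ← add_assoc] at h
  rw [add_comm]
  exact (add_right_cancel h).symm

theorem piG_opH (X : 𝔤 p q) (f : Smooth p q) :
    piG p q X (opH p q f) = opH p q (piG p q X f) := by
  have h := congrArg (fun T : Module.End ℂ (Smooth p q) => T f)
    (isWeyl.commute_quad_one X.1).eq
  simp only [Module.End.mul_apply] at h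
  simp only [piG_eq, opH_eq, map_sub, map_neg, map_smul, h]

theorem commute_piG_opXm (X : 𝔤 p q) : Commute (piG p q X) (opXm p q) := by
  rw [piG_eq, opXm_eq]
  exact (isWeyl.commute_quad_sqForm_u (so_skew X.2)).smul_right _

theorem commute_piG_opXp (X : 𝔤 p q) : Commute (piG p q X) (opXp p q) := by
  rw [piG_eq, opXp_eq]
  refine (isWeyl.commute_quad_sqForm_w fun a c => ?_).smul_right _
  linear_combination (sgn a * sgn c) * so_skew X.2 a c - sgn a * X.1 a c * sgn_mul_self c -
    sgn c * X.1 c a * sgn_mul_self a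

/-! ### The action of `K` -/

/-- The block matrix of `k`. -/
def kMat (k : K p q) : Matrix (Fin p ⊕ Fin q) (Fin p ⊕ Fin q) ℂ := blockDiag k.1.1 k.2.1

/-- The linear action of `k⁻¹` on `V`. -/
def kInvAct (k : K p q) : V p q →L[ℝ] V p q :=
  ContinuousLinearMap.prodMap (Matrix.mulVecLin k⁻¹.1.1).toContinuousLinearMap
    (Matrix.mulVecLin k⁻¹.2.1).toContinuousLinearMap

theorem piK_apply (k : K p q) (f : Smooth p q) (v : V p q) :
    (piK p q k f).1 v = f.1 (kInvAct k v) := rfl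

theorem coordC_kInvAct (k : K p q) (v : V p q) (a : Fin p ⊕ Fin q) :
    coordC (kInvAct k v) a = ∑ b, kMat k b a * coordC v b := by
  rcases a with i | i
  · have : (kInvAct k v).1 i = ∑ j, k.1.1 j i * v.1 j := rfl
    simp [coordC, Fintype.sum_sum_type, kMat, blockDiag, this]
  · have : (kInvAct k v).2 i = ∑ j, k.2.1 j i * v.2 j := rfl
    simp [coordC, Fintype.sum_sum_type, kMat, blockDiag, this]

theorem kInvAct_basisV (k : K p q) (a : Fin p ⊕ Fin q) :
    kInvAct k (basisV a) = ∑ b, (kMat k a b).re • (basisV b : V p q) := by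
  rcases a with i | i <;> ext j
  all_goals
    first
    | (have h : ∀ w : V p q, (kInvAct k w).1 j = ∑ j', k.1.1 j' j * w.1 j' := fun _ => rfl
       rw [h])
    | (have h : ∀ w : V p q, (kInvAct k w).2 j = ∑ j', k.2.1 j' j * w.2 j' := fun _ => rfl
       rw [h])
    simp [basisV, Fintype.sum_sum_type, kMat, blockDiag, Prod.fst_sum, Prod.snd_sum,
      Finset.sum_apply, Pi.single_apply]

theorem kMat_re (k : K p q) (a b : Fin p ⊕ Fin q) : ((kMat k a b).re : ℂ) = kMat k a b := by
  rcases a with i | i <;> rcases b with j | j <;> simp [kMat, blockDiag]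

theorem piK_mul_polyMul_X (k : K p q) (a : Fin p ⊕ Fin q) :
    piK p q k * polyMul (MvPolynomial.X a) =
      ∑ b, kMat k b a • (polyMul (MvPolynomial.X b) * piK p q k) := by
  ext1 f
  refine smooth_ext fun v => ?_
  have h : ((∑ b, kMat k b a • (polyMul (MvPolynomial.X b) * piK p q k)) f).1 v =
      ∑ b, kMat k b a * (coordC v b * f.1 (kInvAct k v)) := by
    rw [LinearMap.sum_apply, AddSubmonoidClass.coe_finsetSum, Finset.sum_apply]
    refine Finset.sum_congr rfl fun b _ => ?_
    change kMat k b a * (evalV v (MvPolynomial.X b) * f.1 (kInvAct k v)) = _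
    simp [evalV]
  rw [h, Module.End.mul_apply, piK_apply, polyMul_apply]
  simp only [evalV, MvPolynomial.aeval_X, coordC_kInvAct, Finset.sum_mul, mul_assoc]

theorem dd_mul_piK (k : K p q) (a : Fin p ⊕ Fin q) :
    dd a * piK p q k = ∑ b, kMat k a b • (piK p q k * dd b) := by
  ext1 f
  refine smooth_ext fun v => ?_
  have h : ((∑ b, kMat k a b • (piK p q k * dd b)) f).1 v =
      ∑ b, kMat k a b * fderiv ℝ f.1 (kInvAct k v) (basisV b) := by
    rw [LinearMap.sum_apply, AddSubmonoidClass.coe_finsetSum, Finset.sum_apply]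
    refine Finset.sum_congr rfl fun b _ => ?_
    rw [dd_eq]
    rfl
  rw [h, dd_eq]
  change fderiv ℝ (f.1 ∘ kInvAct k) v (basisV a) = _
  rw [fderiv_comp _ (Smooth.differentiableAt f _) (kInvAct k).differentiableAt,
    ContinuousLinearMap.fderiv, ContinuousLinearMap.comp_apply, kInvAct_basisV, map_sum]
  refine Finset.sum_congr rfl fun b _ => ?_
  rw [map_smul, Complex.real_smul, kMat_re]

theorem kMat_inv (k : K p q) : kMat k⁻¹ = (kMat k).transpose := by
  rw [kMat, kMat, blockDiag, blockDiag, Matrix.fromBlocks_transpose]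
  congr 1

theorem kMat_mul_transpose (k : K p q) : kMat k * (kMat k).transpose = 1 := by
  have h : ∀ k l : K p q, kMat k * kMat l = kMat (k * l) := by
    intro k l
    simp only [kMat, blockDiag, Matrix.fromBlocks_multiply, Matrix.mul_zero, Matrix.zero_mul,
      add_zero, zero_add]
    congr 1 <;> exact (Matrix.map_mul (f := Complex.ofRealHom)).symm
  have h1 : kMat (1 : K p q) = 1 := by
    rw [kMat, blockDiag, ← Matrix.fromBlocks_one]
    congr 1 <;> exact Matrix.map_one _ Complex.ofReal_zero Complex.ofReal_one
  rw [← kMat_inv, h, mul_inv_cancel, h1]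

theorem kMat_transpose_mul (k : K p q) : (kMat k).transpose * kMat k = 1 :=
  mul_eq_one_comm.1 (kMat_mul_transpose k)

/-- The chain rule gives derivatives transforming by the matrix on the other side; orthogonality
inverts it, so derivatives transform by the same matrix as the coordinates. This is what allows
`semiconj_quad` to be used. -/
theorem piK_mul_dd (k : K p q) (a : Fin p ⊕ Fin q) :
    piK p q k * dd a = ∑ b, kMat k b a • (dd b * piK p q k) := by
  simp only [dd_mul_piK, Finset.smul_sum, smul_smul]
  rw [Finset.sum_comm, Finset.sum_eq_single a]
  · rw [← Finset.sum_smul]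
    have := congrFun (congrFun (kMat_transpose_mul k) a) a
    rw [Matrix.mul_apply, Matrix.one_apply_eq] at this
    simp only [Matrix.transpose_apply] at this
    rw [this, one_smul]
  · intro b _ hb
    rw [← Finset.sum_smul]
    have := congrFun (congrFun (kMat_transpose_mul k) a) b
    rw [Matrix.mul_apply, Matrix.one_apply_ne hb.symm] at this
    simp only [Matrix.transpose_apply] at this
    rw [this, zero_smul]
  · simp

theorem kMat_inl_inr (k : K p q) (i : Fin p) (j : Fin q) :
    kMat k (Sum.inl i) (Sum.inr j) = 0 := by simp [kMat, blockDiag]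

theorem kMat_inr_inl (k : K p q) (i : Fin p) (j : Fin q) :
    kMat k (Sum.inr j) (Sum.inl i) = 0 := by simp [kMat, blockDiag]

theorem piK_mul_uOp (k : K p q) (a : Fin p ⊕ Fin q) :
    piK p q k * uOp a = ∑ b, kMat k b a • (uOp b * piK p q k) := by
  rcases a with i | i
  · simp only [uOp, Sum.elim_inl, mx_eq, piK_mul_polyMul_X, Fintype.sum_sum_type, kMat_inr_inl,
      zero_smul, Finset.sum_const_zero]
  · simp only [uOp, Sum.elim_inr, dy_eq, mul_smul_comm, piK_mul_dd, Fintype.sum_sum_type,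
      kMat_inl_inr, zero_smul, Finset.sum_const_zero, zero_add, smul_mul_assoc, Finset.smul_sum,
      smul_comm Complex.I]

theorem piK_mul_wOp (k : K p q) (a : Fin p ⊕ Fin q) :
    piK p q k * wOp a = ∑ b, kMat k b a • (wOp b * piK p q k) := by
  rcases a with i | i
  · simp only [wOp, Sum.elim_inl, dx_eq, piK_mul_dd, Fintype.sum_sum_type, kMat_inr_inl,
      zero_smul, Finset.sum_const_zero]
  · simp only [wOp, Sum.elim_inr, my_eq, mul_smul_comm, piK_mul_polyMul_X, Fintype.sum_sum_type,
      kMat_inl_inr, zero_smul, Finset.sum_const_zero, zero_add, smul_mul_assoc, Finset.smul_sum,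
      smul_comm Complex.I]

theorem kMat_isometry (k : K p q) :
    kMat k * Matrix.diagonal sgn * (kMat k).transpose = Matrix.diagonal sgn := by
  have h : kMat k * Matrix.diagonal sgn = Matrix.diagonal sgn * kMat k := by
    ext a b
    rw [Matrix.mul_diagonal, Matrix.diagonal_mul]
    rcases a with i | i <;> rcases b with j | j <;> simp [kMat, blockDiag, sgn]
  rw [h, mul_assoc, kMat_mul_transpose, mul_one]

theorem commute_piK_opXm (k : K p q) : Commute (piK p q k) (opXm p q) := by
  rw [opXm_eq]
  exact (commute_sqForm_of_isometry (piK_mul_uOp k) (kMat_isometry k)).smul_right _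

theorem commute_piK_opXp (k : K p q) : Commute (piK p q k) (opXp p q) := by
  rw [opXp_eq]
  exact (commute_sqForm_of_isometry (piK_mul_wOp k) (kMat_isometry k)).smul_right _

theorem piK_opH (k : K p q) (f : Smooth p q) :
    piK p q k (opH p q f) = opH p q (piK p q k f) := by
  have h := congrArg (fun T : Module.End ℂ (Smooth p q) => T f)
    (semiconj_quad (piK_mul_uOp k) (piK_mul_wOp k) 1)
  rw [mul_one, kMat_mul_transpose] at h
  simp only [Module.End.mul_apply] at h
  simp only [opH_eq, map_sub, map_neg, map_smul, h]

theorem piK_piG (k : K p q) (X : 𝔤 p q) (f : Smooth p q) :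
    piK p q k (piG p q X f) = piG p q (Ad k X) (piK p q k f) := by
  have h := congrArg (fun T : Module.End ℂ (Smooth p q) => T f)
    (semiconj_quad (piK_mul_uOp k) (piK_mul_wOp k) X.1)
  simp only [Module.End.mul_apply] at h
  rw [piG_eq, piG_eq, h, ← kMat_inv]
  rfl

end PolyOps

open MvPolynomial

/-! ### The Fischer inner product -/

section Fischer

variable {σ : Type*}

/-- The product of the factorials of the exponents. -/
def multiFact (s : σ →₀ ℕ) : ℕ := s.prod fun _ k => k.factorial

theorem multiFact_pos (s : σ →₀ ℕ) : 0 < multiFact s :=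
  Finset.prod_pos fun _ _ => Nat.factorial_pos _

theorem multiFact_sub_single (s : σ →₀ ℕ) (i : σ) (hi : s i ≠ 0) :
    multiFact s = s i * multiFact (s - Finsupp.single i 1) := by
  classical
  have h : s = (s - Finsupp.single i 1) + Finsupp.single i 1 :=
    (tsub_add_cancel_of_le (by simpa using Nat.one_le_iff_ne_zero.2 hi)).symm
  set t := s - Finsupp.single i 1 with ht
  have hs : s i = t i + 1 := by rw [h]; simp
  have h1 := Finsupp.mul_prod_erase' s i (fun _ k => k.factorial) (fun _ => rfl)
  have h2 := Finsupp.mul_prod_erase' t i (fun _ k => k.factorial) (fun _ => rfl)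
  have h3 : s.erase i = t.erase i := by
    ext j
    by_cases hj : j = i
    · subst hj; simp
    · rw [Finsupp.erase_ne hj, Finsupp.erase_ne hj, h]
      simp [Ne.symm hj]
  rw [multiFact, ← h1, multiFact, ← h2, h3, hs, Nat.factorial_succ]
  ring

/-- The Fischer inner product `∑ s! * conj (coeff s f) * coeff s g`, linear in `g`. -/
def fischer (f : MvPolynomial σ ℂ) : MvPolynomial σ ℂ →ₗ[ℂ] ℂ :=
  (MvPolynomial.basisMonomials σ ℂ).constr ℂ
    fun s => (multiFact s : ℂ) * (starRingEnd ℂ) (coeff s f)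

theorem fischer_monomial (f : MvPolynomial σ ℂ) (s : σ →₀ ℕ) (c : ℂ) :
    fischer f (monomial s c) = c * ((multiFact s : ℂ) * (starRingEnd ℂ) (coeff s f)) := by
  have h : monomial s c = c • MvPolynomial.basisMonomials σ ℂ s := by
    simp [smul_monomial]
  rw [h, map_smul, fischer, Module.Basis.constr_basis, smul_eq_mul]

theorem fischer_eq_sum (f g : MvPolynomial σ ℂ) :
    fischer f g =
      ∑ s ∈ g.support, (multiFact s : ℂ) * (starRingEnd ℂ) (coeff s f) * coeff s g := by
  conv_lhs => rw [g.as_sum]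
  rw [map_sum]
  refine Finset.sum_congr rfl fun s _ => ?_
  rw [fischer_monomial]
  ring

theorem fischer_eq_sum' (f g : MvPolynomial σ ℂ) {t : Finset (σ →₀ ℕ)} (ht : g.support ⊆ t) :
    fischer f g = ∑ s ∈ t, (multiFact s : ℂ) * (starRingEnd ℂ) (coeff s f) * coeff s g := by
  rw [fischer_eq_sum]
  refine Finset.sum_subset ht fun s _ hs => ?_
  rw [notMem_support_iff.1 hs, mul_zero]

theorem fischer_add_left (f g h : MvPolynomial σ ℂ) :
    fischer (f + g) h = fischer f h + fischer g h := by
  simp only [fischer_eq_sum, coeff_add, map_add, ← Finset.sum_add_distrib]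
  exact Finset.sum_congr rfl fun s _ => by ring

theorem fischer_smul_left (c : ℂ) (f g : MvPolynomial σ ℂ) :
    fischer (c • f) g = (starRingEnd ℂ) c * fischer f g := by
  simp only [fischer_eq_sum, coeff_smul, smul_eq_mul, map_mul, Finset.mul_sum]
  exact Finset.sum_congr rfl fun s _ => by ring

theorem fischer_conj (f g : MvPolynomial σ ℂ) :
    (starRingEnd ℂ) (fischer f g) = fischer g f := by
  classical
  rw [fischer_eq_sum' f g (Finset.subset_union_right (s₁ := f.support)),
    fischer_eq_sum' g f (Finset.subset_union_left (s₂ := g.support)), map_sum]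
  refine Finset.sum_congr rfl fun s _ => ?_
  simp only [map_mul, Complex.conj_conj, Complex.conj_natCast]
  ring

theorem fischer_self (f : MvPolynomial σ ℂ) :
    fischer f f = ((∑ s ∈ f.support, (multiFact s : ℝ) * Complex.normSq (coeff s f) : ℝ) : ℂ) := by
  rw [fischer_eq_sum]
  push_cast
  refine Finset.sum_congr rfl fun s _ => ?_
  rw [Complex.normSq_eq_conj_mul_self]
  ring

theorem fischer_self_eq_zero {f : MvPolynomial σ ℂ} (h : fischer f f = 0) : f = 0 := by
  rw [fischer_self, Complex.ofReal_eq_zero, Finset.sum_eq_zero_iff_of_nonneg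
    fun s _ => mul_nonneg (Nat.cast_nonneg _) (Complex.normSq_nonneg _)] at h
  ext s
  by_contra hs
  have := h s (mem_support_iff.2 hs)
  rw [mul_eq_zero, Complex.normSq_eq_zero] at this
  rcases this with h1 | h1
  · exact (multiFact_pos s).ne' (by exact_mod_cast h1)
  · exact hs (by simpa using h1)

/-- The factorial weights are chosen for this adjunction: on monomials it is s! = s_i · (s - e_i)!.
-/
theorem fischer_X_mul (i : σ) (f g : MvPolynomial σ ℂ) :
    fischer (X i * f) g = fischer f (pderiv i g) := by
  classical
  induction g using MvPolynomial.induction_on' with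
  | add g h hg hh => rw [map_add, map_add, map_add, hg, hh]
  | monomial s c =>
    rw [fischer_monomial, pderiv_monomial, fischer_monomial, coeff_X_mul']
    by_cases hi : s i = 0
    · simp [hi]
    · rw [if_pos (Finsupp.mem_support_iff.2 hi), multiFact_sub_single s i hi]
      push_cast
      ring

theorem fischer_one (g : MvPolynomial σ ℂ) : fischer 1 g = coeff 0 g := by
  classical
  induction g using MvPolynomial.induction_on' with
  | add g h hg hh => rw [map_add, hg, hh, coeff_add]
  | monomial s c =>
    rw [fischer_monomial, coeff_one, coeff_monomial]
    by_cases hs : 0 = s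
    · subst hs; simp [multiFact]
    · simp [hs, Ne.symm hs]

end Fischer

section Harmonic

variable {n : ℕ}

/-- The polynomial `∑ x_i ^ 2`. -/
def sqNorm (n : ℕ) : MvPolynomial (Fin n) ℂ := ∑ i, X i ^ 2

theorem fischer_sum_left {σ ι : Type*} (s : Finset ι) (f : ι → MvPolynomial σ ℂ)
    (g : MvPolynomial σ ℂ) : fischer (∑ i ∈ s, f i) g = ∑ i ∈ s, fischer (f i) g := by
  classical
  induction s using Finset.induction_on with
  | empty =>
    have : fischer (0 : MvPolynomial σ ℂ) g = 0 := by simp [fischer_eq_sum]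
    simpa using this
  | insert a s ha ih => rw [Finset.sum_insert ha, Finset.sum_insert ha, fischer_add_left, ih]

/-- Consequently multiples of ∑ x_i² are orthogonal to harmonic polynomials. Most uses of the
Fischer product below come down to this. -/
theorem fischer_sqNorm_mul (f g : MvPolynomial (Fin n) ℂ) :
    fischer (sqNorm n * f) g = fischer f (polyLaplacian n g) := by
  simp only [sqNorm, Finset.sum_mul, fischer_sum_left, polyLaplacian, LinearMap.sum_apply, map_sum,
    LinearMap.comp_apply, Derivation.coeFn_coe]
  refine Finset.sum_congr rfl fun i _ => ?_
  rw [pow_two, mul_assoc, fischer_X_mul, fischer_X_mul]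

theorem coeff_zero_polySubst (g : Matrix (Fin n) (Fin n) ℝ) (f : MvPolynomial (Fin n) ℂ) :
    coeff 0 (polySubst g f) = coeff 0 f := by
  have h : ∀ f : MvPolynomial (Fin n) ℂ, coeff 0 f = constantCoeff f := fun _ => rfl
  rw [h, h]
  induction f using MvPolynomial.induction_on with
  | C a => simp [polySubst]
  | add f g hf hg => simp only [map_add, hf, hg]
  | mul_X f i _ => simp [polySubst_X]

theorem orth_sum (g : Orth n) (i k : Fin n) : ∑ j, ((g.1 j i : ℝ) : ℂ) * ((g.1 j k : ℝ) : ℂ) =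
    if i = k then 1 else 0 := by
  have h := congrFun (congrFun (Matrix.mem_orthogonalGroup_iff' (Fin n) ℝ |>.1 g.2) i) k
  simp only [Matrix.mul_apply, Matrix.one_apply, Matrix.transpose_apply] at h
  have h' := congrArg (fun x : ℝ => (x : ℂ)) h
  simpa [apply_ite] using h'

/-- By induction on `f`: a factor X_i crosses the product as a derivative, and orthogonality of `g`
collapses the double sum created by the chain rule. -/
theorem fischer_polySubst (g : Orth n) (f h : MvPolynomial (Fin n) ℂ) :
    fischer (polySubst g.1 f) (polySubst g.1 h) = fischer f h := by
  induction f using MvPolynomial.induction_on generalizing h with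
  | C a =>
    have e : polySubst g.1 (C a) = a • (1 : MvPolynomial (Fin n) ℂ) := by
      simp [polySubst, smul_eq_C_mul]
    have e' : (C a : MvPolynomial (Fin n) ℂ) = a • 1 := by simp [smul_eq_C_mul]
    rw [e, e', fischer_smul_left, fischer_smul_left, fischer_one, fischer_one,
      coeff_zero_polySubst]
  | add f₁ f₂ h₁ h₂ => rw [map_add, fischer_add_left, h₁, h₂, fischer_add_left]
  | mul_X f i ih =>
    rw [map_mul, polySubst_X, mul_comm, Finset.sum_mul, fischer_sum_left, mul_comm f,
      fischer_X_mul, ← ih]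
    have e : ∀ j, fischer (C ((g.1 j i : ℝ) : ℂ) * X j * polySubst g.1 f) (polySubst g.1 h) =
        ∑ k, ((g.1 j i : ℝ) : ℂ) * ((g.1 j k : ℝ) : ℂ) *
          fischer (polySubst g.1 f) (polySubst g.1 (pderiv k h)) := by
      intro j
      rw [mul_assoc, ← smul_eq_C_mul, fischer_smul_left, fischer_X_mul, pderiv_polySubst, map_sum,
        Finset.mul_sum, Complex.conj_ofReal]
      refine Finset.sum_congr rfl fun k _ => ?_
      rw [← smul_eq_C_mul, map_smul, smul_eq_mul, mul_assoc]
    simp only [e]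
    rw [Finset.sum_comm, Finset.sum_eq_single i]
    · rw [← Finset.sum_mul, orth_sum]
      simp
    · intro k _ hk
      rw [← Finset.sum_mul, orth_sum, if_neg hk.symm, zero_mul]
    · simp

/-- The Fischer inner product on a space of polynomials. -/
abbrev fischerCore (S : Submodule ℂ (MvPolynomial (Fin n) ℂ)) : InnerProductSpace.Core ℂ S where
  inner f g := fischer f.1 g.1
  conj_inner_symm f g := fischer_conj g.1 f.1
  re_inner_nonneg f := by
    change 0 ≤ (fischer f.1 f.1).re
    rw [fischer_self, Complex.ofReal_re]
    exact Finset.sum_nonneg fun s _ => mul_nonneg (Nat.cast_nonneg _) (Complex.normSq_nonneg _)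
  add_left f g h := fischer_add_left f.1 g.1 h.1
  smul_left f g c := fischer_smul_left c f.1 g.1
  definite f h := Subtype.ext (fischer_self_eq_zero h)

/-- The Riesz representation theorem, with the norm introduced only inside the proof. -/
theorem exists_inner_repr {W : Type*} [AddCommGroup W] [Module ℂ W] [FiniteDimensional ℂ W]
    (c : InnerProductSpace.Core ℂ W) (φ : W →ₗ[ℂ] ℂ) :
    ∃ w : W, ∀ f : W, φ f = c.inner w f := by
  let _ : NormedAddCommGroup W := c.toNormedAddCommGroup
  let _ : InnerProductSpace ℂ W := InnerProductSpace.ofCore c.toCore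
  have : CompleteSpace W := FiniteDimensional.complete ℂ W
  let L : StrongDual ℂ W := LinearMap.toContinuousLinearMap φ
  refine ⟨(InnerProductSpace.toDual ℂ W).symm L, fun f => ?_⟩
  exact (InnerProductSpace.toDual_symm_apply (x := f) (y := L)).symm

/-- Linear functionals on a space of polynomials are represented by the Fischer inner product. -/
theorem exists_fischer_repr (S : Submodule ℂ (MvPolynomial (Fin n) ℂ)) [FiniteDimensional ℂ S]
    (φ : S →ₗ[ℂ] ℂ) : ∃ w ∈ S, ∀ f : S, φ f = fischer w f.1 := by
  obtain ⟨w, hw⟩ := exists_inner_repr (fischerCore S) φ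
  exact ⟨w.1, w.2, hw⟩

/-! ### Evaluation at real points -/

/-- Evaluation at a real point. -/
def evalR (x : Fin n → ℝ) : MvPolynomial (Fin n) ℂ →ₐ[ℂ] ℂ := aeval fun i => (x i : ℂ)

theorem evalR_X (x : Fin n → ℝ) (i : Fin n) : evalR x (X i) = x i := by simp [evalR]

theorem polynomial_ext_real {f g : MvPolynomial (Fin n) ℂ}
    (h : ∀ x : Fin n → ℝ, evalR x f = evalR x g) : f = g := by
  refine MvPolynomial.funext_set (fun _ => Set.range Complex.ofReal)
    (fun _ => Set.infinite_range_of_injective Complex.ofReal_injective) fun x hx => ?_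
  choose y hy using fun i => hx i (Set.mem_univ i)
  have := h y
  simp only [evalR, hy] at this
  simpa [aeval_eq_eval] using this

theorem evalR_sqNorm (x : Fin n → ℝ) : evalR x (sqNorm n) = ((∑ i, x i ^ 2 : ℝ) : ℂ) := by
  simp [sqNorm, evalR]

theorem evalR_polySubst (g : Matrix (Fin n) (Fin n) ℝ) (x : Fin n → ℝ)
    (f : MvPolynomial (Fin n) ℂ) :
    evalR x (polySubst g f) = evalR (g.transpose.mulVec x) f := by
  have h : (evalR x).comp (polySubst g) = evalR (g.transpose.mulVec x) := by
    apply MvPolynomial.algHom_ext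
    intro i
    simp only [AlgHom.comp_apply, polySubst_X, evalR_X, map_sum, map_mul]
    simp [evalR, Matrix.mulVec, dotProduct]
  exact congrArg (fun φ : MvPolynomial (Fin n) ℂ →ₐ[ℂ] ℂ => φ f) h

theorem evalR_smul {k : ℕ} {f : MvPolynomial (Fin n) ℂ} (hf : f.IsHomogeneous k) (t : ℝ)
    (x : Fin n → ℝ) : evalR (t • x) f = (t : ℂ) ^ k * evalR x f := by
  simp only [evalR, aeval_def, eval₂_eq', Finset.mul_sum]
  refine Finset.sum_congr rfl fun s hs => ?_
  have hk : ∑ i, s i = k := by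
    have := hf (mem_support_iff.1 hs)
    rw [Finsupp.weight_apply, Finsupp.sum_fintype _ _ (by simp)] at this
    simpa using this
  rw [mul_left_comm, ← hk, ← Finset.prod_pow_eq_pow_sum, ← Finset.prod_mul_distrib]
  congr 1
  exact Finset.prod_congr rfl fun i _ => by simp [mul_pow]

/-- A reflection exchanging two vectors of the same length. -/
theorem exists_orth_map (x y : Fin n → ℝ) (h : ∑ i, x i ^ 2 = ∑ i, y i ^ 2) :
    ∃ g : Orth n, g.1.mulVec x = y ∧ g.1.transpose = g.1 ∧
      ∀ z : Fin n → ℝ, ∑ i, z i * x i = ∑ i, z i * y i → g.1.mulVec z = z := by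
  by_cases hxy : x = y
  · exact ⟨1, by simp [hxy], by simp, fun z _ => by simp⟩
  set v : Fin n → ℝ := x - y with hv
  have hvv : v ⬝ᵥ v ≠ 0 := by
    rw [Ne, dotProduct_self_eq_zero]
    exact sub_ne_zero.2 hxy
  -- `G` will be the reflection in the hyperplane orthogonal to v = x - y. Equal lengths give v·v =
  -- 2 v·x, so `G` takes x to y.
  set c : ℝ := 2 / (v ⬝ᵥ v) with hc
  let G : Matrix (Fin n) (Fin n) ℝ := 1 - c • Matrix.vecMulVec v v
  have hG : ∀ z, G.mulVec z = z - (c * (v ⬝ᵥ z)) • v := by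
    intro z
    simp only [G, Matrix.sub_mulVec, Matrix.one_mulVec, Matrix.smul_mulVec,
      Matrix.vecMulVec_mulVec]
    rw [mul_smul]
    congr 2
    ext i
    simp [mul_comm]
  have hGt : G.transpose = G := by
    simp [G, Matrix.transpose_sub, Matrix.transpose_smul, Matrix.transpose_vecMulVec]
  have hGG : G * G = 1 := by
    apply Matrix.ext_of_mulVec_single
    intro i
    rw [← Matrix.mulVec_mulVec, hG, hG, dotProduct_sub, dotProduct_smul, Matrix.one_mulVec,
      smul_eq_mul]
    have : c * (v ⬝ᵥ Pi.single i 1 - c * (v ⬝ᵥ Pi.single i 1) * (v ⬝ᵥ v)) =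
        -(c * (v ⬝ᵥ Pi.single i 1)) := by
      rw [hc]
      field_simp
      ring
    rw [this]
    module
  have hx2 : x ⬝ᵥ x = y ⬝ᵥ y := by
    simpa [dotProduct, pow_two] using h
  refine ⟨⟨G, (Matrix.mem_orthogonalGroup_iff (Fin n) ℝ).2 (by
    change G * G.transpose = 1
    rw [hGt, hGG])⟩, ?_, hGt, ?_⟩
  · change G.mulVec x = y
    rw [hG]
    have : c * (v ⬝ᵥ x) = 1 := by
      have h1 : v ⬝ᵥ v = 2 * (v ⬝ᵥ x) := by
        simp only [hv, sub_dotProduct, dotProduct_sub]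
        rw [dotProduct_comm y x, hx2]
        ring
      rw [hc, h1]
      have : v ⬝ᵥ x ≠ 0 := fun h0 => hvv (by rw [h1, h0, mul_zero])
      field_simp
    rw [this, one_smul, hv]
    abel
  · intro z hz
    change G.mulVec z = z
    rw [hG]
    have : v ⬝ᵥ z = 0 := by
      rw [hv, sub_dotProduct, dotProduct_comm, dotProduct_comm y]
      exact sub_eq_zero.2 hz
    rw [this]
    simp

end Harmonic

open MvPolynomial

/-! ### Invariant functionals on harmonic polynomials -/

section Zonal

variable {n : ℕ}

theorem mem_Harm {d : ℕ} {f : MvPolynomial (Fin n) ℂ} :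
    f ∈ Harm d n ↔ f.IsHomogeneous d ∧ polyLaplacian n f = 0 := by
  rw [Harm, Submodule.mem_inf, mem_homogeneousSubmodule, LinearMap.mem_ker]

theorem support_sum_eq {k : ℕ} {f : MvPolynomial (Fin n) ℂ} (hf : f.IsHomogeneous k)
    {s : Fin n →₀ ℕ} (hs : s ∈ f.support) : ∑ i, s i = k := by
  have := hf (mem_support_iff.1 hs)
  rw [Finsupp.weight_apply, Finsupp.sum_fintype _ _ (by simp)] at this
  simpa using this

theorem fischer_X_pow (i : Fin n) (k : ℕ) (f : MvPolynomial (Fin n) ℂ) :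
    fischer (X i ^ k) f = (k.factorial : ℂ) * coeff (Finsupp.single i k) f := by
  have e : ∀ s : Fin n →₀ ℕ, (multiFact s : ℂ) * (starRingEnd ℂ) (coeff s (X i ^ k)) =
      if Finsupp.single i k = s then (k.factorial : ℂ) else 0 := by
    intro s
    rw [coeff_X_pow]
    split_ifs with h
    · subst h
      simp [multiFact]
    · simp
  rw [fischer_eq_sum]
  simp only [e, ite_mul, zero_mul]
  rw [Finset.sum_ite_eq]
  split_ifs with h
  · rfl
  · rw [notMem_support_iff.1 h, mul_zero]

theorem evalR_single {k : ℕ} {f : MvPolynomial (Fin n) ℂ} (hf : f.IsHomogeneous k) (i : Fin n) :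
    evalR (Pi.single i 1) f = coeff (Finsupp.single i k) f := by
  classical
  have e : ∀ s ∈ f.support, coeff s f * ∏ j, ((Pi.single i 1 : Fin n → ℝ) j : ℂ) ^ s j =
      if Finsupp.single i k = s then coeff s f else 0 := by
    intro s hs
    split_ifs with h
    · subst h
      rw [Finset.prod_eq_one, mul_one]
      intro j _
      by_cases hj : j = i
      · subst hj; simp
      · simp [Ne.symm hj]
    · have : ∃ j, j ≠ i ∧ s j ≠ 0 := by
        by_contra! hcon
        apply h
        ext j
        by_cases hj : j = i
        · subst hj
          have := support_sum_eq hf hs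
          rw [Finset.sum_eq_single j (fun l _ hl => hcon l hl) (by simp)] at this
          simp [this]
        · simp [Ne.symm hj, hcon j hj]
      obtain ⟨j, hj, hsj⟩ := this
      rw [Finset.prod_eq_zero (Finset.mem_univ j), mul_zero]
      simp [hj, hsj]
  simp only [evalR, aeval_def, eval₂_eq', Algebra.algebraMap_self, RingHom.id_apply]
  rw [Finset.sum_congr rfl e, Finset.sum_ite_eq]
  split_ifs with h
  · rfl
  · rw [notMem_support_iff.1 h]

/-- A homogeneous polynomial fixed by the stabilizer of the first basis vector is, modulo
`∑ x_i ^ 2`, a multiple of a power of the first coordinate. -/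
theorem exists_eq_add_sqNorm_mul {k : ℕ} {f : MvPolynomial (Fin (n + 1)) ℂ}
    (hf : f.IsHomogeneous k)
    (hfix : ∀ g : Orth (n + 1), g.1.mulVec (Pi.single 0 1) = Pi.single 0 1 →
      polySubst g.1 f = f) :
    ∃ (c : ℂ) (u : MvPolynomial (Fin (n + 1)) ℂ), f = c • X 0 ^ k + sqNorm (n + 1) * u := by
  classical
  rcases n with _ | n
  -- In one variable a homogeneous polynomial is already a multiple of X₀^k.
  · refine ⟨∑ s ∈ f.support, coeff s f, 0, ?_⟩
    rw [mul_zero, add_zero, Finset.sum_smul]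
    conv_lhs => rw [f.as_sum]
    refine Finset.sum_congr rfl fun s hs => ?_
    have h := support_sum_eq hf hs
    rw [Fin.sum_univ_one] at h
    have : s = Finsupp.single 0 k := by
      ext i
      rw [show i = 0 from Fin.fin_one_eq_zero i, h]
      simp
    rw [this, X_pow_eq_monomial, smul_monomial, smul_eq_mul, mul_one]
  -- Reflections fixing e₀ show that f(x) = f(x₀, ±t, 0, …, 0) with t² = |x|² - x₀². Averaging over
  -- the sign keeps the monomials even in t, and `u` is the result with t² replaced by |x|² - x₀².
  let S := f.support.filter fun s => Even (s 1) ∧ ∀ i, i ≠ 0 → i ≠ 1 → s i = 0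
  let u : MvPolynomial (Fin (n + 1 + 1)) ℂ := ∑ s ∈ S, C (coeff s f) *
    (X 0 ^ s 0 * (sqNorm (n + 1 + 1) - X 0 ^ 2) ^ (s 1 / 2))
  have hu : f = u := by
    refine polynomial_ext_real fun x => ?_
    set t : ℝ := Real.sqrt (∑ i, x i ^ 2 - x 0 ^ 2) with ht
    have htt : t ^ 2 = ∑ i, x i ^ 2 - x 0 ^ 2 := by
      rw [ht, Real.sq_sqrt]
      rw [sub_nonneg]
      exact Finset.single_le_sum (f := fun i => x i ^ 2) (fun i _ => sq_nonneg _)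
        (Finset.mem_univ 0)
    have key : ∀ τ : ℝ, τ ^ 2 = t ^ 2 →
        evalR x f = evalR (Pi.single 0 (x 0) + Pi.single 1 τ) f := by
      intro τ hτ
      -- The two points have the same first coordinate, so the reflection exchanging them fixes e₀.
      obtain ⟨g, hg1, hg2, hg3⟩ := exists_orth_map x (Pi.single 0 (x 0) + Pi.single 1 τ) (by
        have e : ∀ y : Fin (n + 1 + 1) → ℝ, (∀ i : Fin n, y i.succ.succ = 0) →
            ∑ i, y i ^ 2 = y 0 ^ 2 + y 1 ^ 2 := by
          intro y hy
          rw [Fin.sum_univ_succ, Fin.sum_univ_succ]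
          simp [hy]
        refine Eq.trans ?_ (e _ fun i => ?_).symm
        · simp [hτ, htt]
        · have h1 : i.succ.succ ≠ 1 := fun h => Fin.succ_ne_zero i (Fin.succ_injective _ h)
          simp [h1])
      have hfx := hfix g (hg3 _ (by
        simp [Pi.single_apply, ite_mul]))
      rw [← hg1]
      conv_lhs => rw [← hfx, evalR_polySubst, hg2]
    have hev : ∀ τ : ℝ, evalR (Pi.single 0 (x 0) + Pi.single 1 τ) f =
        ∑ s ∈ f.support, if (∀ i, i ≠ 0 → i ≠ 1 → s i = 0) then
          coeff s f * ((x 0 : ℂ) ^ s 0 * (τ : ℂ) ^ s 1) else 0 := by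
      intro τ
      simp only [evalR, aeval_def, eval₂_eq', Algebra.algebraMap_self, RingHom.id_apply]
      refine Finset.sum_congr rfl fun s _ => ?_
      split_ifs with h
      · congr 1
        rw [← Finset.prod_subset (Finset.subset_univ {0, 1})]
        · rw [Finset.prod_pair (by simp)]
          simp
        · intro i _ hi
          simp only [Finset.mem_insert, Finset.mem_singleton, not_or] at hi
          rw [h i hi.1 hi.2, pow_zero]
      · push Not at h
        obtain ⟨i, h0, h1, hi⟩ := h
        rw [Finset.prod_eq_zero (Finset.mem_univ i), mul_zero]
        simp [h0, h1, hi]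
    have h2 : evalR x f = (evalR (Pi.single 0 (x 0) + Pi.single 1 t) f +
        evalR (Pi.single 0 (x 0) + Pi.single 1 (-t)) f) / 2 := by
      rw [← key t rfl, ← key (-t) (by ring)]
      ring
    rw [h2, hev, hev, ← Finset.sum_add_distrib, Finset.sum_div]
    simp only [u, S, map_sum, map_mul, map_pow, map_sub, evalR_X, evalR_sqNorm]
    rw [Finset.sum_filter]
    refine Finset.sum_congr rfl fun s _ => ?_
    have hC : evalR x (C (coeff s f)) = coeff s f := by simp [evalR]
    have htC : ((∑ i, x i ^ 2 : ℝ) : ℂ) - (x 0 : ℂ) ^ 2 = (t : ℂ) ^ 2 := by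
      rw [← Complex.ofReal_pow, ← Complex.ofReal_pow, htt, Complex.ofReal_sub]
    by_cases h : ∀ i, i ≠ 0 → i ≠ 1 → s i = 0
    · rw [if_pos h, if_pos h, hC, htC]
      by_cases he : Even (s 1)
      · rw [if_pos ⟨he, h⟩]
        obtain ⟨j, hj⟩ := he
        have : s 1 / 2 = j := by omega
        rw [this, ← pow_mul, hj, Complex.ofReal_neg, Even.neg_pow ⟨j, rfl⟩, two_mul]
        ring
      · rw [if_neg fun hh => he hh.1, Complex.ofReal_neg, (Nat.not_even_iff_odd.1 he).neg_pow]
        ring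
    · rw [if_neg h, if_neg h, if_neg fun hh => h hh.2]
      simp
  -- Modulo |x|² the factor |x|² - x₀² is -x₀², so every term becomes a multiple of x₀^k.
  have hdvd : ∀ s ∈ S, ∃ v, C (coeff s f) *
      (X 0 ^ s 0 * (sqNorm (n + 1 + 1) - X 0 ^ 2) ^ (s 1 / 2)) =
      (coeff s f * (-1) ^ (s 1 / 2)) • X 0 ^ k + sqNorm (n + 1 + 1) * v := by
    intro s hs
    obtain ⟨hsf, he, h⟩ := Finset.mem_filter.1 hs
    obtain ⟨w, hw⟩ := sub_dvd_pow_sub_pow (sqNorm (n + 1 + 1) - X 0 ^ 2) (-X 0 ^ 2) (s 1 / 2)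
    have hk : s 0 + 2 * (s 1 / 2) = k := by
      rw [← support_sum_eq hf hsf, Nat.mul_div_cancel' he.two_dvd,
        ← Finset.sum_subset (Finset.subset_univ {0, 1}), Finset.sum_pair (by simp)]
      intro i _ hi
      simp only [Finset.mem_insert, Finset.mem_singleton, not_or] at hi
      exact h i hi.1 hi.2
    refine ⟨C (coeff s f) * X 0 ^ s 0 * w, ?_⟩
    rw [sub_eq_iff_eq_add] at hw
    rw [hw, smul_eq_C_mul, C_mul, ← hk, pow_add, pow_mul (X 0) 2 (s 1 / 2),
      neg_pow ((X 0 : MvPolynomial (Fin (n + 1 + 1)) ℂ) ^ 2), map_pow, C_neg, C_1]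
    ring
  choose! v hv using hdvd
  refine ⟨∑ s ∈ S, coeff s f * (-1) ^ (s 1 / 2), ∑ s ∈ S, v s, ?_⟩
  rw [Finset.sum_smul, Finset.mul_sum, ← Finset.sum_add_distrib]
  exact hu.trans (Finset.sum_congr rfl hv)

/-- In the Fischer product of f with itself, the multiple of |x|² is orthogonal to the harmonic f,
and the power of x₀ pairs with f to a multiple of f(e₀) = 0. -/
theorem harm_fixed_eq_zero {k : ℕ} {f : MvPolynomial (Fin (n + 1)) ℂ} (hf : f ∈ Harm k (n + 1))
    (hfix : ∀ g : Orth (n + 1), g.1.mulVec (Pi.single 0 1) = Pi.single 0 1 →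
      polySubst g.1 f = f) (h0 : evalR (Pi.single 0 1) f = 0) : f = 0 := by
  obtain ⟨hh, hL⟩ := mem_Harm.1 hf
  obtain ⟨c, u, hcu⟩ := exists_eq_add_sqNorm_mul hh hfix
  apply fischer_self_eq_zero
  have : fischer (c • X 0 ^ k + sqNorm (n + 1) * u) f = 0 := by
    rw [fischer_add_left, fischer_smul_left, fischer_X_pow, fischer_sqNorm_mul, hL, map_zero,
      ← evalR_single hh, h0]
    simp
  rwa [← hcu] at this

instance (d n : ℕ) : FiniteDimensional ℂ (Harm d n) := by
  have : FiniteDimensional ℂ (homogeneousSubmodule (Fin n) ℂ d) :=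
    Module.Finite.iff_fg.2 (homogeneousSubmodule_fg (Fin n) ℂ d)
  exact Submodule.finiteDimensional_of_le (inf_le_left (b := LinearMap.ker (polyLaplacian n)))

theorem harmRep_apply {d : ℕ} (g : Orth n) (f : Harm d n) :
    (harmRep d n g f).1 = polySubst g.1 f.1 := rfl

/-- A functional fixed by the stabilizer of the first basis vector is a multiple of the evaluation
there. -/
theorem exists_eq_evalR {k : ℕ} (φ : Harm k (n + 1) →ₗ[ℂ] ℂ)
    (hφ : ∀ g : Orth (n + 1), g.1.mulVec (Pi.single 0 1) = Pi.single 0 1 →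
      ∀ f, φ (harmRep k (n + 1) g f) = φ f) :
    ∃ c : ℂ, ∀ f, φ f = c * evalR (Pi.single 0 1) f.1 := by
  -- The vector representing an invariant functional is invariant, because the Fischer product is.
  have fixed : ∀ (ψ : Harm k (n + 1) →ₗ[ℂ] ℂ) (w : MvPolynomial (Fin (n + 1)) ℂ),
      w ∈ Harm k (n + 1) → (∀ f, ψ f = fischer w f.1) →
      (∀ g : Orth (n + 1), g.1.mulVec (Pi.single 0 1) = Pi.single 0 1 →
        ∀ f, ψ (harmRep k (n + 1) g f) = ψ f) →
      ∀ g : Orth (n + 1), g.1.mulVec (Pi.single 0 1) = Pi.single 0 1 → polySubst g.1 w = w := by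
    intro ψ w hw hψ hψ' g hg
    have hd : polySubst g.1 w - w ∈ Harm k (n + 1) :=
      Submodule.sub_mem _ (polySubst_mem_Harm g hw) hw
    rw [← sub_eq_zero]
    apply fischer_self_eq_zero
    set d := polySubst g.1 w - w with hdd
    have hsurj : ∃ f : Harm k (n + 1), harmRep k (n + 1) g f = ⟨d, hd⟩ :=
      ⟨harmRep k (n + 1) g⁻¹ ⟨d, hd⟩, by
        rw [← Module.End.mul_apply, ← map_mul, mul_inv_cancel, map_one, Module.End.one_apply]⟩
    obtain ⟨f, hf⟩ := hsurj
    have hf' : polySubst g.1 f.1 = d := congrArg Subtype.val hf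
    have e1 : fischer (polySubst g.1 w) d = fischer w d := by
      rw [← hf', fischer_polySubst, hf', ← hψ, ← hψ' g hg f, hf, hψ]
    have e2 : polySubst g.1 w = d + w := by rw [hdd]; ring
    rw [e2, fischer_add_left] at e1
    simpa using e1
  obtain ⟨w, hw, hwφ⟩ := exists_fischer_repr (Harm k (n + 1)) φ
  let ev : Harm k (n + 1) →ₗ[ℂ] ℂ :=
    (evalR (Pi.single 0 1)).toLinearMap ∘ₗ (Harm k (n + 1)).subtype
  have hev : ∀ f, ev f = evalR (Pi.single 0 1) f.1 := fun f => rfl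
  have hevfix : ∀ g : Orth (n + 1), g.1.mulVec (Pi.single 0 1) = Pi.single 0 1 →
      ∀ f, ev (harmRep k (n + 1) g f) = ev f := by
    intro g hg f
    rw [hev, hev, harmRep_apply, evalR_polySubst]
    congr 2
    have h1 : g.1.transpose * g.1 = 1 := (Matrix.mem_orthogonalGroup_iff' _ ℝ).1 g.2
    calc g.1.transpose.mulVec (Pi.single 0 1)
        = g.1.transpose.mulVec (g.1.mulVec (Pi.single 0 1)) := by rw [hg]
      _ = Pi.single 0 1 := by rw [Matrix.mulVec_mulVec, h1, Matrix.one_mulVec]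
  obtain ⟨z, hz, hzev⟩ := exists_fischer_repr (Harm k (n + 1)) ev
  have hwfix := fixed φ w hw hwφ hφ
  have hzfix := fixed ev z hz hzev hevfix
  -- A fixed harmonic polynomial is determined by its value at e₀, so `w` is a multiple of the
  -- vector `z` representing the evaluation, provided z(e₀) ≠ 0. If z(e₀) = 0, then `z`, hence the
  -- evaluation, and hence `w` vanish.
  by_cases hz0 : evalR (Pi.single 0 1) z = 0
  · have z0 : z = 0 := harm_fixed_eq_zero hz hzfix hz0
    have hev0 : ∀ f, ev f = 0 := by
      intro f
      rw [hzev, z0]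
      simp [fischer_eq_sum]
    have : w = 0 := harm_fixed_eq_zero hw hwfix (hev0 ⟨w, hw⟩)
    refine ⟨0, fun f => ?_⟩
    rw [hwφ, this]
    simp [fischer_eq_sum]
  · set c := evalR (Pi.single 0 1) w / evalR (Pi.single 0 1) z with hc
    have : w - c • z = 0 := by
      refine harm_fixed_eq_zero (Submodule.sub_mem _ hw (Submodule.smul_mem _ _ hz)) ?_ ?_
      · intro g hg
        rw [map_sub, map_smul, hwfix g hg, hzfix g hg]
      · rw [map_sub, map_smul, hc, smul_eq_mul, div_mul_cancel₀ _ hz0, sub_self]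
    rw [sub_eq_zero] at this
    refine ⟨(starRingEnd ℂ) c, fun f => ?_⟩
    rw [hwφ, this, fischer_smul_left, ← hzev, hev]

/-- An intertwining map between spaces of harmonic polynomials is scalar on the unit sphere. -/
theorem exists_scalar_on_sphere {k k' : ℕ} (T : Harm k (n + 1) →ₗ[ℂ] Harm k' (n + 1))
    (hT : ∀ g f, T (harmRep k (n + 1) g f) = harmRep k' (n + 1) g (T f)) :
    ∃ c : ℂ, ∀ f (x : Fin (n + 1) → ℝ), ∑ i, x i ^ 2 = 1 →
      evalR x (T f).1 = c * evalR x f.1 := by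
  let φ : Harm k (n + 1) →ₗ[ℂ] ℂ :=
    (evalR (Pi.single 0 1)).toLinearMap ∘ₗ (Harm k' (n + 1)).subtype ∘ₗ T
  have hφ : ∀ f, φ f = evalR (Pi.single 0 1) (T f).1 := fun f => rfl
  obtain ⟨c, hc⟩ := exists_eq_evalR φ (by
    intro g hg f
    rw [hφ, hφ, hT, harmRep_apply, evalR_polySubst]
    congr 2
    have h1 : g.1.transpose * g.1 = 1 := (Matrix.mem_orthogonalGroup_iff' _ ℝ).1 g.2
    calc g.1.transpose.mulVec (Pi.single 0 1)
        = g.1.transpose.mulVec (g.1.mulVec (Pi.single 0 1)) := by rw [hg]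
      _ = Pi.single 0 1 := by rw [Matrix.mulVec_mulVec, h1, Matrix.one_mulVec])
  refine ⟨c, fun f x hx => ?_⟩
  -- A symmetric orthogonal matrix taking e₀ to x transports the identity from e₀ to x.
  obtain ⟨g, hg, hgt, -⟩ := exists_orth_map (Pi.single 0 1) x (by
    rw [hx, Finset.sum_eq_single 0] <;> simp +contextual)
  have h := hc (harmRep k (n + 1) g f)
  rw [hφ, hT, harmRep_apply, harmRep_apply, evalR_polySubst, evalR_polySubst, hgt, hg] at h
  exact h

theorem exists_eq_smul_unit {x : Fin n → ℝ} (hx : x ≠ 0) : ∃ (r : ℝ) (y : Fin n → ℝ), r ≠ 0 ∧ ∑ i, y i ^ 2 = 1 ∧ x = r • y ∧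
      r ^ 2 = ∑ i, x i ^ 2 := by
  have hpos : 0 < ∑ i, x i ^ 2 := by
    obtain ⟨i, hi⟩ := Function.ne_iff.1 hx
    exact Finset.sum_pos' (fun i _ => sq_nonneg _) ⟨i, Finset.mem_univ _, by
      have : x i ≠ 0 := hi
      positivity⟩
  have hr : Real.sqrt (∑ i, x i ^ 2) ≠ 0 := (Real.sqrt_pos.2 hpos).ne'
  have hr2 := Real.sq_sqrt hpos.le
  refine ⟨_, (Real.sqrt (∑ i, x i ^ 2))⁻¹ • x, hr, ?_, by rw [smul_smul, mul_inv_cancel₀ hr,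
    one_smul], hr2⟩
  simp only [Pi.smul_apply, smul_eq_mul, mul_pow, ← Finset.mul_sum]
  rw [inv_pow, hr2, inv_mul_cancel₀ hpos.ne']

theorem harm_eq_of_sphere {k : ℕ} {f f' : MvPolynomial (Fin n) ℂ} (hf : f ∈ Harm k n)
    (hf' : f' ∈ Harm k n) {c : ℂ}
    (h : ∀ x : Fin n → ℝ, ∑ i, x i ^ 2 = 1 → evalR x f' = c * evalR x f) (hn : 0 < n) :
    f' = c • f := by
  refine polynomial_ext_real fun x => ?_
  rw [map_smul, smul_eq_mul]
  by_cases hx : x = 0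
  · have h0 : x = (0 : ℝ) • (Pi.single ⟨0, hn⟩ 1 : Fin n → ℝ) := by simp [hx]
    rw [h0, evalR_smul (mem_Harm.1 hf').1, evalR_smul (mem_Harm.1 hf).1, h]
    · ring
    · rw [Finset.sum_eq_single ⟨0, hn⟩] <;> simp +contextual
  · obtain ⟨r, y, -, hy, hxy, -⟩ := exists_eq_smul_unit hx
    rw [hxy, evalR_smul (mem_Harm.1 hf').1, evalR_smul (mem_Harm.1 hf).1, h y hy]
    ring

/-- If the degrees differ by an odd number, comparing x with -x gives f' = 0 on the sphere. If they
differ by 2i + 2, homogeneity gives f' = c |x|^{2i+2} f everywhere, and a harmonic polynomial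
divisible by |x|² is orthogonal to itself. -/
theorem harm_eq_zero_of_sphere_lt {k k' : ℕ} (hk : k < k') {f f' : MvPolynomial (Fin n) ℂ}
    (hf : f ∈ Harm k n) (hf' : f' ∈ Harm k' n) {c : ℂ}
    (h : ∀ x : Fin n → ℝ, ∑ i, x i ^ 2 = 1 → evalR x f' = c * evalR x f) : f' = 0 := by
  obtain ⟨j, rfl⟩ := Nat.exists_eq_add_of_lt hk
  have hzero : ∀ {l : ℕ} {u : MvPolynomial (Fin n) ℂ}, u.IsHomogeneous (l + 1) →
      evalR 0 u = 0 := by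
    intro l u hu
    have := evalR_smul hu 0 0
    simpa using this
  rcases Nat.even_or_odd' j with ⟨i, rfl | rfl⟩
  · apply polynomial_ext_real
    intro x
    rw [map_zero]
    by_cases hx : x = 0
    · rw [hx]
      exact hzero (mem_Harm.1 hf').1
    obtain ⟨r, y, -, hy, hxy, -⟩ := exists_eq_smul_unit hx
    have h1 := h y hy
    have h2 := h ((-1 : ℝ) • y) (by simpa using hy)
    rw [evalR_smul (mem_Harm.1 hf').1, evalR_smul (mem_Harm.1 hf).1] at h2
    have hp : ((-1 : ℝ) : ℂ) ^ (k + 2 * i + 1) = -((-1 : ℝ) : ℂ) ^ k := by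
      rw [pow_add, pow_add, pow_mul]
      simp
    have hne : ((-1 : ℝ) : ℂ) ^ k ≠ 0 := pow_ne_zero _ (by simp)
    have h3 : evalR y f' = 0 := by
      rw [hp] at h2
      have : ((-1 : ℝ) : ℂ) ^ k * (2 * evalR y f') = 0 := by
        linear_combination -h2 + ((-1 : ℝ) : ℂ) ^ k * h1
      simpa [hne] using this
    rw [hxy, evalR_smul (mem_Harm.1 hf').1, h3, mul_zero]
  · have e : f' = sqNorm n * (c • (sqNorm n ^ i * f)) := by
      apply polynomial_ext_real
      intro x
      rw [map_mul, map_smul, map_mul, map_pow, evalR_sqNorm, smul_eq_mul]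
      by_cases hx : x = 0
      · rw [hx, hzero (mem_Harm.1 hf').1]
        simp
      obtain ⟨r, y, -, hy, hxy, hr⟩ := exists_eq_smul_unit hx
      rw [← hr, hxy, evalR_smul (mem_Harm.1 hf').1, evalR_smul (mem_Harm.1 hf).1, h y hy]
      push_cast
      ring
    apply fischer_self_eq_zero
    have : fischer (sqNorm n * (c • (sqNorm n ^ i * f))) f' = 0 := by
      rw [fischer_sqNorm_mul, (mem_Harm.1 hf').2, map_zero]
    rwa [← e] at this

theorem harm_eq_zero_of_sphere {k k' : ℕ} (hk : k ≠ k') {f f' : MvPolynomial (Fin n) ℂ}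
    (hf : f ∈ Harm k n) (hf' : f' ∈ Harm k' n) {c : ℂ}
    (h : ∀ x : Fin n → ℝ, ∑ i, x i ^ 2 = 1 → evalR x f' = c * evalR x f) (hn : 0 < n) :
    f' = 0 := by
  rcases lt_or_gt_of_ne hk with hk | hk
  · exact harm_eq_zero_of_sphere_lt hk hf hf' h
  · by_cases hc : c = 0
    · have := harm_eq_of_sphere (Submodule.zero_mem _) hf' (c := 0) (fun x hx => by
        rw [h x hx, hc, zero_mul, zero_mul]) hn
      simpa using this
    · have h0 : f = 0 := harm_eq_zero_of_sphere_lt hk hf' hf (c := c⁻¹) fun x hx => by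
        rw [h x hx, inv_mul_cancel_left₀ hc]
      have := harm_eq_of_sphere (Submodule.zero_mem _) hf' (c := 0) (fun x hx => by
        rw [h x hx, h0, map_zero, mul_zero, mul_zero]) hn
      simpa using this

/-- There are no nonzero intertwining maps between harmonic polynomials of different degrees. -/
theorem harm_intertwining_eq_zero {k k' : ℕ} (hn : 0 < n) (hk : k ≠ k')
    (T : Harm k n →ₗ[ℂ] Harm k' n)
    (hT : ∀ g f, T (harmRep k n g f) = harmRep k' n g (T f)) : T = 0 := by
  obtain ⟨n, rfl⟩ := Nat.exists_eq_succ_of_ne_zero hn.ne'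
  obtain ⟨c, hc⟩ := exists_scalar_on_sphere T hT
  ext1 f
  exact Subtype.ext (harm_eq_zero_of_sphere hk f.2 (T f).2 (hc f) hn)

/-- Schur's lemma for harmonic polynomials. -/
theorem harm_intertwining_scalar {k : ℕ} (hn : 0 < n) (T : Harm k n →ₗ[ℂ] Harm k n)
    (hT : ∀ g f, T (harmRep k n g f) = harmRep k n g (T f)) : ∃ c : ℂ, ∀ f, T f = c • f := by
  obtain ⟨n, rfl⟩ := Nat.exists_eq_succ_of_ne_zero hn.ne'
  obtain ⟨c, hc⟩ := exists_scalar_on_sphere T hT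
  exact ⟨c, fun f => Subtype.ext (harm_eq_of_sphere f.2 (T f).2 (hc f) hn)⟩

/-- Orthogonal projection to a space of polynomials. -/
theorem exists_fischer_proj (S : Submodule ℂ (MvPolynomial (Fin n) ℂ)) [FiniteDimensional ℂ S]
    (f : MvPolynomial (Fin n) ℂ) : ∃ u ∈ S, ∀ w ∈ S, fischer w (f - u) = 0 := by
  obtain ⟨u, hu, h⟩ := exists_fischer_repr S (fischer f ∘ₗ S.subtype)
  refine ⟨u, hu, fun w hw => ?_⟩
  rw [← fischer_conj, map_eq_zero]
  have : fischer (f - u + u) w = fischer (f - u) w + fischer u w := fischer_add_left _ _ _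
  rw [sub_add_cancel, ← h ⟨w, hw⟩] at this
  simpa using this

/-- The orthogonal projection onto a subrepresentation commutes with the group, so it is a scalar by
Schur's lemma; a projection that is the identity on a nonzero subspace has scalar 1. -/
theorem harmRep_isIrreducible {k : ℕ} (hn : 0 < n) [Nontrivial (Harm k n)] :
    (harmRep k n).IsIrreducible := by
  refine { exists_pair_ne := ⟨⊥, ⊤, ?_⟩, eq_bot_or_eq_top := fun U => ?_ }
  · intro h
    have : (⊥ : Submodule ℂ (Harm k n)) = ⊤ := congrArg Subrepresentation.toSubmodule h
    exact bot_ne_top this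
  let S : Submodule ℂ (MvPolynomial (Fin n) ℂ) := U.toSubmodule.map (Harm k n).subtype
  have hS : S ≤ Harm k n := Submodule.map_subtype_le _ _
  have memS : ∀ f : Harm k n, f.1 ∈ S ↔ f ∈ U.toSubmodule := fun f => by
    simp [S]
  choose P hPS hP using exists_fischer_proj S
  have uniq : ∀ f u, u ∈ S → (∀ w ∈ S, fischer w (f - u) = 0) → P f = u := by
    intro f u hu h
    have hd : P f - u ∈ S := Submodule.sub_mem _ (hPS f) hu
    rw [← sub_eq_zero]
    apply fischer_self_eq_zero
    have e : P f - u = (f - u) - (f - P f) := by ring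
    nth_rw 2 [e]
    rw [map_sub, h _ hd, hP f _ hd, sub_zero]
  let T : Harm k n →ₗ[ℂ] Harm k n :=
    { toFun := fun f => ⟨P f.1, hS (hPS _)⟩
      map_add' := fun f g => Subtype.ext (uniq _ _ (Submodule.add_mem _ (hPS _) (hPS _)) (by
        intro w hw
        have e : (f + g).1 - (P f.1 + P g.1) = (f.1 - P f.1) + (g.1 - P g.1) := by
          rw [Submodule.coe_add]; ring
        change fischer w ((f + g).1 - (P f.1 + P g.1)) = 0
        rw [e, map_add, hP _ w hw, hP _ w hw, add_zero]))
      map_smul' := fun c f => Subtype.ext (uniq _ _ (Submodule.smul_mem _ c (hPS _)) (by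
        intro w hw
        change fischer w (c • f.1 - c • P f.1) = 0
        rw [← smul_sub, map_smul, hP _ w hw, smul_zero])) }
  obtain ⟨c, hc⟩ := harm_intertwining_scalar hn T (by
    intro g f
    refine Subtype.ext (uniq _ _ ?_ ?_)
    · have h1 : T f ∈ U.toSubmodule := (memS _).1 (hPS f.1)
      exact (memS _).2 (U.apply_mem_toSubmodule g h1)
    · intro w hw
      have hw' : (⟨w, hS hw⟩ : Harm k n) ∈ U.toSubmodule := (memS _).1 hw
      have h2 := (memS _).2 (U.apply_mem_toSubmodule g⁻¹ hw')
      have h3 := hP f.1 _ h2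
      rw [← fischer_polySubst g, map_sub] at h3
      have h4 : polySubst g.1 (harmRep k n g⁻¹ ⟨w, hS hw⟩).1 = w := by
        rw [← harmRep_apply, ← Module.End.mul_apply, ← map_mul, mul_inv_cancel, map_one,
          Module.End.one_apply]
      rw [h4] at h3
      exact h3)
  have hTU : ∀ f ∈ U.toSubmodule, T f = f := fun f hf =>
    Subtype.ext (uniq _ _ ((memS f).2 hf) fun w _ => by rw [sub_self, map_zero])
  by_cases hU : U.toSubmodule = ⊥
  · left
    exact Subrepresentation.toSubmodule_injective hU
  · right
    obtain ⟨u, hu, hu0⟩ := Submodule.exists_mem_ne_zero_of_ne_bot hU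
    have hc1 : c = 1 := by
      have h1 := hc u
      rw [hTU u hu] at h1
      exact smul_left_injective ℂ hu0 (h1.symm.trans (one_smul ℂ u).symm)
    apply Subrepresentation.toSubmodule_injective
    refine (Submodule.eq_top_iff'.2 fun f => ?_ : U.toSubmodule = ⊤)
    have h1 := hc f
    rw [hc1, one_smul] at h1
    rw [← h1]
    exact (memS _).1 (hPS f.1)

end Zonal

/-! ### External tensor products of irreducible representations -/

section External

variable {G₁ G₂ W₁ W₂ : Type*} [Group G₁] [Group G₂] [AddCommGroup W₁] [Module ℂ W₁]
  [AddCommGroup W₂] [Module ℂ W₂]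

/-- Burnside's theorem. -/
theorem span_range_eq_top [FiniteDimensional ℂ W₁] (ρ : Representation ℂ G₁ W₁)
    (hρ : ρ.IsIrreducible) :
    Submodule.span ℂ (Set.range fun g => (ρ g : W₁ →ₗ[ℂ] W₁)) = ⊤ := by
  classical
  rw [Submodule.eq_top_iff']
  intro f
  have hs : IsSimpleModule (MonoidAlgebra ℂ G₁) ρ.asModule :=
    (Representation.irreducible_iff_isSimpleModule_asModule ρ).1 hρ
  have hfd : FiniteDimensional ℂ ρ.asModule := ‹FiniteDimensional ℂ W₁›
  have hb : Function.Bijective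
      (algebraMap ℂ (Module.End (MonoidAlgebra ℂ G₁) ρ.asModule)) :=
    IsSimpleModule.algebraMap_end_bijective_of_isAlgClosed ℂ
  -- By Schur's lemma the commutant consists of scalars, so `f` is linear over it and Jacobson
  -- density applies; agreement on a basis is agreement everywhere.
  let F : Module.End (Module.End (MonoidAlgebra ℂ G₁) ρ.asModule) ρ.asModule :=
    { toFun := fun v => f v
      map_add' := fun v w => map_add f v w
      map_smul' := fun φ v => by
        obtain ⟨c, rfl⟩ := hb.2 φ
        exact map_smul f c v }
  let b := Module.finBasis ℂ W₁
  obtain ⟨r, hr⟩ := jacobson_density F (Finset.univ.image fun i => (b i : ρ.asModule))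
  have e : f = ρ.asAlgebraHom r := by
    refine b.ext fun i => ?_
    exact hr (b i) (Finset.mem_image_of_mem _ (Finset.mem_univ i))
  rw [e, Representation.asAlgebraHom_def, MonoidAlgebra.lift_apply]
  exact Submodule.sum_mem _ fun g _ => Submodule.smul_mem _ _ (Submodule.subset_span ⟨g, rfl⟩)

/-- The external tensor product of two irreducible representations is irreducible. -/
theorem isIrreducible_external [FiniteDimensional ℂ W₁] [FiniteDimensional ℂ W₂]
    (ρ₁ : Representation ℂ G₁ W₁) (ρ₂ : Representation ℂ G₂ W₂)
    (h₁ : ρ₁.IsIrreducible) (h₂ : ρ₂.IsIrreducible) [Nontrivial (W₁ ⊗[ℂ] W₂)] :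
    (Representation.tprod (ρ₁.comp (MonoidHom.fst G₁ G₂))
      (ρ₂.comp (MonoidHom.snd G₁ G₂))).IsIrreducible := by
  refine { exists_pair_ne := ⟨⊥, ⊤, ?_⟩, eq_bot_or_eq_top := fun U => ?_ }
  · intro h
    have : (⊥ : Submodule ℂ (W₁ ⊗[ℂ] W₂)) = ⊤ := congrArg Subrepresentation.toSubmodule h
    exact bot_ne_top this
  have stable₁ : ∀ f : W₁ →ₗ[ℂ] W₁, ∀ u ∈ U.toSubmodule,
      TensorProduct.map f LinearMap.id u ∈ U.toSubmodule := by
    intro f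
    have hf : f ∈ Submodule.span ℂ (Set.range fun g => (ρ₁ g : W₁ →ₗ[ℂ] W₁)) := by
      rw [span_range_eq_top ρ₁ h₁]
      trivial
    induction hf using Submodule.span_induction with
    | mem f hf =>
      obtain ⟨g, rfl⟩ := hf
      intro u hu
      have := U.apply_mem_toSubmodule (g, 1) hu
      rw [Representation.tprod_apply] at this
      simpa [Module.End.one_eq_id] using! this
    | zero => intro u hu; simp
    | add f f' _ _ hf hf' =>
      intro u hu
      rw [TensorProduct.map_add_left]
      exact Submodule.add_mem _ (hf u hu) (hf' u hu)
    | smul c f _ hf =>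
      intro u hu
      rw [TensorProduct.map_smul_left]
      exact Submodule.smul_mem _ c (hf u hu)
  have stable₂ : ∀ f : W₂ →ₗ[ℂ] W₂, ∀ u ∈ U.toSubmodule,
      TensorProduct.map LinearMap.id f u ∈ U.toSubmodule := by
    intro f
    have hf : f ∈ Submodule.span ℂ (Set.range fun g => (ρ₂ g : W₂ →ₗ[ℂ] W₂)) := by
      rw [span_range_eq_top ρ₂ h₂]
      trivial
    induction hf using Submodule.span_induction with
    | mem f hf =>
      obtain ⟨g, rfl⟩ := hf
      intro u hu
      have := U.apply_mem_toSubmodule (1, g) hu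
      rw [Representation.tprod_apply] at this
      simpa [Module.End.one_eq_id] using! this
    | zero => intro u hu; simp
    | add f f' _ _ hf hf' =>
      intro u hu
      rw [TensorProduct.map_add_right]
      exact Submodule.add_mem _ (hf u hu) (hf' u hu)
    | smul c f _ hf =>
      intro u hu
      rw [TensorProduct.map_smul_right]
      exact Submodule.smul_mem _ c (hf u hu)
  by_cases hU : U.toSubmodule = ⊥
  · left
    exact Subrepresentation.toSubmodule_injective hU
  right
  apply Subrepresentation.toSubmodule_injective
  refine (Submodule.eq_top_iff'.2 fun t => ?_ : U.toSubmodule = ⊤)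
  obtain ⟨u, hu, hu0⟩ := Submodule.exists_mem_ne_zero_of_ne_bot hU
  let b₁ := Module.finBasis ℂ W₁
  let b₂ := Module.finBasis ℂ W₂
  -- By Burnside's theorem rank-one operators on either factor preserve `U`. Those built from a
  -- nonvanishing coordinate of `u` take `u` to a nonzero multiple of any chosen pure tensor.
  obtain ⟨⟨i, j⟩, hij⟩ : ∃ ij, (b₁.tensorProduct b₂).repr u ij ≠ 0 := by
    by_contra! hcon
    exact hu0 ((b₁.tensorProduct b₂).repr.map_eq_zero_iff.1 (Finsupp.ext hcon))
  induction t using TensorProduct.induction_on with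
  | zero => exact Submodule.zero_mem _
  | add x y hx hy => exact Submodule.add_mem _ hx hy
  | tmul x y =>
    have key : ∀ w : W₁ ⊗[ℂ] W₂, TensorProduct.map LinearMap.id
        (LinearMap.toSpanSingleton ℂ W₂ y ∘ₗ b₂.coord j)
        (TensorProduct.map (LinearMap.toSpanSingleton ℂ W₁ x ∘ₗ b₁.coord i) LinearMap.id w) =
        (b₁.tensorProduct b₂).repr w (i, j) • x ⊗ₜ[ℂ] y := by
      intro w
      induction w using TensorProduct.induction_on with
      | zero => simp
      | add w w' hw hw' => simp only [map_add, hw, hw', Finsupp.add_apply, add_smul]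
      | tmul v w =>
        simp [Module.Basis.tensorProduct_repr_tmul_apply, TensorProduct.smul_tmul',
          TensorProduct.tmul_smul, smul_smul]
    have h := stable₂ (LinearMap.toSpanSingleton ℂ W₂ y ∘ₗ b₂.coord j) _
      (stable₁ (LinearMap.toSpanSingleton ℂ W₁ x ∘ₗ b₁.coord i) u hu)
    rw [key] at h
    exact (Submodule.smul_mem_iff _ hij).1 h

theorem tensor_eq_zero_of_right {t : W₁ ⊗[ℂ] W₂} [FiniteDimensional ℂ W₂]
    (h : ∀ ψ : W₂ →ₗ[ℂ] ℂ, TensorProduct.rid ℂ W₁ (TensorProduct.map LinearMap.id ψ t) = 0) :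
    t = 0 := by
  let b₂ := Module.finBasis ℂ W₂
  have e : ∀ t : W₁ ⊗[ℂ] W₂, t = ∑ j, (TensorProduct.rid ℂ W₁
      (TensorProduct.map LinearMap.id (b₂.coord j) t)) ⊗ₜ[ℂ] b₂ j := by
    intro t
    induction t using TensorProduct.induction_on with
    | zero => simp
    | add x y hx hy =>
      simp only [map_add, TensorProduct.add_tmul, Finset.sum_add_distrib]
      rw [← hx, ← hy]
    | tmul x y =>
      conv_lhs => rw [← b₂.sum_repr y, TensorProduct.tmul_sum]
      simp [TensorProduct.smul_tmul]
  rw [e t]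
  simp [h]

theorem tensor_eq_zero_of_left {t : W₁ ⊗[ℂ] W₂} [FiniteDimensional ℂ W₁]
    (h : ∀ ψ : W₁ →ₗ[ℂ] ℂ, TensorProduct.lid ℂ W₂ (TensorProduct.map ψ LinearMap.id t) = 0) :
    t = 0 := by
  let b₁ := Module.finBasis ℂ W₁
  have e : ∀ t : W₁ ⊗[ℂ] W₂, t = ∑ j, b₁ j ⊗ₜ[ℂ] (TensorProduct.lid ℂ W₂
      (TensorProduct.map (b₁.coord j) LinearMap.id t)) := by
    intro t
    induction t using TensorProduct.induction_on with
    | zero => simp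
    | add x y hx hy =>
      simp only [map_add, TensorProduct.tmul_add, Finset.sum_add_distrib]
      rw [← hx, ← hy]
    | tmul x y =>
      conv_lhs => rw [← b₁.sum_repr x, TensorProduct.sum_tmul]
      simp [TensorProduct.smul_tmul]
  rw [e t]
  simp [h]

end External

/-! ### Irreducibility and inequivalence of the K-types -/

section KTypes

variable {p q : ℕ}

theorem kTypeRep_tmul {k l : ℕ} (g : K p q) (a : Harm k p) (b : Harm l q) :
    kTypeRep p q k l g (a ⊗ₜ[ℂ] b) = (harmRep k p g.1 a) ⊗ₜ[ℂ] (harmRep l q g.2 b) := by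
  rw [kTypeRep, Representation.tprod_apply]
  rfl

theorem kTypeRep_isIrreducible (hp : 0 < p) (hq : 0 < q) (k l : ℕ)
    [hn : Nontrivial (Harm k p ⊗[ℂ] Harm l q)] :
    Representation.IsIrreducible (k := ℂ) (V := Harm k p ⊗[ℂ] Harm l q)
      (kTypeRep p q k l) := by
  have h₁ : Nontrivial (Harm k p) := by
    by_contra hcon
    rw [not_nontrivial_iff_subsingleton] at hcon
    exact not_subsingleton (Harm k p ⊗[ℂ] Harm l q) inferInstance
  have h₂ : Nontrivial (Harm l q) := by
    by_contra hcon
    rw [not_nontrivial_iff_subsingleton] at hcon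
    exact not_subsingleton (Harm k p ⊗[ℂ] Harm l q) inferInstance
  exact isIrreducible_external (harmRep k p) (harmRep l q) (harmRep_isIrreducible hp)
    (harmRep_isIrreducible hq)

theorem kType_eq_bot_or_eq_top (hp : 0 < p) (hq : 0 < q) {k l : ℕ}
    (U : Submodule ℂ (Harm k p ⊗[ℂ] Harm l q))
    (hU : ∀ g, ∀ w ∈ U, kTypeRep p q k l g w ∈ U) : U = ⊥ ∨ U = ⊤ := by
  rcases subsingleton_or_nontrivial (Harm k p ⊗[ℂ] Harm l q) with h | h
  · left
    exact Subsingleton.elim _ _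
  · have := kTypeRep_isIrreducible hp hq k l
    exact (eq_bot_or_eq_top (⟨U, fun g w => hU g w⟩ : Subrepresentation (kTypeRep p q k l))).imp
      (congrArg Subrepresentation.toSubmodule) (congrArg Subrepresentation.toSubmodule)

/-- One of the two degrees differs. Fixing a vector in the other factor of the source and applying a
functional to it in the target leaves an intertwining map for a single orthogonal group between
different degrees, which is zero. -/
theorem kType_intertwining_eq_zero (hp : 0 < p) (hq : 0 < q) {k l k' l' : ℕ}
    (hne : (k, l) ≠ (k', l')) (T : Harm k p ⊗[ℂ] Harm l q →ₗ[ℂ] Harm k' p ⊗[ℂ] Harm l' q)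
    (hT : ∀ g w, T (kTypeRep p q k l g w) = kTypeRep p q k' l' g (T w)) : T = 0 := by
  refine TensorProduct.ext' fun a b => ?_
  rw [LinearMap.zero_apply]
  by_cases hk : k = k'
  · have hl : l ≠ l' := fun hl => hne (by rw [hk, hl])
    refine tensor_eq_zero_of_left fun ψ => ?_
    let S : Harm l q →ₗ[ℂ] Harm l' q := (TensorProduct.lid ℂ (Harm l' q)).toLinearMap ∘ₗ
      TensorProduct.map ψ LinearMap.id ∘ₗ T ∘ₗ TensorProduct.mk ℂ (Harm k p) (Harm l q) a
    have hS : S = 0 := by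
      refine harm_intertwining_eq_zero hq hl S fun g f => ?_
      have h1 : T (a ⊗ₜ[ℂ] harmRep l q g f) = kTypeRep p q k' l' (1, g) (T (a ⊗ₜ[ℂ] f)) := by
        rw [← hT, kTypeRep_tmul, map_one, Module.End.one_apply]
      change TensorProduct.lid ℂ (Harm l' q) (TensorProduct.map ψ LinearMap.id
        (T (a ⊗ₜ[ℂ] harmRep l q g f))) = harmRep l' q g (TensorProduct.lid ℂ (Harm l' q)
        (TensorProduct.map ψ LinearMap.id (T (a ⊗ₜ[ℂ] f))))
      rw [h1]
      generalize T (a ⊗ₜ[ℂ] f) = t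
      induction t using TensorProduct.induction_on with
      | zero => simp
      | add x y hx hy => simp only [map_add, hx, hy]
      | tmul x y => rw [kTypeRep_tmul]; simp
    exact congrArg (fun S : Harm l q →ₗ[ℂ] Harm l' q => S b) hS
  · refine tensor_eq_zero_of_right fun ψ => ?_
    let S : Harm k p →ₗ[ℂ] Harm k' p := (TensorProduct.rid ℂ (Harm k' p)).toLinearMap ∘ₗ
      TensorProduct.map LinearMap.id ψ ∘ₗ T ∘ₗ
        (TensorProduct.mk ℂ (Harm k p) (Harm l q)).flip b
    have hS : S = 0 := by
      refine harm_intertwining_eq_zero hp hk S fun g f => ?_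
      have h1 : T (harmRep k p g f ⊗ₜ[ℂ] b) = kTypeRep p q k' l' (g, 1) (T (f ⊗ₜ[ℂ] b)) := by
        rw [← hT, kTypeRep_tmul, map_one, Module.End.one_apply]
      change TensorProduct.rid ℂ (Harm k' p) (TensorProduct.map LinearMap.id ψ
        (T (harmRep k p g f ⊗ₜ[ℂ] b))) = harmRep k' p g (TensorProduct.rid ℂ (Harm k' p)
        (TensorProduct.map LinearMap.id ψ (T (f ⊗ₜ[ℂ] b))))
      rw [h1]
      generalize T (f ⊗ₜ[ℂ] b) = t
      induction t using TensorProduct.induction_on with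
      | zero => simp
      | add x y hx hy => simp only [map_add, hx, hy]
      | tmul x y => rw [kTypeRep_tmul]; simp
    exact congrArg (fun S : Harm k p →ₗ[ℂ] Harm k' p => S a) hS

theorem multiplicityFree (hp : 0 < p) (hq : 0 < q) (m : ℕ) : MultiplicityFree p q m := by
  refine ⟨fun i _ hn => kTypeRep_isIrreducible hp hq _ _, fun i _ j _ hij hn => ⟨fun e => ?_⟩⟩
  have h := kType_intertwining_eq_zero hp hq hij e.toLinearEquiv.toLinearMap fun g w =>
    congrArg (fun f => f w) (e.isIntertwining' g)
  obtain ⟨x, y, hxy⟩ := hn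
  apply hxy
  apply e.toLinearEquiv.injective
  have h' : ∀ x, e.toLinearEquiv x = 0 := fun x => congrArg (fun f => f x) h
  rw [h', h']

end KTypes

/-! ### Entire functions and the functions `Ψ_α` -/

section Entire

/-- The algebra of entire functions. -/
def Ent : Subalgebra ℂ (ℂ → ℂ) where
  carrier := {χ | Differentiable ℂ χ}
  mul_mem' hf hg := Differentiable.mul (Set.mem_ofPred.1 hf) (Set.mem_ofPred.1 hg)
  add_mem' hf hg := Differentiable.add (Set.mem_ofPred.1 hf) (Set.mem_ofPred.1 hg)
  algebraMap_mem' c := Set.mem_ofPred.2 (differentiable_const c)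

theorem Ent.differentiable (χ : Ent) : Differentiable ℂ χ.1 := Set.mem_ofPred.1 χ.2

/-- The derivative of an entire function. -/
def entD : Ent →ₗ[ℂ] Ent where
  toFun χ := ⟨deriv χ.1, Set.mem_ofPred.2 (Ent.differentiable χ).deriv⟩
  map_add' f g := Subtype.ext (funext fun z =>
    deriv_add ((Ent.differentiable f) z) ((Ent.differentiable g) z))
  map_smul' c f := Subtype.ext (funext fun z => deriv_const_smul c ((Ent.differentiable f) z))

theorem entD_apply (χ : Ent) (z : ℂ) : (entD χ).1 z = deriv χ.1 z := rfl

theorem entD_mul (f g : Ent) : entD (f * g) = entD f * g + f * entD g :=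
  Subtype.ext (funext fun z => deriv_mul ((Ent.differentiable f) z) ((Ent.differentiable g) z))

/-- The identity function. -/
def entZ : Ent := ⟨fun z => z, Set.mem_ofPred.2 differentiable_id⟩

theorem entD_entZ : entD entZ = 1 := Subtype.ext (funext fun z => deriv_id z)

theorem ent_ext_deriv {f g : Ent} (h : ∀ n : ℕ, ((entD ^ n) f).1 0 = ((entD ^ n) g).1 0) :
    f = g := by
  have key : ∀ (f : Ent) (n : ℕ), iteratedDeriv n f.1 = ((entD ^ n) f).1 := by
    intro f n
    induction n with
    | zero => simp
    | succ n ih =>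
      rw [iteratedDeriv_succ, ih, pow_succ', Module.End.mul_apply]
      rfl
  refine Subtype.ext (funext fun z => ?_)
  rw [← Complex.taylorSeries_eq_of_entire' 0 z (Ent.differentiable f),
    ← Complex.taylorSeries_eq_of_entire' 0 z (Ent.differentiable g)]
  simp only [key, h]

/-- The operator `z χ'' + κ χ' + χ`. -/
def besselOp (κ : ℂ) (χ : Ent) : Ent := entZ * entD (entD χ) + κ • entD χ + χ

/-- Differentiation shifts the parameter by one. Read at the origin, the equation zχ'' + κχ' + χ = 0
thus becomes the recursion (κ + n) χ⁽ⁿ⁺¹⁾(0) = -χ⁽ⁿ⁾(0). -/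
theorem entD_besselOp (κ : ℂ) (χ : Ent) : entD (besselOp κ χ) = besselOp (κ + 1) (entD χ) := by
  simp only [besselOp, map_add, entD_mul, entD_entZ, map_smul, one_mul, add_smul, one_smul]
  abel

theorem entD_pow_besselOp (κ : ℂ) (χ : Ent) (n : ℕ) :
    (entD ^ n) (besselOp κ χ) = besselOp (κ + n) ((entD ^ n) χ) := by
  induction n with
  | zero => simp
  | succ n ih =>
    rw [pow_succ', Module.End.mul_apply, ih, entD_besselOp, Module.End.mul_apply]
    push_cast
    rw [add_assoc]

theorem besselOp_apply_zero (κ : ℂ) (χ : Ent) :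
    (besselOp κ χ).1 0 = κ * (entD χ).1 0 + χ.1 0 := by
  change 0 * (entD (entD χ)).1 0 + κ * (entD χ).1 0 + χ.1 0 = _
  ring

/-- `α` is not a non-positive integer. -/
def GoodParam (α : ℂ) : Prop := ∀ n : ℕ, α ≠ -(n : ℂ)

theorem GoodParam.add_one {α : ℂ} (h : GoodParam α) : GoodParam (α + 1) := fun n hn =>
  h (n + 1) (by push_cast; linear_combination hn)

theorem GoodParam.add_natCast {α : ℂ} (h : GoodParam α) (k : ℕ) : α + k ≠ 0 := fun h0 =>
  h k (by linear_combination h0)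

theorem GoodParam.ne_zero {α : ℂ} (h : GoodParam α) : α ≠ 0 := by simpa using h 0

theorem pochhammer_ne_zero {α : ℂ} (h : GoodParam α) (n : ℕ) :
    (ascPochhammer ℂ n).eval α ≠ 0 := by
  induction n with
  | zero => simp
  | succ n ih =>
    rw [ascPochhammer_succ_eval]
    exact mul_ne_zero ih (h.add_natCast n)

/-- Once n ≥ |α| + 1, each new factor α + n has modulus at least 1, so a minimum over an initial
range serves for all n. The bound lets the exponential series dominate Ψ_α. -/
theorem exists_pochhammer_bound {α : ℂ} (h : GoodParam α) :
    ∃ ε : ℝ, 0 < ε ∧ ∀ n, ε ≤ ‖(ascPochhammer ℂ n).eval α‖ := by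
  obtain ⟨N, hN⟩ := exists_nat_ge (‖α‖ + 1)
  obtain ⟨i, -, hi⟩ := Finset.exists_min_image (Finset.range (N + 1))
    (fun n => ‖(ascPochhammer ℂ n).eval α‖) ⟨0, by simp⟩
  refine ⟨_, norm_pos_iff.2 (pochhammer_ne_zero h i), fun n => ?_⟩
  rcases le_total n N with hn | hn
  · exact hi n (Finset.mem_range.2 (by omega))
  · induction n, hn using Nat.le_induction with
    | base => exact hi N (Finset.mem_range.2 (by omega))
    | succ n hn ih =>
      rw [ascPochhammer_succ_eval, norm_mul]
      refine ih.trans (le_mul_of_one_le_right (norm_nonneg _) ?_)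
      have h1 : (n : ℝ) ≤ ‖α + n‖ + ‖α‖ := by
        have := norm_sub_le (α + n) α
        rw [add_sub_cancel_left, Complex.norm_natCast] at this
        exact this
      have h2 : (N : ℝ) ≤ n := by exact_mod_cast hn
      linarith

/-- The coefficients of `Ψ_α`. -/
def psiCoeff (α : ℂ) (n : ℕ) : ℂ := (-1) ^ n / ((n.factorial : ℂ) * (ascPochhammer ℂ n).eval α)

theorem psiCoeff_bound {α : ℂ} (h : GoodParam α) (r : ℝ) :
    ∃ u : ℕ → ℝ, Summable u ∧ ∀ (n : ℕ) (w : ℂ), w ∈ Metric.ball (0 : ℂ) r →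
      ‖psiCoeff α n * w ^ n‖ ≤ u n := by
  obtain ⟨ε, hε, hb⟩ := exists_pochhammer_bound h
  refine ⟨fun n => ε⁻¹ * (r ^ n / n.factorial), (Real.summable_pow_div_factorial r).mul_left _,
    fun n w hw => ?_⟩
  have hw' : ‖w‖ ≤ r := by simpa using (Metric.mem_ball.1 hw).le
  have hr : 0 ≤ r := (norm_nonneg w).trans hw'
  rw [norm_mul, norm_pow, psiCoeff, norm_div, norm_mul, norm_pow, norm_neg, norm_one, one_pow,
    Complex.norm_natCast]
  have h1 : (0 : ℝ) < n.factorial := by exact_mod_cast n.factorial_pos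
  calc 1 / ((n.factorial : ℝ) * ‖(ascPochhammer ℂ n).eval α‖) * ‖w‖ ^ n
      ≤ 1 / ((n.factorial : ℝ) * ε) * r ^ n := by
        gcongr
        exact hb n
    _ = _ := by field_simp

theorem Psi_eq (α : ℂ) : Psi α = fun u => ∑' n, psiCoeff α n * u ^ n := rfl

theorem differentiable_Psi {α : ℂ} (h : GoodParam α) : Differentiable ℂ (Psi α) := by
  intro z
  obtain ⟨u, hu, hb⟩ := psiCoeff_bound h (‖z‖ + 1)
  rw [Psi_eq]
  refine (Complex.differentiableOn_tsum_of_summable_norm hu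
    (fun n => (by fun_prop : Differentiable ℂ fun w : ℂ => psiCoeff α n * w ^ n).differentiableOn)
    Metric.isOpen_ball hb).differentiableAt (Metric.isOpen_ball.mem_nhds ?_)
  simp

theorem psiCoeff_succ {α : ℂ} (h : GoodParam α) (n : ℕ) :
    psiCoeff α (n + 1) * (n + 1) = -(1 / α) * psiCoeff (α + 1) n := by
  have e : (ascPochhammer ℂ (n + 1)).eval α = α * (ascPochhammer ℂ n).eval (α + 1) := by
    rw [ascPochhammer_succ_left]
    simp
  have h1 := h.ne_zero
  have h2 := pochhammer_ne_zero h.add_one n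
  have h3 : (n.factorial : ℂ) ≠ 0 := by exact_mod_cast n.factorial_ne_zero
  have h4 : (n : ℂ) + 1 ≠ 0 := Nat.cast_add_one_ne_zero n
  rw [psiCoeff, psiCoeff, e, Nat.factorial_succ, pow_succ]
  push_cast
  field_simp

theorem deriv_Psi {α : ℂ} (h : GoodParam α) (z : ℂ) :
    deriv (Psi α) z = -(1 / α) * Psi (α + 1) z := by
  obtain ⟨u, hu, hb⟩ := psiCoeff_bound h (‖z‖ + 1)
  have hs := Complex.hasSum_deriv_of_summable_norm hu
    (fun n => (by fun_prop : Differentiable ℂ fun w : ℂ => psiCoeff α n * w ^ n).differentiableOn)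
    Metric.isOpen_ball hb (z := z) (by simp)
  have e : ∀ n, deriv (fun w : ℂ => psiCoeff α n * w ^ n) z =
      psiCoeff α n * (n * z ^ (n - 1)) := by
    intro n
    rw [deriv_const_mul_field]
    simp
  simp only [e] at hs
  rw [Psi_eq, ← hs.tsum_eq, hs.summable.tsum_eq_zero_add, Psi_eq]
  simp only [Nat.cast_zero, zero_mul, mul_zero, zero_add, Nat.cast_add, Nat.cast_one,
    Nat.add_sub_cancel]
  rw [← tsum_mul_left]
  refine tsum_congr fun n => ?_
  rw [← mul_assoc, psiCoeff_succ h, mul_assoc]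

theorem Psi_zero (α : ℂ) : Psi α 0 = 1 := by
  rw [Psi_eq]
  change ∑' n, psiCoeff α n * 0 ^ n = 1
  rw [tsum_eq_single 0]
  · simp [psiCoeff]
  · intro n hn
    simp [hn]

open Classical in
/-- `Ψ_α` as an entire function. -/
def psiE (α : ℂ) : Ent := if h : GoodParam α then ⟨Psi α, Set.mem_ofPred.2 (differentiable_Psi h)⟩ else 0

theorem psiE_apply {α : ℂ} (h : GoodParam α) (z : ℂ) : (psiE α).1 z = Psi α z := by
  rw [psiE, dif_pos h]

theorem psiE_zero {α : ℂ} (h : GoodParam α) : (psiE α).1 0 = 1 := by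
  rw [psiE_apply h, Psi_zero]

theorem entD_psiE {α : ℂ} (h : GoodParam α) : entD (psiE α) = (-(1 / α)) • psiE (α + 1) := by
  refine Subtype.ext (funext fun z => ?_)
  rw [entD_apply, psiE, dif_pos h]
  change deriv (Psi α) z = -(1 / α) * (psiE (α + 1)).1 z
  rw [deriv_Psi h, psiE_apply h.add_one]

/-- The n-th derivative of Ψ_α is a multiple of Ψ_{α+n}, and at the origin the equation for α + n
reads -(α + n)/(α + n) + 1 = 0. Vanishing of all derivatives at 0 is enough for an entire function.
-/
theorem besselOp_psiE {α : ℂ} (h : GoodParam α) : besselOp α (psiE α) = 0 := by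
  have key : ∀ n : ℕ, ∃ c : ℂ, (entD ^ n) (psiE α) = c • psiE (α + n) := by
    intro n
    induction n with
    | zero => exact ⟨1, by simp⟩
    | succ n ih =>
      obtain ⟨c, hc⟩ := ih
      have hg : GoodParam (α + n) := by
        clear hc
        induction n with
        | zero => simpa using h
        | succ n ih => rw [Nat.cast_succ, ← add_assoc]; exact ih.add_one
      refine ⟨c * -(1 / (α + n)), ?_⟩
      rw [pow_succ', Module.End.mul_apply, hc, map_smul, entD_psiE hg, smul_smul, Nat.cast_succ,
        add_assoc]
  have good : ∀ n : ℕ, GoodParam (α + n) := by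
    intro n
    induction n with
    | zero => simpa using h
    | succ n ih => rw [Nat.cast_succ, ← add_assoc]; exact ih.add_one
  apply ent_ext_deriv
  intro n
  obtain ⟨c, hc⟩ := key n
  rw [entD_pow_besselOp, hc, besselOp_apply_zero, map_smul, entD_psiE (good n), map_zero]
  change (α + n) * (c * (-(1 / (α + n)) * (psiE (α + n + 1)).1 0)) +
    c * (psiE (α + n)).1 0 = 0
  rw [psiE_zero (good n), psiE_zero (good n).add_one]
  have := (good n).ne_zero
  field_simp
  ring

/-- The entire solutions of `z χ'' + κ χ' + χ = 0`. -/
theorem eq_smul_psiE {κ : ℂ} (h : GoodParam κ) {χ : Ent} (hχ : besselOp κ χ = 0) :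
    χ = (χ.1 0) • psiE κ := by
  -- The recursion at the origin can be solved because κ + n ≠ 0, so the value at 0 determines the
  -- solution.
  have key : ∀ χ : Ent, besselOp κ χ = 0 → χ.1 0 = 0 → χ = 0 := by
    intro χ hχ h0
    apply ent_ext_deriv
    intro n
    rw [map_zero]
    induction n with
    | zero => simpa using h0
    | succ n ih =>
      have h1 := entD_pow_besselOp κ χ n
      rw [hχ, map_zero] at h1
      have h2 := besselOp_apply_zero (κ + n) ((entD ^ n) χ)
      rw [← h1, ih] at h2
      rw [pow_succ', Module.End.mul_apply]
      have h3 : (κ + n) * (entD ((entD ^ n) χ)).1 0 = 0 := by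
        have : (0 : Ent).1 0 = 0 := rfl
        rw [this] at h2
        linear_combination -h2
      exact (mul_eq_zero.1 h3).resolve_left (h.add_natCast n)
  rw [← sub_eq_zero]
  apply key
  · have : ∀ (χ : Ent) (c : ℂ), besselOp κ (χ - c • psiE κ) =
        besselOp κ χ - c • besselOp κ (psiE κ) := by
      intro χ c
      simp only [besselOp, map_sub, map_smul, mul_sub, smul_add, smul_sub, mul_smul_comm,
        smul_comm c κ]
      abel
    rw [this, hχ, besselOp_psiE h, smul_zero, sub_zero]
  · change χ.1 0 - χ.1 0 * (psiE κ).1 0 = 0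
    rw [psiE_zero h]
    ring

/-- An entire function vanishing on the positive half line is zero. -/
theorem ent_eq_zero_of_pos {χ : Ent} (h : ∀ t : ℝ, 0 < t → χ.1 t = 0) : χ = 0 := by
  refine Subtype.ext ?_
  have ha : AnalyticOnNhd ℂ χ.1 Set.univ := fun z _ =>
    (Ent.differentiable χ).analyticAt z
  have hz : AnalyticOnNhd ℂ (0 : ℂ → ℂ) Set.univ := fun z _ => analyticAt_const
  refine ha.eq_of_frequently_eq (z₀ := 1) hz ?_
  have ht : Filter.Tendsto (fun t : ℝ => (t : ℂ)) (nhdsWithin 1 {1}ᶜ) (nhdsWithin 1 {1}ᶜ) := by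
    refine tendsto_nhdsWithin_of_tendsto_nhds_of_eventually_within _ ?_ ?_
    · refine (Complex.continuous_ofReal.tendsto' 1 1 (by simp)).mono_left nhdsWithin_le_nhds
    · filter_upwards [self_mem_nhdsWithin] with t ht
      simpa using ht
  refine ht.frequently (Filter.Eventually.frequently ?_)
  filter_upwards [nhdsWithin_le_nhds (lt_mem_nhds (zero_lt_one (α := ℝ)))] with t ht
  exact h t ht

end Entire

/-! ### Euler operators and Laplacians in a block of variables -/

section Block

open MvPolynomial

variable {σ : Type*}

/-- Half the sum of the squares of the variables in a block. -/
def rhoS (s : Finset σ) : MvPolynomial σ ℂ := (1 / 2 : ℂ) • ∑ a ∈ s, X a ^ 2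

/-- The Euler operator of a block of variables. -/
def eulS (s : Finset σ) : MvPolynomial σ ℂ →ₗ[ℂ] MvPolynomial σ ℂ :=
  ∑ a ∈ s, LinearMap.mulLeft ℂ (X a) ∘ₗ (pderiv a).toLinearMap

/-- The Laplacian of a block of variables. -/
def lapS (s : Finset σ) : MvPolynomial σ ℂ →ₗ[ℂ] MvPolynomial σ ℂ :=
  ∑ a ∈ s, (pderiv a).toLinearMap ∘ₗ (pderiv a).toLinearMap

theorem eulS_apply (s : Finset σ) (P : MvPolynomial σ ℂ) :
    eulS s P = ∑ a ∈ s, X a * pderiv a P := by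
  simp [eulS, LinearMap.sum_apply]

theorem lapS_apply (s : Finset σ) (P : MvPolynomial σ ℂ) :
    lapS s P = ∑ a ∈ s, pderiv a (pderiv a P) := by
  simp [lapS, LinearMap.sum_apply]

theorem two_smul_rhoS (s : Finset σ) : (2 : ℂ) • rhoS s = ∑ a ∈ s, X a ^ 2 := by
  rw [rhoS, smul_smul]
  norm_num

theorem pderiv_rhoS [DecidableEq σ] (s : Finset σ) (a : σ) :
    pderiv a (rhoS s) = if a ∈ s then X a else 0 := by
  rw [rhoS, Derivation.map_smul, map_sum]
  have : ∀ b ∈ s, pderiv a (X b ^ 2 : MvPolynomial σ ℂ) =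
      if a = b then (2 : ℂ) • X a else 0 := by
    intro b _
    rw [Derivation.leibniz_pow, pderiv_X, Pi.single_apply]
    by_cases h : a = b
    · subst h
      simp [two_smul]
    · simp [h, Ne.symm h]
  rw [Finset.sum_congr rfl this, Finset.sum_ite_eq]
  split_ifs
  · rw [smul_smul]; norm_num
  · simp

theorem eulS_mul (s : Finset σ) (P Q : MvPolynomial σ ℂ) :
    eulS s (P * Q) = eulS s P * Q + P * eulS s Q := by
  simp only [eulS_apply, Derivation.leibniz, smul_eq_mul, Finset.sum_mul, Finset.mul_sum,
    ← Finset.sum_add_distrib]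
  exact Finset.sum_congr rfl fun a _ => by ring

theorem eulS_rhoS (s : Finset σ) : eulS s (rhoS s) = (2 : ℂ) • rhoS s := by
  classical
  rw [eulS_apply, two_smul_rhoS]
  refine Finset.sum_congr rfl fun a ha => ?_
  rw [pderiv_rhoS, if_pos ha, sq]

theorem eulS_rhoS_of_disjoint {s t : Finset σ} (h : Disjoint s t) : eulS s (rhoS t) = 0 := by
  classical
  rw [eulS_apply]
  refine Finset.sum_eq_zero fun a ha => ?_
  rw [pderiv_rhoS, if_neg (Finset.disjoint_left.1 h ha), mul_zero]

theorem eulS_pow {s : Finset σ} {P : MvPolynomial σ ℂ} {e : ℂ} (h : eulS s P = e • P) (n : ℕ) :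
    eulS s (P ^ n) = (n * e) • P ^ n := by
  induction n with
  | zero =>
    have : eulS s (1 : MvPolynomial σ ℂ) = 0 := by simp [eulS_apply]
    simp [this]
  | succ n ih =>
    rw [pow_succ, eulS_mul, ih, h]
    push_cast
    simp only [smul_mul_assoc, mul_smul_comm]
    module

theorem eulS_mul_of_eigen {s : Finset σ} {P Q : MvPolynomial σ ℂ} {e e' : ℂ}
    (hP : eulS s P = e • P) (hQ : eulS s Q = e' • Q) : eulS s (P * Q) = (e + e') • (P * Q) := by
  rw [eulS_mul, hP, hQ]
  simp only [smul_mul_assoc, mul_smul_comm]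
  module

/-- The Laplacian of `P ρ`. -/
theorem lapS_mul_rhoS (s : Finset σ) (P : MvPolynomial σ ℂ) :
    lapS s (P * rhoS s) = lapS s P * rhoS s + (2 : ℂ) • eulS s P + (s.card : ℂ) • P := by
  classical
  simp only [lapS_apply, eulS_apply, Derivation.leibniz, smul_eq_mul, map_add]
  rw [Finset.sum_mul, Finset.smul_sum]
  have e : (s.card : ℂ) • P = ∑ a ∈ s, P := by
    rw [Finset.sum_const, Nat.cast_smul_eq_nsmul]
  rw [e, ← Finset.sum_add_distrib, ← Finset.sum_add_distrib]
  refine Finset.sum_congr rfl fun a ha => ?_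
  rw [pderiv_rhoS, if_pos ha, pderiv_X_self, two_smul]
  ring

theorem lapS_mul_of_const {s : Finset σ} {Q : MvPolynomial σ ℂ} (hQ : ∀ a ∈ s, pderiv a Q = 0)
    (P : MvPolynomial σ ℂ) : lapS s (P * Q) = lapS s P * Q := by
  simp only [lapS_apply, Finset.sum_mul]
  refine Finset.sum_congr rfl fun a ha => ?_
  simp [Derivation.leibniz, hQ a ha, mul_comm]

theorem pderiv_rhoS_pow_of_disjoint {s t : Finset σ} (h : Disjoint s t) (n : ℕ) {a : σ}
    (ha : a ∈ s) : pderiv a (rhoS t ^ n) = 0 := by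
  classical
  rw [Derivation.leibniz_pow, pderiv_rhoS, if_neg (Finset.disjoint_left.1 h ha)]
  simp

/-- The Laplacian of `P ρⁿ` for `P` harmonic and homogeneous. -/
theorem lapS_mul_rhoS_pow {s : Finset σ} {P : MvPolynomial σ ℂ} {e : ℂ}
    (he : eulS s P = e • P) (hl : lapS s P = 0) (n : ℕ) :
    lapS s (P * rhoS s ^ (n + 1)) =
      (2 * (n + 1) * (e + (s.card : ℂ) / 2 + n)) • (P * rhoS s ^ n) := by
  induction n with
  | zero =>
    rw [zero_add, pow_one, lapS_mul_rhoS, hl, he]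
    simp only [zero_mul, zero_add, pow_zero, mul_one, Nat.cast_zero, add_zero]
    module
  | succ n ih =>
    have hE : eulS s (P * rhoS s ^ (n + 1)) = (e + ((n + 1 : ℕ) : ℂ) * 2) •
        (P * rhoS s ^ (n + 1)) := eulS_mul_of_eigen he (eulS_pow (eulS_rhoS s) (n + 1))
    rw [pow_succ, ← mul_assoc, lapS_mul_rhoS, ih, hE, smul_mul_assoc, mul_assoc P, ← pow_succ]
    push_cast
    module

/-- The angular momentum operators. -/
def angS (a b : σ) (P : MvPolynomial σ ℂ) : MvPolynomial σ ℂ := X a * pderiv b P - X b * pderiv a P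

theorem pderiv_comm (a b : σ) (P : MvPolynomial σ ℂ) :
    pderiv a (pderiv b P) = pderiv b (pderiv a P) := by
  classical
  induction P using MvPolynomial.induction_on with
  | C c => simp
  | add f g hf hg => simp [hf, hg]
  | mul_X f c hf =>
    simp only [Derivation.leibniz, smul_eq_mul, map_add, hf, pderiv_X, Pi.single_apply]
    split_ifs <;> simp <;> ring

theorem sum_X_mul_pderiv_X_mul (s : Finset σ) (P : MvPolynomial σ ℂ) :
    ∑ a ∈ s, ∑ b ∈ s, X a * pderiv b (X a * pderiv b P) =
      (2 : ℂ) • (rhoS s * lapS s P) + eulS s P := by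
  classical
  rw [← smul_mul_assoc, two_smul_rhoS, lapS_apply, Finset.sum_mul_sum, eulS_apply,
    ← Finset.sum_add_distrib]
  refine Finset.sum_congr rfl fun a ha => ?_
  have : ∀ b ∈ s, X a * pderiv b (X a * pderiv b P) = X a ^ 2 * pderiv b (pderiv b P) +
      if a = b then X a * pderiv a P else 0 := by
    intro b _
    rw [Derivation.leibniz, smul_eq_mul, smul_eq_mul, pderiv_X, Pi.single_apply]
    split_ifs with h
    · subst h; ring
    · ring
  rw [Finset.sum_congr rfl this, Finset.sum_add_distrib, Finset.sum_ite_eq, if_pos ha]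

theorem eulS_eulS (s : Finset σ) (P : MvPolynomial σ ℂ) :
    eulS s (eulS s P) = ∑ a ∈ s, ∑ b ∈ s, X a * (X b * pderiv b (pderiv a P)) + eulS s P := by
  classical
  conv_lhs => rw [eulS_apply, eulS_apply]
  conv_rhs => rw [eulS_apply]
  rw [← Finset.sum_add_distrib]
  refine Finset.sum_congr rfl fun a ha => ?_
  rw [map_sum, Finset.mul_sum]
  have : ∀ b ∈ s, X a * pderiv a (X b * pderiv b P) =
      X a * (X b * pderiv b (pderiv a P)) + if a = b then X a * pderiv a P else 0 := by
    intro b _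
    rw [Derivation.leibniz, smul_eq_mul, smul_eq_mul, pderiv_X, Pi.single_apply, pderiv_comm a b]
    by_cases h : a = b
    · subst h
      simp
      ring
    · simp [h, Ne.symm h]
  rw [Finset.sum_congr rfl this, Finset.sum_add_distrib, Finset.sum_ite_eq, if_pos ha]

theorem sum_X_mul_pderiv_X_mul_swap (s : Finset σ) (P : MvPolynomial σ ℂ) :
    ∑ a ∈ s, ∑ b ∈ s, X a * pderiv b (X b * pderiv a P) =
      eulS s (eulS s P) + ((s.card : ℂ) - 1) • eulS s P := by
  have h5 : ∑ a ∈ s, ∑ b ∈ s, X a * pderiv b (X b * pderiv a P) =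
      ∑ a ∈ s, ∑ b ∈ s, X a * (X b * pderiv b (pderiv a P)) + (s.card : ℂ) • eulS s P := by
    have : ∀ a b, X a * pderiv b (X b * pderiv a P) =
      X a * (X b * pderiv b (pderiv a P)) + X a * pderiv a P := by
      intro a b
      rw [Derivation.leibniz, smul_eq_mul, smul_eq_mul, pderiv_X_self]
      ring
    simp only [this, Finset.sum_add_distrib]
    congr 1
    rw [eulS_apply, Finset.smul_sum]
    refine Finset.sum_congr rfl fun a _ => ?_
    rw [Finset.sum_const, Nat.cast_smul_eq_nsmul]
  rw [h5, eulS_eulS]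
  module

/-- Expanding the square of an angular momentum gives four double sums, equal in pairs after
exchanging the indices; each pair is expressed by the Laplacian and the Euler operator. -/
theorem sum_angS_sq (s : Finset σ) (P : MvPolynomial σ ℂ) :
    ∑ a ∈ s, ∑ b ∈ s, angS a b (angS a b P) =
      (4 : ℂ) • (rhoS s * lapS s P) - (2 : ℂ) • eulS s (eulS s P) -
        (2 * ((s.card : ℂ) - 2)) • eulS s P := by
  have h1 : ∀ a b, angS a b (angS a b P) =
      (X a * pderiv b (X a * pderiv b P) - X a * pderiv b (X b * pderiv a P)) +
      (X b * pderiv a (X b * pderiv a P) - X b * pderiv a (X a * pderiv b P)) := by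
    intro a b
    simp only [angS, map_sub, mul_sub]
    abel
  simp only [h1, Finset.sum_add_distrib, Finset.sum_sub_distrib]
  rw [Finset.sum_comm (f := fun a b => X b * pderiv a (X b * pderiv a P)),
    Finset.sum_comm (f := fun a b => X b * pderiv a (X a * pderiv b P)),
    sum_X_mul_pderiv_X_mul, sum_X_mul_pderiv_X_mul_swap]
  module

/-- The eigenvalue of the Casimir operator of a block of variables. -/
theorem sum_angS_sq_mul_rhoS_pow {s : Finset σ} {P : MvPolynomial σ ℂ} {e : ℂ}
    (he : eulS s P = e • P) (hl : lapS s P = 0) (n : ℕ) :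
    ∑ a ∈ s, ∑ b ∈ s, angS a b (angS a b (P * rhoS s ^ n)) =
      (-2 * e * (e + (s.card : ℂ) - 2)) • (P * rhoS s ^ n) := by
  have hE : eulS s (P * rhoS s ^ n) = (e + (n : ℂ) * 2) •
      (P * rhoS s ^ n) := eulS_mul_of_eigen he (eulS_pow (eulS_rhoS s) n)
  rw [sum_angS_sq, hE, map_smul, hE]
  -- The terms containing n cancel between the Laplacian and the Euler part, in accordance with the
  -- rotation invariance of ρ. The case n = 0 is separate because there the Laplacian vanishes
  -- outright.
  rcases n with _ | n
  · simp only [pow_zero, mul_one, hl, mul_zero, Nat.cast_zero]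
    module
  · rw [lapS_mul_rhoS_pow he hl, mul_smul_comm, mul_left_comm, ← pow_succ']
    push_cast
    module

end Block

/-! ### Functions of the form `P(x, y) χ(ρ_x ρ_y)` -/

section Radial

open MvPolynomial

variable {p q : ℕ}

/-- The `x`-variables. -/
def bX (p q : ℕ) : Finset (Fin p ⊕ Fin q) := Finset.univ.map Function.Embedding.inl

/-- The `y`-variables. -/
def bY (p q : ℕ) : Finset (Fin p ⊕ Fin q) := Finset.univ.map Function.Embedding.inr

theorem card_bX : (bX p q).card = p := by simp [bX]

theorem card_bY : (bY p q).card = q := by simp [bY]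

theorem disjoint_bX_bY : Disjoint (bX p q) (bY p q) := by
  rw [Finset.disjoint_left]
  rintro (i | i) h <;> simp [bX, bY] at h ⊢

/-- The polynomial `ρ_x`. -/
abbrev rX (p q : ℕ) : Pol p q := rhoS (bX p q)

/-- The polynomial `ρ_y`. -/
abbrev rY (p q : ℕ) : Pol p q := rhoS (bY p q)

theorem evalV_rX (v : V p q) : evalV v (rX p q) = (rho v.1 : ℂ) := by
  rw [rX, rhoS, map_smul, map_sum, bX, Finset.sum_map, rho]
  simp [evalV, coordC]
  ring

theorem evalV_rY (v : V p q) : evalV v (rY p q) = (rho v.2 : ℂ) := by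
  rw [rY, rhoS, map_smul, map_sum, bY, Finset.sum_map, rho]
  simp [evalV, coordC]
  ring

/-- The function `χ(ρ_x ρ_y)`. -/
def rad : Ent →ₗ[ℂ] Smooth p q where
  toFun χ := ⟨fun v => χ.1 (evalV v (rX p q * rY p q)), Set.mem_ofPred.2
    (((Ent.differentiable χ).contDiff.restrict_scalars ℝ).comp (contDiff_evalV _))⟩
  map_add' _ _ := rfl
  map_smul' _ _ := rfl

theorem fderiv_evalV (a : Fin p ⊕ Fin q) (P : Pol p q) (v : V p q) :
    fderiv ℝ (fun v : V p q => evalV v P) v (basisV a) = evalV v (pderiv a P) := by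
  let one : Smooth p q := ⟨fun _ => 1, (contDiff_const : ContDiff ℝ ∞ fun _ : V p q => (1 : ℂ))⟩
  have h := congrArg (fun f : Smooth p q => f.1 v) (dd_polyMul_apply a P one)
  have h1 : (polyMul P one).1 = fun v : V p q => evalV v P := funext fun v => mul_one _
  have h2 : dd a one = 0 := by
    rw [dd_eq]
    refine smooth_ext fun v => ?_
    rw [dirDeriv_apply]
    change fderiv ℝ (fun _ : V p q => (1 : ℂ)) v (basisV a) = 0
    simp
  rw [h2, map_zero, zero_add, dd_eq] at h
  change fderiv ℝ (polyMul P one).1 v (basisV a) = evalV v (pderiv a P) * 1 at h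
  rw [h1, mul_one] at h
  exact h

theorem dd_rad (a : Fin p ⊕ Fin q) (χ : Ent) :
    dd a (rad χ) = polyMul (pderiv a (rX p q * rY p q)) (rad (entD χ)) := by
  refine smooth_ext fun v => ?_
  rw [dd_eq, dirDeriv_apply, polyMul_apply, ← fderiv_evalV]
  have h1 := (Ent.differentiable χ (evalV v (rX p q * rY p q))).hasDerivAt.complexToReal_fderiv
  have h2 := ((contDiff_evalV (rX p q * rY p q)).differentiable (by simp) v).hasFDerivAt
  have h3 := HasFDerivAt.comp v h1 h2
  have h4 : (rad χ : Smooth p q).1 = χ.1 ∘ fun v => evalV v (rX p q * rY p q) := rfl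
  rw [h4, h3.fderiv, ContinuousLinearMap.comp_apply, mul_comm (fderiv ℝ _ v _)]
  rfl

/-- The function `P(x, y) χ(ρ_x ρ_y)`. -/
def G : Pol p q →ₗ[ℂ] Ent →ₗ[ℂ] Smooth p q :=
  LinearMap.mk₂ ℂ (fun P χ => polyMul P (rad χ)) (fun P Q χ => by rw [map_add]; rfl)
    (fun c P χ => by rw [map_smul]; rfl) (fun P χ θ => by rw [map_add, map_add])
    (fun c P χ => by rw [map_smul, map_smul])

theorem G_eq (P : Pol p q) (χ : Ent) : G P χ = polyMul P (rad χ) := rfl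

theorem G_apply (P : Pol p q) (χ : Ent) (v : V p q) :
    (G P χ).1 v = evalV v P * χ.1 (evalV v (rX p q * rY p q)) := rfl

theorem polyMul_G (Q P : Pol p q) (χ : Ent) : polyMul Q (G P χ) = G (Q * P) χ := by
  rw [G_eq, G_eq, map_mul, Module.End.mul_apply]

/-- A factor ρ_x ρ_y may be kept in the polynomial or moved into the entire function as
multiplication by z. -/
theorem G_mul_rho (P : Pol p q) (χ : Ent) : G (P * (rX p q * rY p q)) χ = G P (entZ * χ) := by
  refine smooth_ext fun v => ?_
  rw [G_apply, G_apply, map_mul, mul_assoc]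
  rfl

theorem dd_G (a : Fin p ⊕ Fin q) (P : Pol p q) (χ : Ent) :
    dd a (G P χ) = G (pderiv a P) χ + G (P * pderiv a (rX p q * rY p q)) (entD χ) := by
  rw [G_eq, dd_polyMul_apply, dd_rad, ← G_eq, ← G_eq, polyMul_G, add_comm]

/-- Here `s` stands for one block of variables and `R` for the half square norm of the other, so
that the computations serve both blocks. -/
theorem dd_G_of_mem {s : Finset (Fin p ⊕ Fin q)} {R : Pol p q}
    (hU : ∀ a ∈ s, pderiv a (rX p q * rY p q) = X a * R) {a : Fin p ⊕ Fin q} (ha : a ∈ s)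
    (P : Pol p q) (χ : Ent) :
    dd a (G P χ) = G (pderiv a P) χ + G (P * R * X a) (entD χ) := by
  rw [dd_G, hU a ha, mul_assoc, mul_comm R]

theorem pderiv_rho_of_mem_bX {a : Fin p ⊕ Fin q} (ha : a ∈ bX p q) :
    pderiv a (rX p q * rY p q) = X a * rY p q := by
  rw [Derivation.leibniz, pderiv_rhoS, pderiv_rhoS, if_pos ha,
    if_neg (Finset.disjoint_left.1 disjoint_bX_bY ha), smul_zero, zero_add, smul_eq_mul, mul_comm]

theorem pderiv_rho_of_mem_bY {a : Fin p ⊕ Fin q} (ha : a ∈ bY p q) :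
    pderiv a (rX p q * rY p q) = X a * rX p q := by
  rw [Derivation.leibniz, pderiv_rhoS, pderiv_rhoS, if_pos ha,
    if_neg (Finset.disjoint_right.1 disjoint_bX_bY ha), smul_zero, add_zero, smul_eq_mul, mul_comm]

theorem sum_mul_dd_G {s : Finset (Fin p ⊕ Fin q)} {R : Pol p q}
    (hU : ∀ a ∈ s, pderiv a (rX p q * rY p q) = X a * R) (P : Pol p q) (χ : Ent) :
    ∑ a ∈ s, polyMul (X a) (dd a (G P χ)) =
      G (eulS s P) χ + G (P * R * (2 : ℂ) • rhoS s) (entD χ) := by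
  rw [two_smul_rhoS, eulS_apply, Finset.mul_sum, map_sum, map_sum, LinearMap.sum_apply,
    LinearMap.sum_apply, ← Finset.sum_add_distrib]
  refine Finset.sum_congr rfl fun a ha => ?_
  have h : X a * (P * R * X a) = P * R * X a ^ 2 := by ring
  rw [dd_G_of_mem hU ha, map_add, polyMul_G, polyMul_G, h]

theorem sum_dd_dd_G {s : Finset (Fin p ⊕ Fin q)} {R : Pol p q}
    (hU : ∀ a ∈ s, pderiv a (rX p q * rY p q) = X a * R) (hR : ∀ a ∈ s, pderiv a R = 0)
    (P : Pol p q) (χ : Ent) :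
    ∑ a ∈ s, dd a (dd a (G P χ)) =
      G (lapS s P) χ + G ((2 : ℂ) • (eulS s P * R) + (s.card : ℂ) • (P * R)) (entD χ) +
        G (P * R * R * (2 : ℂ) • rhoS s) (entD (entD χ)) := by
  have e : (s.card : ℂ) • (P * R) = ∑ a ∈ s, P * R := by
    rw [Finset.sum_const, Nat.cast_smul_eq_nsmul]
  rw [e, two_smul_rhoS, lapS_apply, eulS_apply, Finset.mul_sum, Finset.sum_mul, Finset.smul_sum,
    ← Finset.sum_add_distrib, map_sum, map_sum, map_sum, LinearMap.sum_apply,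
    LinearMap.sum_apply, LinearMap.sum_apply, ← Finset.sum_add_distrib, ← Finset.sum_add_distrib]
  refine Finset.sum_congr rfl fun a ha => ?_
  rw [dd_G_of_mem hU ha, map_add, dd_G_of_mem hU ha, dd_G_of_mem hU ha]
  have h1 : pderiv a (P * R * X a) = pderiv a P * R * X a + P * R := by
    simp only [Derivation.leibniz, smul_eq_mul, hR a ha, pderiv_X_self]
    ring
  have h2 : (2 : ℂ) • (X a * pderiv a P * R) + P * R =
      pderiv a P * R * X a + (pderiv a P * R * X a + P * R) := by
    rw [two_smul]
    ring
  have h3 : P * R * X a * R * X a = P * R * R * X a ^ 2 := by ring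
  rw [h1, h2, h3, map_add _ (pderiv a P * R * X a) (pderiv a P * R * X a + P * R),
    LinearMap.add_apply]
  abel

theorem opXp_apply (f : Smooth p q) :
    opXp p q f = -(1 / 2 : ℂ) • (∑ a ∈ bX p q, dd a (dd a f)) - polyMul (rY p q) f := by
  have h : polyMul (rY p q) f = (1 / 2 : ℂ) • ∑ j, my j (my j f) := by
    rw [rY, rhoS, map_smul, map_sum, bY, Finset.sum_map, LinearMap.smul_apply,
      LinearMap.sum_apply]
    congr 1
    refine Finset.sum_congr rfl fun j _ => ?_
    rw [my_eq, sq, map_mul]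
    rfl
  rw [h, bX, Finset.sum_map, opXp]
  simp only [LinearMap.smul_apply, LinearMap.add_apply, LinearMap.sum_apply,
    Module.End.mul_apply, smul_add, neg_smul, sub_eq_add_neg]
  exact congrArg₂ _ (neg_smul (1 / 2 : ℂ) _).symm rfl

theorem opXm_apply (f : Smooth p q) :
    opXm p q f = (1 / 2 : ℂ) • (∑ a ∈ bY p q, dd a (dd a f)) + polyMul (rX p q) f := by
  have h : polyMul (rX p q) f = (1 / 2 : ℂ) • ∑ j, mx j (mx j f) := by
    rw [rX, rhoS, map_smul, map_sum, bX, Finset.sum_map, LinearMap.smul_apply,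
      LinearMap.sum_apply]
    congr 1
    refine Finset.sum_congr rfl fun j _ => ?_
    rw [mx_eq, sq, map_mul]
    rfl
  rw [h, bY, Finset.sum_map, opXm]
  simp only [LinearMap.smul_apply, LinearMap.add_apply, LinearMap.sum_apply,
    Module.End.mul_apply, smul_add]
  rw [add_comm]
  rfl

theorem opH_apply_block (f : Smooth p q) :
    opH p q f = -(∑ a ∈ bX p q, polyMul (X a) (dd a f)) - ((p : ℂ) / 2) • f +
      (∑ a ∈ bY p q, polyMul (X a) (dd a f)) + ((q : ℂ) / 2) • f := by
  rw [opH_apply, bX, bY, Finset.sum_map, Finset.sum_map]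
  simp only [mx_eq, my_eq]
  rfl

/-- The derivatives of χ(ρ_x ρ_y) contribute equally to the two Euler operators and cancel in H. -/
theorem opH_G {P : Pol p q} {e e' : ℂ} (hx : eulS (bX p q) P = e • P)
    (hy : eulS (bY p q) P = e' • P) (χ : Ent) :
    opH p q (G P χ) = ((e' + (q : ℂ) / 2) - (e + (p : ℂ) / 2)) • G P χ := by
  rw [opH_apply_block, sum_mul_dd_G fun a ha => pderiv_rho_of_mem_bX ha,
    sum_mul_dd_G fun a ha => pderiv_rho_of_mem_bY ha, hx, hy]
  have : P * rY p q * (2 : ℂ) • rX p q = P * rX p q * (2 : ℂ) • rY p q := by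
    rw [mul_smul_comm, mul_smul_comm, mul_right_comm]
  rw [this]
  simp only [map_smul, LinearMap.smul_apply]
  module

/-- By the chain rule the x-Laplacian of χ(ρ_x ρ_y) contributes ρ_y (zχ'' + (e + p/2) χ'), and
multiplication by ρ_y in X⁺ supplies the last term of the Bessel operator. -/
theorem opXp_G {P : Pol p q} {e : ℂ} (hx : eulS (bX p q) P = e • P) (χ : Ent) :
    opXp p q (G P χ) = -(1 / 2 : ℂ) • G (lapS (bX p q) P) χ -
      G (P * rY p q) (besselOp (e + (p : ℂ) / 2) χ) := by
  have hR : ∀ a ∈ bX p q, pderiv a (rY p q) = 0 := fun a ha => by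
    rw [pderiv_rhoS, if_neg (Finset.disjoint_left.1 disjoint_bX_bY ha)]
  rw [opXp_apply, sum_dd_dd_G (fun a ha => pderiv_rho_of_mem_bX ha) hR, hx, card_bX, polyMul_G,
    besselOp]
  have h1 : P * rY p q * rY p q * (2 : ℂ) • rX p q =
      (2 : ℂ) • (P * rY p q * (rX p q * rY p q)) := by
    rw [mul_smul_comm, mul_assoc _ (rY p q) (rX p q), mul_comm (rY p q) (rX p q)]
  rw [h1]
  simp only [map_smul, map_add, LinearMap.smul_apply, LinearMap.add_apply, G_mul_rho,
    smul_mul_assoc, mul_comm (rY p q) P]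
  module

theorem opXm_G {P : Pol p q} {e : ℂ} (hy : eulS (bY p q) P = e • P) (χ : Ent) :
    opXm p q (G P χ) = (1 / 2 : ℂ) • G (lapS (bY p q) P) χ +
      G (P * rX p q) (besselOp (e + (q : ℂ) / 2) χ) := by
  have hR : ∀ a ∈ bY p q, pderiv a (rX p q) = 0 := fun a ha => by
    rw [pderiv_rhoS, if_neg (Finset.disjoint_right.1 disjoint_bX_bY ha)]
  rw [opXm_apply, sum_dd_dd_G (fun a ha => pderiv_rho_of_mem_bY ha) hR, hy, card_bY, polyMul_G,
    besselOp]
  have h1 : P * rX p q * rX p q * (2 : ℂ) • rY p q =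
      (2 : ℂ) • (P * rX p q * (rX p q * rY p q)) := by
    rw [mul_smul_comm, mul_assoc _ (rX p q) (rY p q)]
  rw [h1]
  simp only [map_smul, map_add, LinearMap.smul_apply, LinearMap.add_apply, G_mul_rho,
    smul_mul_assoc, mul_comm (rX p q) P]
  module

/-! ### The action of `K` on polynomials -/

/-- The action of `K` on polynomials. -/
def polyK (k : K p q) : Pol p q →ₐ[ℂ] Pol p q :=
  aeval fun a => ∑ b, kMat k b a • X b

theorem polyK_X (k : K p q) (a : Fin p ⊕ Fin q) : polyK k (X a) = ∑ b, kMat k b a • X b := by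
  simp [polyK]

theorem evalV_polyK (k : K p q) (P : Pol p q) (v : V p q) :
    evalV v (polyK k P) = evalV (kInvAct k v) P := by
  have h : (evalV v).comp (polyK k) = evalV (kInvAct k v) := by
    apply MvPolynomial.algHom_ext
    intro a
    simp [polyK_X, evalV, coordC_kInvAct]
  exact congrArg (fun f : Pol p q →ₐ[ℂ] ℂ => f P) h

theorem polyK_rename_inl (k : K p q) (h : MvPolynomial (Fin p) ℂ) :
    polyK k (rename Sum.inl h) = rename Sum.inl (polySubst k.1.1 h) := by
  have : (polyK k).comp (rename Sum.inl) = (rename Sum.inl).comp (polySubst k.1.1) := by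
    apply MvPolynomial.algHom_ext
    intro i
    simp [polyK_X, polySubst_X, Fintype.sum_sum_type, kMat, blockDiag, MvPolynomial.smul_eq_C_mul]
  exact congrArg (fun f : _ →ₐ[ℂ] Pol p q => f h) this

theorem polyK_rename_inr (k : K p q) (h : MvPolynomial (Fin q) ℂ) :
    polyK k (rename Sum.inr h) = rename Sum.inr (polySubst k.2.1 h) := by
  have : (polyK k).comp (rename Sum.inr) = (rename Sum.inr).comp (polySubst k.2.1) := by
    apply MvPolynomial.algHom_ext
    intro i
    simp [polyK_X, polySubst_X, Fintype.sum_sum_type, kMat, blockDiag, MvPolynomial.smul_eq_C_mul]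
  exact congrArg (fun f : _ →ₐ[ℂ] Pol p q => f h) this

theorem rename_sqNorm_inl : rename Sum.inl (sqNorm p) = (2 : ℂ) • rX p q := by
  rw [two_smul_rhoS, bX, Finset.sum_map, sqNorm, map_sum]
  simp

theorem rename_sqNorm_inr : rename Sum.inr (sqNorm q) = (2 : ℂ) • rY p q := by
  rw [two_smul_rhoS, bY, Finset.sum_map, sqNorm, map_sum]
  simp

theorem evalV_injective {P Q : Pol p q} (h : ∀ v, evalV v P = evalV v Q) : P = Q := by
  refine MvPolynomial.funext_set (fun _ => Set.range ((↑) : ℝ → ℂ))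
    (fun _ => Set.infinite_range_of_injective Complex.ofReal_injective) fun x hx => ?_
  choose y hy using fun i => hx i (Set.mem_univ i)
  have := h (fun i => y (Sum.inl i), fun j => y (Sum.inr j))
  have e : coordC ((fun i => y (Sum.inl i), fun j => y (Sum.inr j)) : V p q) = x := by
    funext a
    rcases a with i | j
    · exact hy (Sum.inl i)
    · exact hy (Sum.inr j)
  change aeval (coordC _) P = aeval (coordC _) Q at this
  rw [e] at this
  simpa [aeval_eq_eval] using this

theorem rho_mulVec {n : ℕ} (g : Orth n) (x : Fin n → ℝ) : rho (g.1.mulVec x) = rho x := by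
  have h := congrArg (fun A => x ⬝ᵥ A.mulVec x) ((Matrix.mem_orthogonalGroup_iff' (Fin n) ℝ).1 g.2)
  simp only [Matrix.one_mulVec] at h
  have e : ∀ y : Fin n → ℝ, rho y = (y ⬝ᵥ y) / 2 := fun y => by
    simp only [rho, dotProduct, sq]
  rw [e, e, ← h, ← Matrix.mulVec_mulVec, Matrix.dotProduct_mulVec x, Matrix.vecMul_transpose]

theorem polyK_rX (k : K p q) : polyK k (rX p q) = rX p q := by
  refine evalV_injective fun v => ?_
  rw [evalV_polyK, evalV_rX, evalV_rX]
  congr 1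
  exact rho_mulVec k⁻¹.1 v.1

theorem polyK_rY (k : K p q) : polyK k (rY p q) = rY p q := by
  refine evalV_injective fun v => ?_
  rw [evalV_polyK, evalV_rY, evalV_rY]
  congr 1
  exact rho_mulVec k⁻¹.2 v.2

theorem piK_G (k : K p q) (P : Pol p q) (χ : Ent) : piK p q k (G P χ) = G (polyK k P) χ := by
  refine smooth_ext fun v => ?_
  rw [piK_apply, G_apply, G_apply, evalV_polyK, ← evalV_polyK k (rX p q * rY p q) v, map_mul,
    polyK_rX, polyK_rY]

end Radial

/-! ### Products of harmonic polynomials -/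

section Types

open MvPolynomial

variable {p q : ℕ}

/-- The map `h₁ ⊗ h₂ ↦ h₁(x) h₂(y)`. -/
def theta (k l : ℕ) : Harm k p ⊗[ℂ] Harm l q →ₗ[ℂ] Pol p q :=
  TensorProduct.lift (LinearMap.mk₂ ℂ (fun (h₁ : Harm k p) (h₂ : Harm l q) =>
    (rename Sum.inl h₁.1 * rename Sum.inr h₂.1 : Pol p q))
    (fun a b c => by rw [Submodule.coe_add, map_add, add_mul])
    (fun c a b => by rw [Submodule.coe_smul, map_smul, smul_mul_assoc])
    (fun a b c => by rw [Submodule.coe_add, map_add, mul_add])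
    (fun c a b => by rw [Submodule.coe_smul, map_smul, mul_smul_comm]))

theorem theta_tmul {k l : ℕ} (a : Harm k p) (b : Harm l q) :
    theta k l (a ⊗ₜ[ℂ] b) = (rename Sum.inl a.1 * rename Sum.inr b.1 : Pol p q) := rfl

theorem theta_kTypeRep {k l : ℕ} (g : K p q) (w : Harm k p ⊗[ℂ] Harm l q) :
    theta k l (kTypeRep p q k l g w) = polyK g (theta k l w) := by
  induction w using TensorProduct.induction_on with
  | zero => simp
  | add a b ha hb => simp only [map_add, ha, hb]
  | tmul a b =>
    rw [kTypeRep_tmul, theta_tmul, theta_tmul, map_mul, polyK_rename_inl, polyK_rename_inr,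
      harmRep_apply, harmRep_apply]

/-- The kernel is K-stable, so by irreducibility it is zero or everything. In the second case all
pure tensors map to zero, although a product of nonzero polynomials in separate variables is
nonzero, so the tensor product itself is zero. -/
theorem theta_eq_zero (hp : 0 < p) (hq : 0 < q) {k l : ℕ} {w : Harm k p ⊗[ℂ] Harm l q}
    (hw : theta k l w = (0 : Pol p q)) : w = 0 := by
  rcases kType_eq_bot_or_eq_top hp hq (LinearMap.ker (theta k l : _ →ₗ[ℂ] Pol p q))
    (fun g w hw => by
      rw [LinearMap.mem_ker] at hw ⊢
      rw [theta_kTypeRep, hw, map_zero]) with h | h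
  · have h1 : w ∈ LinearMap.ker (theta k l : _ →ₗ[ℂ] Pol p q) := LinearMap.mem_ker.2 hw
    rw [h] at h1
    exact (Submodule.mem_bot ℂ).1 h1
  · clear hw
    induction w using TensorProduct.induction_on with
    | zero => rfl
    | add a b ha hb => rw [ha, hb, add_zero]
    | tmul a b =>
      have h1 : theta k l (a ⊗ₜ[ℂ] b) = (0 : Pol p q) := by
        rw [← LinearMap.mem_ker, h]
        trivial
      rw [theta_tmul] at h1
      rcases mul_eq_zero.1 h1 with h2 | h2
      · have : a = 0 := Subtype.ext (rename_injective _ Sum.inl_injective (by simpa using h2))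
        rw [this, TensorProduct.zero_tmul]
      · have : b = 0 := Subtype.ext (rename_injective _ Sum.inr_injective (by simpa using h2))
        rw [this, TensorProduct.tmul_zero]

/-- The span of the products of harmonic polynomials of degrees `k` and `l`. -/
def HH (p q k l : ℕ) : Submodule ℂ (Pol p q) := LinearMap.range (theta k l)

instance (k l : ℕ) : FiniteDimensional ℂ (HH p q k l) :=
  inferInstanceAs (FiniteDimensional ℂ (LinearMap.range (theta k l)))

theorem HH_induction {k l : ℕ} {motive : Pol p q → Prop} (h0 : motive 0)
    (hadd : ∀ P Q, motive P → motive Q → motive (P + Q))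
    (hmul : ∀ h₁ ∈ Harm k p, ∀ h₂ ∈ Harm l q, motive (rename Sum.inl h₁ * rename Sum.inr h₂))
    {P : Pol p q} (hP : P ∈ HH p q k l) : motive P := by
  obtain ⟨w, rfl⟩ := hP
  induction w using TensorProduct.induction_on with
  | zero => simpa using h0
  | add a b ha hb =>
    rw [map_add]
    exact hadd _ _ ha hb
  | tmul a b => exact hmul _ a.2 _ b.2

theorem mul_mem_HH {k l : ℕ} {h₁ : MvPolynomial (Fin p) ℂ} {h₂ : MvPolynomial (Fin q) ℂ}
    (H₁ : h₁ ∈ Harm k p) (H₂ : h₂ ∈ Harm l q) :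
    rename Sum.inl h₁ * rename Sum.inr h₂ ∈ HH p q k l :=
  ⟨(⟨h₁, H₁⟩ : Harm k p) ⊗ₜ[ℂ] (⟨h₂, H₂⟩ : Harm l q), theta_tmul _ _⟩

theorem pderiv_rename_of_ne {σ τ : Type*} {f : σ → τ} {b : τ} (hb : ∀ a, f a ≠ b)
    (P : MvPolynomial σ ℂ) : pderiv b (rename f P) = 0 := by
  induction P using MvPolynomial.induction_on with
  | C c => simp
  | add f g hf hg => simp [hf, hg]
  | mul_X g a hg =>
    simp [hg, Derivation.leibniz, pderiv_X_of_ne (hb a)]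

theorem pderiv_inl_mul (i : Fin p) (f : MvPolynomial (Fin p) ℂ) (g : MvPolynomial (Fin q) ℂ) :
    pderiv (Sum.inl i) (rename Sum.inl f * rename Sum.inr g : Pol p q) =
      rename Sum.inl (pderiv i f) * rename Sum.inr g := by
  rw [Derivation.leibniz, pderiv_rename Sum.inl_injective,
    pderiv_rename_of_ne (fun _ => Sum.inr_ne_inl), smul_zero, zero_add, smul_eq_mul, mul_comm]

theorem pderiv_inr_mul (j : Fin q) (f : MvPolynomial (Fin p) ℂ) (g : MvPolynomial (Fin q) ℂ) :
    pderiv (Sum.inr j) (rename Sum.inl f * rename Sum.inr g : Pol p q) =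
      rename Sum.inl f * rename Sum.inr (pderiv j g) := by
  rw [Derivation.leibniz, pderiv_rename Sum.inr_injective,
    pderiv_rename_of_ne (fun _ => Sum.inl_ne_inr), smul_zero, add_zero, smul_eq_mul]

theorem HH_eulX {k l : ℕ} {P : Pol p q} (hP : P ∈ HH p q k l) :
    eulS (bX p q) P = (k : ℂ) • P := by
  refine HH_induction (motive := fun P => eulS (bX p q) P = (k : ℂ) • P) (by simp) (fun P Q hP hQ => by rw [map_add, hP, hQ, smul_add]) ?_ hP
  intro h₁ H₁ h₂ H₂
  rw [eulS_apply, bX, Finset.sum_map]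
  have h := congrArg (rename (Sum.inl : Fin p → Fin p ⊕ Fin q)) (mem_Harm.1 H₁).1.sum_X_mul_pderiv
  rw [map_sum, map_nsmul] at h
  simp only [map_mul, rename_X] at h
  rw [Nat.cast_smul_eq_nsmul, ← smul_mul_assoc, ← h, Finset.sum_mul]
  refine Finset.sum_congr rfl fun i _ => ?_
  rw [Function.Embedding.inl_apply, pderiv_inl_mul, mul_assoc]

theorem HH_eulY {k l : ℕ} {P : Pol p q} (hP : P ∈ HH p q k l) :
    eulS (bY p q) P = (l : ℂ) • P := by
  refine HH_induction (motive := fun P => eulS (bY p q) P = (l : ℂ) • P) (by simp) (fun P Q hP hQ => by rw [map_add, hP, hQ, smul_add]) ?_ hP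
  intro h₁ H₁ h₂ H₂
  rw [eulS_apply, bY, Finset.sum_map]
  have h := congrArg (rename (Sum.inr : Fin q → Fin p ⊕ Fin q)) (mem_Harm.1 H₂).1.sum_X_mul_pderiv
  rw [map_sum, map_nsmul] at h
  simp only [map_mul, rename_X] at h
  rw [Nat.cast_smul_eq_nsmul, ← mul_smul_comm, ← h, Finset.mul_sum]
  refine Finset.sum_congr rfl fun i _ => ?_
  rw [Function.Embedding.inr_apply, pderiv_inr_mul, mul_left_comm]

theorem polyLaplacian_apply {n : ℕ} (f : MvPolynomial (Fin n) ℂ) :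
    polyLaplacian n f = ∑ i, pderiv i (pderiv i f) := by
  simp [polyLaplacian, LinearMap.sum_apply]

theorem HH_lapX {k l : ℕ} {P : Pol p q} (hP : P ∈ HH p q k l) : lapS (bX p q) P = 0 := by
  refine HH_induction (motive := fun P => lapS (bX p q) P = 0) (by simp) (fun P Q hP hQ => by rw [map_add, hP, hQ, add_zero]) ?_ hP
  intro h₁ H₁ h₂ H₂
  rw [lapS_apply, bX, Finset.sum_map]
  have h := congrArg (rename (Sum.inl : Fin p → Fin p ⊕ Fin q)) (mem_Harm.1 H₁).2
  rw [polyLaplacian_apply, map_sum, map_zero] at h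
  simp only [Function.Embedding.inl_apply, pderiv_inl_mul]
  rw [← Finset.sum_mul, h, zero_mul]

theorem HH_lapY {k l : ℕ} {P : Pol p q} (hP : P ∈ HH p q k l) : lapS (bY p q) P = 0 := by
  refine HH_induction (motive := fun P => lapS (bY p q) P = 0) (by simp) (fun P Q hP hQ => by rw [map_add, hP, hQ, add_zero]) ?_ hP
  intro h₁ H₁ h₂ H₂
  rw [lapS_apply, bY, Finset.sum_map]
  have h := congrArg (rename (Sum.inr : Fin q → Fin p ⊕ Fin q)) (mem_Harm.1 H₂).2
  rw [polyLaplacian_apply, map_sum, map_zero] at h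
  simp only [Function.Embedding.inr_apply, pderiv_inr_mul]
  rw [← Finset.mul_sum, h, mul_zero]

theorem HH_eulX_mul {k l : ℕ} {P : Pol p q} (hP : P ∈ HH p q k l) (a b : ℕ) :
    eulS (bX p q) (P * (rX p q ^ a * rY p q ^ b)) =
      ((k : ℂ) + 2 * a) • (P * (rX p q ^ a * rY p q ^ b)) := by
  have h1 := eulS_pow (eulS_rhoS (bX p q)) a
  have h2 : eulS (bX p q) (rY p q ^ b) = (b * (0 : ℂ)) • rY p q ^ b :=
    eulS_pow (by rw [eulS_rhoS_of_disjoint disjoint_bX_bY, zero_smul]) b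
  rw [eulS_mul_of_eigen (HH_eulX hP) (eulS_mul_of_eigen h1 h2)]
  congr 1
  ring

theorem HH_eulY_mul {k l : ℕ} {P : Pol p q} (hP : P ∈ HH p q k l) (a b : ℕ) :
    eulS (bY p q) (P * (rX p q ^ a * rY p q ^ b)) =
      ((l : ℂ) + 2 * b) • (P * (rX p q ^ a * rY p q ^ b)) := by
  have h1 := eulS_pow (eulS_rhoS (bY p q)) b
  have h2 : eulS (bY p q) (rX p q ^ a) = (a * (0 : ℂ)) • rX p q ^ a :=
    eulS_pow (by rw [eulS_rhoS_of_disjoint disjoint_bX_bY.symm, zero_smul]) a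
  rw [eulS_mul_of_eigen (HH_eulY hP) (eulS_mul_of_eigen h2 h1)]
  congr 1
  ring

theorem HH_lapX_mul_zero {k l : ℕ} {P : Pol p q} (hP : P ∈ HH p q k l) (b : ℕ) :
    lapS (bX p q) (P * (rX p q ^ 0 * rY p q ^ b)) = 0 := by
  rw [pow_zero, one_mul, lapS_mul_of_const
    (fun a ha => pderiv_rhoS_pow_of_disjoint disjoint_bX_bY b ha), HH_lapX hP, zero_mul]

theorem HH_lapX_mul_succ {k l : ℕ} {P : Pol p q} (hP : P ∈ HH p q k l) (a b : ℕ) :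
    lapS (bX p q) (P * (rX p q ^ (a + 1) * rY p q ^ b)) =
      (2 * ((a : ℂ) + 1) * (k + (p : ℂ) / 2 + a)) • (P * (rX p q ^ a * rY p q ^ b)) := by
  rw [← mul_assoc, lapS_mul_of_const
    (fun a ha => pderiv_rhoS_pow_of_disjoint disjoint_bX_bY b ha),
    lapS_mul_rhoS_pow (HH_eulX hP) (HH_lapX hP), card_bX, smul_mul_assoc, mul_assoc P]

theorem HH_lapY_mul_zero {k l : ℕ} {P : Pol p q} (hP : P ∈ HH p q k l) (a : ℕ) :
    lapS (bY p q) (P * (rX p q ^ a * rY p q ^ 0)) = 0 := by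
  rw [pow_zero, mul_one, lapS_mul_of_const
    (fun b hb => pderiv_rhoS_pow_of_disjoint disjoint_bX_bY.symm a hb), HH_lapY hP, zero_mul]

theorem HH_lapY_mul_succ {k l : ℕ} {P : Pol p q} (hP : P ∈ HH p q k l) (a b : ℕ) :
    lapS (bY p q) (P * (rX p q ^ a * rY p q ^ (b + 1))) =
      (2 * ((b : ℂ) + 1) * (l + (q : ℂ) / 2 + b)) • (P * (rX p q ^ a * rY p q ^ b)) := by
  rw [mul_comm (rX p q ^ a), ← mul_assoc, lapS_mul_of_const
    (fun b hb => pderiv_rhoS_pow_of_disjoint disjoint_bX_bY.symm a hb),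
    lapS_mul_rhoS_pow (HH_eulY hP) (HH_lapY hP), card_bY, smul_mul_assoc, mul_assoc P,
    mul_comm (rX p q ^ a)]

/-! ### The decomposition of polynomials -/

theorem isHomogeneous_zero_eq_C {σ : Type*} {f : MvPolynomial σ ℂ} (hf : f.IsHomogeneous 0) :
    f = C (coeff 0 f) :=
  totalDegree_eq_zero_iff_eq_C.1 (Nat.le_zero.1 hf.totalDegree_le)

theorem polyLaplacian_isHomogeneous {n d : ℕ} {f : MvPolynomial (Fin n) ℂ}
    (hf : f.IsHomogeneous d) : (polyLaplacian n f).IsHomogeneous (d - 2) := by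
  rw [polyLaplacian_apply]
  exact IsHomogeneous.sum _ _ _ fun i _ => hf.pderiv.pderiv

/-- Polynomials are sums of products of harmonic polynomials and powers of the squared norm. -/
theorem mem_span_harm_mul_sqNorm_pow {n : ℕ} (f : MvPolynomial (Fin n) ℂ) :
    f ∈ Submodule.span ℂ {g | ∃ (k a : ℕ), ∃ h ∈ Harm k n, g = h * sqNorm n ^ a} := by
  set S := Submodule.span ℂ {g | ∃ (k a : ℕ), ∃ h ∈ Harm k n, g = h * sqNorm n ^ a} with hS
  have harm : ∀ d, ∀ f ∈ Harm d n, f ∈ S := fun d f hf =>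
    Submodule.subset_span ⟨d, 0, f, hf, by simp⟩
  have step : ∀ f ∈ S, sqNorm n * f ∈ S := by
    intro f hf
    induction hf using Submodule.span_induction with
    | mem x hx =>
      obtain ⟨k, a, h, hh, rfl⟩ := hx
      exact Submodule.subset_span ⟨k, a + 1, h, hh, by ring⟩
    | zero => simp
    | add x y _ _ hx hy => rw [mul_add]; exact S.add_mem hx hy
    | smul c x _ hx => rw [mul_smul_comm]; exact S.smul_mem c hx
  have hom : ∀ d, ∀ f : MvPolynomial (Fin n) ℂ, f.IsHomogeneous d → f ∈ S := by
    intro d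
    induction d using Nat.strong_induction_on with
    | _ d ih =>
      intro f hf
      rcases lt_or_ge d 2 with hd | hd
      · refine harm d f (mem_Harm.2 ⟨hf, ?_⟩)
        rw [polyLaplacian_apply]
        refine Finset.sum_eq_zero fun i _ => ?_
        have h0 : (pderiv i f).IsHomogeneous 0 := by
          have := hf.pderiv (i := i)
          rwa [show d - 1 = 0 by omega] at this
        rw [isHomogeneous_zero_eq_C h0, pderiv_C]
      · let T : Submodule ℂ (MvPolynomial (Fin n) ℂ) :=
          (homogeneousSubmodule (Fin n) ℂ (d - 2)).map (LinearMap.mulLeft ℂ (sqNorm n))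
        have : FiniteDimensional ℂ (homogeneousSubmodule (Fin n) ℂ (d - 2)) :=
          Module.Finite.iff_fg.2 (homogeneousSubmodule_fg (Fin n) ℂ (d - 2))
        -- Subtracting the projection onto |x|² times the forms of degree d - 2 leaves r orthogonal
        -- to |x|² Δr, so ⟨Δr, Δr⟩ = 0 and r is harmonic.
        obtain ⟨u, hu, horth⟩ := exists_fischer_proj T f
        obtain ⟨u', hu', rfl⟩ := hu
        rw [LinearMap.mulLeft_apply] at horth
        have hsq : (sqNorm n).IsHomogeneous 2 :=
          IsHomogeneous.sum _ _ _ fun i _ => by simpa using (isHomogeneous_X ℂ i).pow 2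
        have hfu : (f - sqNorm n * u').IsHomogeneous d := by
          refine hf.sub ?_
          have := hsq.mul ((mem_homogeneousSubmodule _ _).1 hu')
          rwa [show 2 + (d - 2) = d by omega] at this
        have hl : polyLaplacian n (f - sqNorm n * u') = 0 := by
          apply fischer_self_eq_zero
          rw [← fischer_sqNorm_mul]
          exact horth _ ⟨_, (mem_homogeneousSubmodule _ _).2 (polyLaplacian_isHomogeneous hfu), rfl⟩
        have e : f = (f - sqNorm n * u') + sqNorm n * u' := by ring
        rw [e]
        exact S.add_mem (harm d _ (mem_Harm.2 ⟨hfu, hl⟩))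
          (step _ (ih _ (by omega) _ ((mem_homogeneousSubmodule _ _).1 hu')))
  rw [← sum_homogeneousComponent f]
  exact S.sum_mem fun d _ => hom d _ (homogeneousComponent_isHomogeneous d f)

theorem mem_span_HH_mul (P : Pol p q) :
    P ∈ Submodule.span ℂ {Q | ∃ (k l a b : ℕ), ∃ R ∈ HH p q k l,
      Q = R * (rX p q ^ a * rY p q ^ b)} := by
  set S := Submodule.span ℂ {Q | ∃ (k l a b : ℕ), ∃ R ∈ HH p q k l,
      Q = R * (rX p q ^ a * rY p q ^ b)} with hS
  have hmul : ∀ (f : MvPolynomial (Fin p) ℂ) (g : MvPolynomial (Fin q) ℂ),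
      rename Sum.inl f * rename Sum.inr g ∈ S := by
    intro f g
    induction mem_span_harm_mul_sqNorm_pow f using Submodule.span_induction with
    | zero => simp
    | add x y _ _ hx hy => rw [map_add, add_mul]; exact S.add_mem hx hy
    | smul c x _ hx => rw [map_smul, smul_mul_assoc]; exact S.smul_mem c hx
    | mem x hx =>
      obtain ⟨k, a, h₁, H₁, rfl⟩ := hx
      induction mem_span_harm_mul_sqNorm_pow g using Submodule.span_induction with
      | zero => simp
      | add x y _ _ hx hy => rw [map_add, mul_add]; exact S.add_mem hx hy
      | smul c x _ hx => rw [map_smul, mul_smul_comm]; exact S.smul_mem c hx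
      | mem x hx =>
        obtain ⟨l, b, h₂, H₂, rfl⟩ := hx
        have e : (rename Sum.inl (h₁ * sqNorm p ^ a) * rename Sum.inr (h₂ * sqNorm q ^ b) :
            Pol p q) = ((2 : ℂ) ^ a * 2 ^ b) • ((rename Sum.inl h₁ * rename Sum.inr h₂) *
              (rX p q ^ a * rY p q ^ b)) := by
          rw [map_mul, map_mul, map_pow, map_pow, rename_sqNorm_inl, rename_sqNorm_inr,
            smul_pow, smul_pow, mul_smul_comm, mul_smul_comm, smul_mul_assoc, mul_smul_comm,
            smul_smul, mul_mul_mul_comm]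
        rw [e]
        exact S.smul_mem _ (Submodule.subset_span ⟨k, l, a, b, _, mul_mem_HH H₁ H₂, rfl⟩)
  have hall : P ∈ Submodule.span ℂ {Q : Pol p q | ∃ f g, Q = rename Sum.inl f * rename Sum.inr g} := by
    induction P using MvPolynomial.induction_on with
    | C c => exact Submodule.subset_span ⟨C c, 1, by simp⟩
    | add f g hf hg => exact Submodule.add_mem _ hf hg
    | mul_X f i hf =>
      induction hf using Submodule.span_induction with
      | zero => simp
      | add x y _ _ hx hy => rw [add_mul]; exact Submodule.add_mem _ hx hy
      | smul c x _ hx => rw [smul_mul_assoc]; exact Submodule.smul_mem _ c hx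
      | mem x hx =>
        obtain ⟨f, g, rfl⟩ := hx
        rcases i with i | j
        · exact Submodule.subset_span ⟨f * X i, g, by simp; ring⟩
        · exact Submodule.subset_span ⟨f, g * X j, by simp; ring⟩
  refine Submodule.span_le.2 ?_ hall
  rintro _ ⟨f, g, rfl⟩
  exact hmul f g

end Types

/-! ### `(𝔤, K)`-modules of functions `∑ P(x, y) χ(ρ_x ρ_y)` -/

section GKModules

open MvPolynomial

variable {p q : ℕ}

/-- The span of all functions `P(x, y) χ(ρ_x ρ_y)`. -/
def bigE (p q : ℕ) : Submodule ℂ (Smooth p q) := Submodule.span ℂ {F | ∃ P χ, F = G P χ}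

theorem G_mem_bigE (P : Pol p q) (χ : Ent) : G P χ ∈ bigE p q := Submodule.subset_span ⟨P, χ, rfl⟩

theorem bigE_induction {motive : Smooth p q → Prop} (h0 : motive 0)
    (hadd : ∀ f g, motive f → motive g → motive (f + g)) (hG : ∀ P χ, motive (G P χ))
    {f : Smooth p q} (hf : f ∈ bigE p q) : motive f := by
  induction hf using Submodule.span_induction with
  | zero => exact h0
  | add x y _ _ hx hy => exact hadd x y hx hy
  | mem x hx =>
    obtain ⟨P, χ, rfl⟩ := hx
    exact hG P χ
  | smul c x hx' hx =>
    clear hx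
    induction hx' using Submodule.span_induction generalizing c with
    | zero => simpa using h0
    | add x y _ _ hx hy => rw [smul_add]; exact hadd _ _ (hx c) (hy c)
    | smul d x _ hx => rw [smul_smul]; exact hx _
    | mem x hx =>
      obtain ⟨P, χ, rfl⟩ := hx
      rw [← map_smul]
      exact hG P _

theorem polyMul_mem_bigE (Q : Pol p q) {f : Smooth p q} (hf : f ∈ bigE p q) :
    polyMul Q f ∈ bigE p q :=
  bigE_induction (motive := fun f => polyMul Q f ∈ bigE p q) (by simp)
    (fun f g hf hg => by rw [map_add]; exact add_mem hf hg)
    (fun P χ => by rw [polyMul_G]; exact G_mem_bigE _ _) hf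

theorem dd_mem_bigE (a : Fin p ⊕ Fin q) {f : Smooth p q} (hf : f ∈ bigE p q) :
    dd a f ∈ bigE p q :=
  bigE_induction (motive := fun f => dd a f ∈ bigE p q) (by simp)
    (fun f g hf hg => by rw [map_add]; exact add_mem hf hg)
    (fun P χ => by rw [dd_G]; exact add_mem (G_mem_bigE _ _) (G_mem_bigE _ _)) hf

theorem piK_mem_bigE (k : K p q) {f : Smooth p q} (hf : f ∈ bigE p q) :
    piK p q k f ∈ bigE p q :=
  bigE_induction (motive := fun f => piK p q k f ∈ bigE p q) (by simp)
    (fun f g hf hg => by rw [map_add]; exact add_mem hf hg)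
    (fun P χ => by rw [piK_G]; exact G_mem_bigE _ _) hf

theorem piG_apply (Y : 𝔤 p q) (f : Smooth p q) : piG p q Y f =
    ∑ i, ∑ j, Y.1 (Sum.inl i) (Sum.inl j) • polyMul (X (Sum.inl i)) (dd (Sum.inl j) f) +
    ∑ i, ∑ j, Y.1 (Sum.inr i) (Sum.inr j) • polyMul (X (Sum.inr i)) (dd (Sum.inr j) f) +
    ∑ i, ∑ j, (Y.1 (Sum.inl i) (Sum.inr j) * Complex.I) •
      (polyMul (X (Sum.inl i)) (polyMul (X (Sum.inr j)) f) + dd (Sum.inl i) (dd (Sum.inr j) f)) := by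
  have hE : piG p q Y = ∑ i, ∑ j, Y.1 (Sum.inl i) (Sum.inl j) • (mx i * dx j) +
    ∑ i, ∑ j, Y.1 (Sum.inr i) (Sum.inr j) • (my i * dy j) +
    ∑ i, ∑ j, (Y.1 (Sum.inl i) (Sum.inr j) * Complex.I) • (mx i * my j + dx i * dy j) := rfl
  rw [hE]
  simp only [LinearMap.add_apply, LinearMap.sum_apply, LinearMap.smul_apply, Module.End.mul_apply,
    mx_eq, my_eq, dx_eq, dy_eq]

/-- The reason for enlarging ℰ: with arbitrary entire χ, stability under multiplication by
coordinates and under derivatives is immediate. -/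
theorem piG_mem_bigE (Y : 𝔤 p q) {f : Smooth p q} (hf : f ∈ bigE p q) :
    piG p q Y f ∈ bigE p q := by
  rw [piG_apply]
  refine add_mem (add_mem ?_ ?_) ?_
  · exact sum_mem fun i _ => sum_mem fun j _ => Submodule.smul_mem _ _
      (polyMul_mem_bigE _ (dd_mem_bigE _ hf))
  · exact sum_mem fun i _ => sum_mem fun j _ => Submodule.smul_mem _ _
      (polyMul_mem_bigE _ (dd_mem_bigE _ hf))
  · exact sum_mem fun i _ => sum_mem fun j _ => Submodule.smul_mem _ _
      (add_mem (polyMul_mem_bigE _ (polyMul_mem_bigE _ hf)) (dd_mem_bigE _ (dd_mem_bigE _ hf)))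

/-- The vector field on polynomials defined by a matrix. -/
def matD (Y : Matrix (Fin p ⊕ Fin q) (Fin p ⊕ Fin q) ℂ) (P : Pol p q) : Pol p q :=
  ∑ a, ∑ b, Y b a • (X b * pderiv a P)

/-- The vector field of a block diagonal skew matrix is tangent to the spheres in both blocks:
swapping indices turns each sum into its negative. -/
theorem matD_rho {Y : 𝔤 p q} (hY : ∀ i j, Y.1 (Sum.inl i) (Sum.inr j) = 0)
    (hY' : ∀ i j, Y.1 (Sum.inr j) (Sum.inl i) = 0) : matD Y.1 (rX p q * rY p q) = 0 := by
  have key : ∀ {n : ℕ} (f : Fin n → Pol p q) (c : Fin n → Fin n → ℂ) (R : Pol p q),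
      (∀ i j, c i j = -c j i) → ∑ i, ∑ j, c j i • (f j * (f i * R)) = 0 := by
    intro n f c R hc
    have h1 : ∑ i, ∑ j, c j i • (f j * (f i * R)) = -∑ i, ∑ j, c j i • (f j * (f i * R)) := by
      conv_lhs => rw [Finset.sum_comm]
      rw [← Finset.sum_neg_distrib]
      refine Finset.sum_congr rfl fun i _ => ?_
      rw [← Finset.sum_neg_distrib]
      refine Finset.sum_congr rfl fun j _ => ?_
      rw [hc i j, neg_smul, mul_left_comm]
    exact self_eq_neg.1 h1
  have ha : ∀ i j, Y.1 (Sum.inl i) (Sum.inl j) = -Y.1 (Sum.inl j) (Sum.inl i) := fun i j => by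
    have := so_skew Y.2 (Sum.inl i) (Sum.inl j)
    simpa [sgn] using this
  have hb : ∀ i j, Y.1 (Sum.inr i) (Sum.inr j) = -Y.1 (Sum.inr j) (Sum.inr i) := fun i j => by
    have := so_skew Y.2 (Sum.inr i) (Sum.inr j)
    simp only [sgn, Sum.elim_inr, mul_neg, mul_one, neg_neg] at this
    linear_combination -this
  have h1 : ∀ i : Fin p, pderiv (Sum.inl i) (rX p q * rY p q) = X (Sum.inl i) * rY p q :=
    fun i => pderiv_rho_of_mem_bX (by simp [bX])
  have h2 : ∀ i : Fin q, pderiv (Sum.inr i) (rX p q * rY p q) = X (Sum.inr i) * rX p q :=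
    fun i => pderiv_rho_of_mem_bY (by simp [bY])
  rw [matD]
  simp only [Fintype.sum_sum_type, hY, hY', zero_smul, Finset.sum_const_zero, add_zero, zero_add,
    h1, h2]
  rw [key (fun i => X (Sum.inl i)) (fun i j => Y.1 (Sum.inl i) (Sum.inl j)) _ ha,
    key (fun i => X (Sum.inr i)) (fun i j => Y.1 (Sum.inr i) (Sum.inr j)) _ hb, add_zero]

theorem piG_G {Y : 𝔤 p q} (hY : ∀ i j, Y.1 (Sum.inl i) (Sum.inr j) = 0)
    (hY' : ∀ i j, Y.1 (Sum.inr j) (Sum.inl i) = 0) (P : Pol p q) (χ : Ent) :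
    piG p q Y (G P χ) = G (matD Y.1 P) χ := by
  have h : piG p q Y (G P χ) = ∑ a, ∑ b, Y.1 b a • polyMul (X b) (dd a (G P χ)) := by
    rw [piG_apply]
    simp only [Fintype.sum_sum_type, hY, hY', zero_mul, zero_smul, Finset.sum_const_zero, add_zero,
      zero_add]
    rw [Finset.sum_comm]
    congr 1
    rw [Finset.sum_comm]
  have h2 : G (P * matD Y.1 (rX p q * rY p q)) (entD χ) = 0 := by
    rw [matD_rho hY hY', mul_zero, map_zero, LinearMap.zero_apply]
  rw [← add_zero (G (matD Y.1 P) χ), ← h2, h, matD, matD, Finset.mul_sum, map_sum, map_sum,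
    LinearMap.sum_apply, LinearMap.sum_apply, ← Finset.sum_add_distrib]
  refine Finset.sum_congr rfl fun a _ => ?_
  rw [Finset.mul_sum, map_sum, map_sum, LinearMap.sum_apply, LinearMap.sum_apply,
    ← Finset.sum_add_distrib]
  refine Finset.sum_congr rfl fun b _ => ?_
  rw [dd_G, map_add, polyMul_G, polyMul_G, mul_smul_comm, map_smul, map_smul,
    LinearMap.smul_apply, LinearMap.smul_apply, smul_add, mul_left_comm P]

theorem polyK_finite (P : Pol p q) : ∃ S : Submodule ℂ (Pol p q), S.FG ∧ ∀ k, polyK k P ∈ S := by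
  induction P using MvPolynomial.induction_on with
  | C c =>
    refine ⟨Submodule.span ℂ {C c}, Submodule.fg_span (Set.finite_singleton _), fun k => ?_⟩
    rw [polyK, aeval_C]
    exact Submodule.subset_span rfl
  | add f g hf hg =>
    obtain ⟨S, hS, h⟩ := hf
    obtain ⟨T, hT, h'⟩ := hg
    refine ⟨S ⊔ T, hS.sup hT, fun k => ?_⟩
    rw [map_add]
    exact Submodule.add_mem_sup (h k) (h' k)
  | mul_X f a hf =>
    obtain ⟨S, hS, h⟩ := hf
    refine ⟨S * Submodule.span ℂ (Set.range X), hS.mul (Submodule.fg_span (Set.finite_range _)),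
      fun k => ?_⟩
    rw [map_mul, polyK_X]
    exact Submodule.mul_mem_mul (h k) (sum_mem fun b _ => Submodule.smul_mem _ _
      (Submodule.subset_span ⟨b, rfl⟩))

theorem piK_finite {f : Smooth p q} (hf : f ∈ bigE p q) :
    ∃ S : Submodule ℂ (Smooth p q), S.FG ∧ ∀ k, piK p q k f ∈ S := by
  refine bigE_induction (motive := fun f => ∃ S : Submodule ℂ (Smooth p q), S.FG ∧
    ∀ k, piK p q k f ∈ S) ⟨⊥, Submodule.fg_bot, by simp⟩ ?_ ?_ hf
  · rintro f g ⟨S, hS, h⟩ ⟨T, hT, h'⟩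
    refine ⟨S ⊔ T, hS.sup hT, fun k => ?_⟩
    rw [map_add]
    exact Submodule.add_mem_sup (h k) (h' k)
  · intro P χ
    obtain ⟨S, hS, h⟩ := polyK_finite P
    refine ⟨S.map (G.flip χ), hS.map _, fun k => ?_⟩
    rw [piK_G]
    exact ⟨_, h k, rfl⟩

theorem continuous_kMat (a b : Fin p ⊕ Fin q) : Continuous fun k : K p q => kMat k a b := by
  have h1 : ∀ i j, Continuous fun k : K p q => k.1.1 i j := fun i j =>
    (continuous_subtype_val.comp continuous_fst).matrix_elem i j
  have h2 : ∀ i j, Continuous fun k : K p q => k.2.1 i j := fun i j =>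
    (continuous_subtype_val.comp continuous_snd).matrix_elem i j
  rcases a with i | i <;> rcases b with j | j <;> simp only [kMat, blockDiag,
    Matrix.fromBlocks_apply₁₁, Matrix.fromBlocks_apply₁₂, Matrix.fromBlocks_apply₂₁,
    Matrix.fromBlocks_apply₂₂, Matrix.map_apply, Matrix.zero_apply]
  · exact Complex.continuous_ofReal.comp (h1 i j)
  · exact continuous_const
  · exact continuous_const
  · exact Complex.continuous_ofReal.comp (h2 i j)

theorem continuous_polyK (P : Pol p q) (φ : Pol p q →ₗ[ℂ] ℂ) :
    Continuous fun k => φ (polyK k P) := by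
  induction P using MvPolynomial.induction_on generalizing φ with
  | C c =>
    simp only [polyK, aeval_C]
    exact continuous_const
  | add f g hf hg =>
    simp only [map_add]
    exact (hf φ).add (hg φ)
  | mul_X f a hf =>
    simp only [map_mul, polyK_X, Finset.mul_sum, mul_smul_comm, map_sum, map_smul, smul_eq_mul]
    exact continuous_finsetSum _ fun b _ => (continuous_kMat b a).mul
      (hf (φ ∘ₗ LinearMap.mulRight ℂ (X b)))

theorem hasDerivAt_exp_entry {n : ℕ} (A : Matrix (Fin n) (Fin n) ℝ) (i j : Fin n) :
    HasDerivAt (fun t : ℝ => NormedSpace.exp (t • A) i j) (A i j) 0 := by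
  let _ : NormedRing (Matrix (Fin n) (Fin n) ℝ) := Matrix.linftyOpNormedRing
  let _ : NormedAlgebra ℝ (Matrix (Fin n) (Fin n) ℝ) := Matrix.linftyOpNormedAlgebra
  have h := hasDerivAt_exp_smul_const A (0 : ℝ)
  rw [zero_smul, NormedSpace.exp_zero, one_mul] at h
  exact (LinearMap.toContinuousLinearMap
    (Matrix.entryLinearMap ℝ ℝ i j)).hasFDerivAt.comp_hasDerivAt 0 h

theorem hasDerivAt_kMat (Z : 𝔨₀ p q) (a b : Fin p ⊕ Fin q) :
    HasDerivAt (fun t : ℝ => kMat (expK (t • Z)) a b) ((kToG Z).1 a b) 0 := by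
  have h1 : ∀ i j, HasDerivAt (fun t : ℝ => ((NormedSpace.exp (t • Z.1.1) i j : ℝ) : ℂ))
      ((Z.1.1 i j : ℝ) : ℂ) 0 := fun i j => (hasDerivAt_exp_entry Z.1.1 i j).ofReal_comp
  have h2 : ∀ i j, HasDerivAt (fun t : ℝ => ((NormedSpace.exp (t • Z.2.1) i j : ℝ) : ℂ))
      ((Z.2.1 i j : ℝ) : ℂ) 0 := fun i j => (hasDerivAt_exp_entry Z.2.1 i j).ofReal_comp
  rcases a with i | i <;> rcases b with j | j
  · exact h1 i j
  · exact hasDerivAt_const _ _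
  · exact hasDerivAt_const _ _
  · exact h2 i j

theorem expK_zero (Z : 𝔨₀ p q) : expK ((0 : ℝ) • Z) = 1 := by
  have h : ∀ {n : ℕ} (A : Matrix (Fin n) (Fin n) ℝ), NormedSpace.exp ((0 : ℝ) • A) = 1 := by
    intro n A
    rw [zero_smul, NormedSpace.exp_zero]
  exact Prod.ext (Subtype.ext (h Z.1.1)) (Subtype.ext (h Z.2.1))

theorem kMat_one : kMat (1 : K p q) = 1 := by
  rw [kMat, blockDiag, ← Matrix.fromBlocks_one]
  congr 1 <;> exact Matrix.map_one _ Complex.ofReal_zero Complex.ofReal_one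

theorem polyK_one (P : Pol p q) : polyK 1 P = P := by
  have : polyK (1 : K p q) = AlgHom.id ℂ _ := by
    apply MvPolynomial.algHom_ext
    intro a
    rw [polyK_X, kMat_one, Finset.sum_eq_single a]
    · simp
    · intro b _ hb
      rw [Matrix.one_apply_ne hb, zero_smul]
    · simp
  rw [this]
  rfl

/-- The functional is arbitrary in the induction because multiplication by a variable is absorbed
into it; the product rule then applies. -/
theorem hasDerivAt_polyK (Z : 𝔨₀ p q) (P : Pol p q) (φ : Pol p q →ₗ[ℂ] ℂ) :
    HasDerivAt (fun t : ℝ => φ (polyK (expK (t • Z)) P)) (φ (matD (kToG Z).1 P)) 0 := by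
  induction P using MvPolynomial.induction_on generalizing φ with
  | C c =>
    simp only [polyK, aeval_C, matD, pderiv_C, mul_zero, smul_zero, Finset.sum_const_zero, map_zero]
    exact hasDerivAt_const _ _
  | add f g hf hg =>
    have : matD (kToG Z).1 (f + g) = matD (kToG Z).1 f + matD (kToG Z).1 g := by
      simp only [matD, map_add, mul_add, smul_add, Finset.sum_add_distrib]
    simp only [this, map_add]
    exact (hf φ).add (hg φ)
  | mul_X f a hf =>
    simp only [map_mul, polyK_X, Finset.mul_sum, mul_smul_comm, map_sum, map_smul, smul_eq_mul]
    have h := HasDerivAt.fun_sum (u := Finset.univ) (fun b _ => (hasDerivAt_kMat Z b a).mul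
      (hf (φ ∘ₗ LinearMap.mulRight ℂ (X b))))
    refine h.congr_deriv ?_
    rw [expK_zero, kMat_one]
    simp only [LinearMap.comp_apply, LinearMap.mulRight_apply, polyK_one]
    have e : matD (kToG Z).1 (f * X a) =
        ∑ b, (kToG Z).1 b a • (f * X b) + matD (kToG Z).1 f * X a := by
      have h1 : ∀ c b, (kToG Z).1 b c • (X b * pderiv c (f * X a)) =
          (if c = a then (kToG Z).1 b a • (f * X b) else 0) +
            ((kToG Z).1 b c • (X b * pderiv c f)) * X a := by
        intro c b
        rw [Derivation.leibniz, pderiv_X, Pi.single_apply, smul_eq_mul, smul_eq_mul]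
        by_cases hc : c = a
        · subst hc
          rw [if_pos rfl, if_pos rfl, smul_mul_assoc, ← smul_add]
          congr 1
          ring
        · rw [if_neg hc, if_neg (Ne.symm hc), zero_add, smul_mul_assoc]
          congr 1
          ring
      simp only [matD, h1, Finset.sum_add_distrib, Finset.sum_mul]
      congr 1
      rw [Finset.sum_comm]
      simp
    rw [e, map_add, map_sum, Finset.sum_add_distrib]
    congr 1
    · simp only [map_smul, smul_eq_mul]
    · rw [Finset.sum_eq_single a]
      · simp
      · intro b _ hb
        rw [Matrix.one_apply_ne hb, zero_mul]
      · simp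

/-- K leaves χ(ρ_x ρ_y) fixed, so finiteness, continuity and differentiability reduce to
polynomials, where K acts polynomially in the matrix entries. The algebraic axioms hold on all of
C^∞(V). -/
theorem isGKModule_of_le_bigE {M : Submodule ℂ (Smooth p q)} (hM : M ≤ bigE p q)
    (hs : IsGKStable (piG p q) (piK p q) M) : IsGKModule (piG p q) (piK p q) M where
  stable := hs
  lie X Y f _ := piG_lie X Y f
  finite f hf := by
    obtain ⟨S, hS, h⟩ := piK_finite (hM hf)
    have : FiniteDimensional ℂ S := Module.Finite.iff_fg.2 hS
    refine Submodule.finiteDimensional_of_le (S₂ := S) (Submodule.span_le.2 ?_)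
    rintro _ ⟨k, rfl⟩
    exact h k
  cont f hf φ := by
    refine bigE_induction (motive := fun f => Continuous fun k => φ (piK p q k f))
      (by simpa using continuous_const) (fun f g hf hg => ?_) (fun P χ => ?_) (hM hf)
    · simp only [map_add]
      exact hf.add hg
    · simp only [piK_G]
      exact continuous_polyK P (φ ∘ₗ G.flip χ)
  deriv f hf φ Z := by
    refine bigE_induction (motive := fun f => HasDerivAt
      (fun t : ℝ => φ (piK p q (expK (t • Z)) f)) (φ (piG p q (kToG Z) f)) 0)
      (by simpa using hasDerivAt_const _ _) (fun f g hf hg => ?_) (fun P χ => ?_) (hM hf)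
    · simp only [map_add]
      exact hf.add hg
    · simp only [piK_G]
      rw [piG_G (fun _ _ => rfl) (fun _ _ => rfl)]
      exact hasDerivAt_polyK Z P (φ ∘ₗ G.flip χ)
  compat k X f _ := piK_piG k X f

end GKModules

/-! ### The space `ℰ` -/

section SpaceE

open MvPolynomial

variable {p q : ℕ}

theorem genFun_eq {h₁ : MvPolynomial (Fin p) ℂ} {h₂ : MvPolynomial (Fin q) ℂ} {a b : ℕ} {α : ℂ}
    (hα : GoodParam α) : genFun p q h₁ h₂ a b α =
      (G ((rename Sum.inl h₁ * rename Sum.inr h₂) * (rX p q ^ a * rY p q ^ b)) (psiE α)).1 := by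
  funext v
  have e1 : evalV v (rename Sum.inl h₁) = eval (fun i => (v.1 i : ℂ)) h₁ := by
    rw [evalV, aeval_rename, aeval_eq_eval]
    rfl
  have e2 : evalV v (rename Sum.inr h₂) = eval (fun j => (v.2 j : ℂ)) h₂ := by
    rw [evalV, aeval_rename, aeval_eq_eval]
    rfl
  rw [G_apply, psiE_apply hα, genFun]
  simp only [map_mul, map_pow, evalV_rX, evalV_rY, e1, e2]
  ring

theorem spaceE_eq : spaceE p q = Submodule.span ℂ {F | ∃ (k l : ℕ) (P : Pol p q) (a b : ℕ) (α : ℂ),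
    P ∈ HH p q k l ∧ GoodParam α ∧ F = G (P * (rX p q ^ a * rY p q ^ b)) (psiE α)} := by
  have h1 : spaceE p q = Submodule.span ℂ {F | ∃ (k l : ℕ) (h₁ : MvPolynomial (Fin p) ℂ)
      (h₂ : MvPolynomial (Fin q) ℂ) (a b : ℕ) (α : ℂ), h₁ ∈ Harm k p ∧ h₂ ∈ Harm l q ∧
      GoodParam α ∧ F = G ((rename Sum.inl h₁ * rename Sum.inr h₂) *
        (rX p q ^ a * rY p q ^ b)) (psiE α)} := by
    rw [spaceE]
    conv_rhs => rw [← Submodule.comap_map_eq_of_injective (Smooth p q).injective_subtype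
      (Submodule.span ℂ _), Submodule.map_span]
    congr 2
    ext F
    constructor
    · rintro ⟨k, l, h₁, h₂, a, b, α, H₁, H₂, hα, rfl⟩
      exact ⟨_, ⟨k, l, h₁, h₂, a, b, α, H₁, H₂, hα, rfl⟩, (genFun_eq hα).symm⟩
    · rintro ⟨_, ⟨k, l, h₁, h₂, a, b, α, H₁, H₂, hα, rfl⟩, rfl⟩
      exact ⟨k, l, h₁, h₂, a, b, α, H₁, H₂, hα, (genFun_eq hα).symm⟩
  rw [h1]
  apply le_antisymm
  · refine Submodule.span_mono ?_
    rintro _ ⟨k, l, h₁, h₂, a, b, α, H₁, H₂, hα, rfl⟩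
    exact ⟨k, l, _, a, b, α, mul_mem_HH H₁ H₂, hα, rfl⟩
  · rw [Submodule.span_le]
    rintro _ ⟨k, l, P, a, b, α, hP, hα, rfl⟩
    refine HH_induction (motive := fun P => G (P * (rX p q ^ a * rY p q ^ b)) (psiE α) ∈
      Submodule.span ℂ _) ?_ ?_ ?_ hP
    · simp
    · intro P Q hP hQ
      rw [add_mul, map_add, LinearMap.add_apply]
      exact add_mem hP hQ
    · intro h₁ H₁ h₂ H₂
      exact Submodule.subset_span ⟨k, l, h₁, h₂, a, b, α, H₁, H₂, hα, rfl⟩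

theorem G_mem_spaceE {k l : ℕ} {P : Pol p q} (hP : P ∈ HH p q k l) (a b : ℕ) {α : ℂ}
    (hα : GoodParam α) : G (P * (rX p q ^ a * rY p q ^ b)) (psiE α) ∈ spaceE p q := by
  rw [spaceE_eq]
  exact Submodule.subset_span ⟨k, l, P, a, b, α, hP, hα, rfl⟩

theorem spaceE_le_bigE : spaceE p q ≤ bigE p q := by
  rw [spaceE_eq, Submodule.span_le]
  rintro _ ⟨k, l, P, a, b, α, -, -, rfl⟩
  exact G_mem_bigE _ _

/-- Changing the parameter of the Bessel operator adds a multiple of the derivative, which takes Ψ_α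
to a multiple of Ψ_{α+1}. This keeps X⁺ and X⁻ inside ℰ. -/
theorem besselOp_psiE_of_ne {α : ℂ} (hα : GoodParam α) (β : ℂ) :
    besselOp β (psiE α) = (-((β - α) / α)) • psiE (α + 1) := by
  have h : besselOp β (psiE α) = besselOp α (psiE α) + (β - α) • entD (psiE α) := by
    simp only [besselOp]
    module
  rw [h, besselOp_psiE hα, zero_add, entD_psiE hα, smul_smul]
  congr 1
  ring

theorem opXm_mem_spaceE {f : Smooth p q} (hf : f ∈ spaceE p q) : opXm p q f ∈ spaceE p q := by
  rw [spaceE_eq] at hf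
  induction hf using Submodule.span_induction with
  | zero => simp
  | add x y _ _ hx hy => rw [map_add]; exact add_mem hx hy
  | smul c x _ hx => rw [map_smul]; exact Submodule.smul_mem _ c hx
  | mem x hx =>
    obtain ⟨k, l, P, a, b, α, hP, hα, rfl⟩ := hx
    rw [opXm_G (HH_eulY_mul hP a b), besselOp_psiE_of_ne hα, map_smul]
    refine add_mem (Submodule.smul_mem _ _ ?_) (Submodule.smul_mem _ _ ?_)
    · rcases b with _ | b
      · rw [HH_lapY_mul_zero hP, map_zero]
        exact zero_mem _
      · rw [HH_lapY_mul_succ hP, map_smul]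
        exact Submodule.smul_mem _ _ (G_mem_spaceE hP a b hα)
    · have e : P * (rX p q ^ a * rY p q ^ b) * rX p q = P * (rX p q ^ (a + 1) * rY p q ^ b) := by
        ring
      rw [e]
      exact G_mem_spaceE hP _ _ hα.add_one

theorem opXp_mem_spaceE {f : Smooth p q} (hf : f ∈ spaceE p q) : opXp p q f ∈ spaceE p q := by
  rw [spaceE_eq] at hf
  induction hf using Submodule.span_induction with
  | zero => simp
  | add x y _ _ hx hy => rw [map_add]; exact add_mem hx hy
  | smul c x _ hx => rw [map_smul]; exact Submodule.smul_mem _ c hx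
  | mem x hx =>
    obtain ⟨k, l, P, a, b, α, hP, hα, rfl⟩ := hx
    rw [opXp_G (HH_eulX_mul hP a b), besselOp_psiE_of_ne hα, map_smul]
    refine sub_mem (Submodule.smul_mem _ _ ?_) (Submodule.smul_mem _ _ ?_)
    · rcases a with _ | a
      · rw [HH_lapX_mul_zero hP, map_zero]
        exact zero_mem _
      · rw [HH_lapX_mul_succ hP, map_smul]
        exact Submodule.smul_mem _ _ (G_mem_spaceE hP a b hα)
    · have e : P * (rX p q ^ a * rY p q ^ b) * rY p q = P * (rX p q ^ a * rY p q ^ (b + 1)) := by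
        ring
      rw [e]
      exact G_mem_spaceE hP _ _ hα.add_one

end SpaceE

/-! ### Separation of the `K`-types -/

section Separation

open MvPolynomial

/-- If a sum of joint eigenvectors lies in a subspace stable under operators that separate them,
then so does each of them. -/
theorem mem_of_add_sum_mem {W ι : Type*} [AddCommGroup W] [Module ℂ W] (N : Submodule ℂ W)
    (i : ι) (s : Finset ι) (g : ι → W)
    (hs : ∀ j ∈ s, ∃ (A : Module.End ℂ W) (μ : ι → ℂ), (∀ f ∈ N, A f ∈ N) ∧ A (g i) = μ i • g i ∧
      (∀ k ∈ s, A (g k) = μ k • g k) ∧ μ i ≠ μ j) (h : g i + ∑ j ∈ s, g j ∈ N) : g i ∈ N := by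
  classical
  induction s using Finset.induction_on generalizing g with
  | empty => simpa using h
  | insert j s hj ih =>
    obtain ⟨A, μ, hA, hi, hk, hne⟩ := hs j (Finset.mem_insert_self _ _)
    -- A - μ_j annihilates g_j and multiplies g_i by a nonzero scalar, which shortens the sum.
    have h1 : A (g i + ∑ k ∈ insert j s, g k) - μ j • (g i + ∑ k ∈ insert j s, g k) ∈ N :=
      N.sub_mem (hA _ h) (N.smul_mem _ h)
    have h2 : A (g i + ∑ k ∈ insert j s, g k) - μ j • (g i + ∑ k ∈ insert j s, g k) =
        (μ i - μ j) • g i + ∑ k ∈ s, (μ k - μ j) • g k := by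
      rw [Finset.sum_insert hj, map_add, map_add, map_sum, hi, hk j (Finset.mem_insert_self _ _),
        Finset.sum_congr rfl fun k hk' => hk k (Finset.mem_insert_of_mem hk')]
      simp only [sub_smul, Finset.sum_sub_distrib, smul_add, Finset.smul_sum]
      abel
    rw [h2] at h1
    have h3 := ih (fun k => (μ k - μ j) • g k) (fun k hk' => by
      obtain ⟨B, ν, hB, hBi, hBk, hne'⟩ := hs k (Finset.mem_insert_of_mem hk')
      refine ⟨B, ν, hB, ?_, fun k' hk'' => ?_, hne'⟩
      · rw [map_smul, hBi, smul_comm]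
      · rw [map_smul, hBk k' (Finset.mem_insert_of_mem hk''), smul_comm]) h1
    exact (N.smul_mem_iff (sub_ne_zero.2 hne)).1 h3

variable {p q : ℕ}

theorem rot_mem {a b : Fin p ⊕ Fin q} (h : (sgn a : ℂ) = sgn b) :
    Matrix.single a b (1 : ℂ) - Matrix.single b a 1 ∈
      LieAlgebra.Orthogonal.so' (Fin p) (Fin q) ℂ := by
  have e : (Matrix.fromBlocks 1 0 0 (-1) : Matrix (Fin p ⊕ Fin q) (Fin p ⊕ Fin q) ℂ) =
      Matrix.diagonal sgn := by
    rw [← Matrix.diagonal_one, ← Matrix.diagonal_one, Matrix.diagonal_neg,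
      Matrix.fromBlocks_diagonal]
    rfl
  rw [mem_𝔤_iff, e]
  ext c d
  rw [Matrix.mul_diagonal, Matrix.diagonal_mul]
  simp only [Matrix.transpose_apply, Matrix.neg_apply, Matrix.sub_apply, Matrix.single_apply]
  by_cases h1 : a = d ∧ b = c
  · obtain ⟨rfl, rfl⟩ := h1
    by_cases hab : a = b
    · subst hab
      simp
    · simp [hab, h]
  · by_cases h2 : a = c ∧ b = d
    · obtain ⟨rfl, rfl⟩ := h2
      have h1' : ¬(b = a ∧ a = b) := fun h' => h1 ⟨h'.2, h'.1⟩
      simp [h, h1, h1']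
    · have h1' : ¬(b = c ∧ a = d) := fun h' => h1 ⟨h'.2, h'.1⟩
      have h2' : ¬(b = d ∧ a = c) := fun h' => h2 ⟨h'.2, h'.1⟩
      simp [h1', h2', h1, h2]

/-- The element `E_{a,b} - E_{b,a}` of `𝔤`. -/
def rot (a b : Fin p ⊕ Fin q) (h : (sgn a : ℂ) = sgn b) : 𝔤 p q := ⟨_, rot_mem h⟩

theorem matD_rot {a b : Fin p ⊕ Fin q} (h : (sgn a : ℂ) = sgn b) (P : Pol p q) :
    matD (rot a b h).1 P = angS a b P := by
  have e : ∀ c d, (rot a b h).1 d c • (X d * pderiv c P) =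
      (if c = b then (if d = a then X a * pderiv b P else 0) else 0) -
      (if c = a then (if d = b then X b * pderiv a P else 0) else 0) := by
    intro c d
    have : (rot a b h).1 d c = (if a = d ∧ b = c then 1 else 0) -
      (if b = d ∧ a = c then 1 else 0) := by
      simp [rot, Matrix.single_apply]
    rw [this, sub_smul, ite_smul, ite_smul, one_smul, zero_smul]
    congr 1
    · by_cases h1 : a = d <;> by_cases h2 : b = c <;> grind
    · by_cases h1 : b = d <;> by_cases h2 : a = c <;> grind
  rw [matD, angS]
  simp only [e, Finset.sum_sub_distrib]
  simp

theorem sgn_inl (i j : Fin p) : (sgn (Sum.inl i : Fin p ⊕ Fin q) : ℂ) = sgn (Sum.inl j : Fin p ⊕ Fin q) := rfl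

theorem sgn_inr (i j : Fin q) : (sgn (Sum.inr i : Fin p ⊕ Fin q) : ℂ) = sgn (Sum.inr j : Fin p ⊕ Fin q) := rfl

theorem piG_rot_inl (i j : Fin p) (P : Pol p q) (χ : Ent) :
    piG p q (rot (Sum.inl i) (Sum.inl j) (sgn_inl i j)) (G P χ) =
      G (angS (Sum.inl i) (Sum.inl j) P) χ := by
  rw [piG_G, matD_rot] <;> intro a b <;> simp [rot]

theorem piG_rot_inr (i j : Fin q) (P : Pol p q) (χ : Ent) :
    piG p q (rot (Sum.inr i) (Sum.inr j) (sgn_inr i j)) (G P χ) =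
      G (angS (Sum.inr i) (Sum.inr j) P) χ := by
  rw [piG_G, matD_rot] <;> intro a b <;> simp [rot]

/-- The Casimir operator of `𝔬(p)`. -/
def casX (p q : ℕ) : Module.End ℂ (Smooth p q) :=
  ∑ i, ∑ j, piG p q (rot (Sum.inl i) (Sum.inl j) (sgn_inl i j)) *
    piG p q (rot (Sum.inl i) (Sum.inl j) (sgn_inl i j))

/-- The Casimir operator of `𝔬(q)`. -/
def casY (p q : ℕ) : Module.End ℂ (Smooth p q) :=
  ∑ i, ∑ j, piG p q (rot (Sum.inr i) (Sum.inr j) (sgn_inr i j)) *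
    piG p q (rot (Sum.inr i) (Sum.inr j) (sgn_inr i j))

/-- The element `-1` of the orthogonal group. -/
def negOne (n : ℕ) : Orth n := ⟨-1, by simp [Matrix.mem_orthogonalGroup_iff]⟩

theorem polySubst_negOne {n k : ℕ} {h : MvPolynomial (Fin n) ℂ} (hh : h.IsHomogeneous k) :
    polySubst (negOne n).1 h = ((-1 : ℂ) ^ k) • h := by
  refine polynomial_ext_real fun x => ?_
  have e : (negOne n).1.transpose.mulVec x = (-1 : ℝ) • x := by
    simp [negOne, Matrix.neg_mulVec]
  rw [evalR_polySubst, e, evalR_smul hh, map_smul]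
  simp

/-- Operators separating the `K`-types: the Casimir operators of `𝔬(p)` and `𝔬(q)` and the
parities. -/
def sepOp (p q : ℕ) : Fin 4 → Module.End ℂ (Smooth p q) :=
  ![casX p q, casY p q, piK p q (negOne p, 1), piK p q (1, negOne q)]

/-- The eigenvalues of the separating operators. -/
def sepVal (p q : ℕ) : Fin 4 → ℕ × ℕ → ℂ :=
  ![fun i => -2 * i.1 * ((i.1 : ℂ) + p - 2), fun i => -2 * i.2 * ((i.2 : ℂ) + q - 2),
    fun i => (-1) ^ i.1, fun i => (-1) ^ i.2]

theorem sepOp_mem {N : Submodule ℂ (Smooth p q)} (hN : IsGKStable (piG p q) (piK p q) N) (n : Fin 4)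
    {f : Smooth p q} (hf : f ∈ N) : sepOp p q n f ∈ N := by
  fin_cases n
  · change casX p q f ∈ N
    simp only [casX, LinearMap.sum_apply, Module.End.mul_apply]
    exact sum_mem fun i _ => sum_mem fun j _ => hN.1 _ _ (hN.1 _ _ hf)
  · change casY p q f ∈ N
    simp only [casY, LinearMap.sum_apply, Module.End.mul_apply]
    exact sum_mem fun i _ => sum_mem fun j _ => hN.1 _ _ (hN.1 _ _ hf)
  · exact hN.2 _ _ hf
  · exact hN.2 _ _ hf

theorem polyK_negOne_left {k l : ℕ} {P : Pol p q} (hP : P ∈ HH p q k l) :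
    polyK (negOne p, 1) P = ((-1 : ℂ) ^ k) • P := by
  refine HH_induction (motive := fun P => polyK (negOne p, 1) P = ((-1 : ℂ) ^ k) • P) (by simp)
    (fun P Q hP hQ => by rw [map_add, hP, hQ, smul_add]) (fun h₁ H₁ h₂ H₂ => ?_) hP
  rw [map_mul, polyK_rename_inl, polyK_rename_inr, polySubst_negOne (mem_Harm.1 H₁).1, map_smul,
    smul_mul_assoc]
  congr 3
  exact congrArg (fun f : _ →ₐ[ℂ] _ => f h₂) (polySubst_one q)

theorem polyK_negOne_right {k l : ℕ} {P : Pol p q} (hP : P ∈ HH p q k l) :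
    polyK (1, negOne q) P = ((-1 : ℂ) ^ l) • P := by
  refine HH_induction (motive := fun P => polyK (1, negOne q) P = ((-1 : ℂ) ^ l) • P) (by simp)
    (fun P Q hP hQ => by rw [map_add, hP, hQ, smul_add]) (fun h₁ H₁ h₂ H₂ => ?_) hP
  rw [map_mul, polyK_rename_inl, polyK_rename_inr, polySubst_negOne (mem_Harm.1 H₂).1, map_smul,
    mul_smul_comm]
  congr 3
  exact congrArg (fun f : _ →ₐ[ℂ] _ => f h₁) (polySubst_one p)

/-- The powers of ρ_x, ρ_y and the factor χ are invariant under K, so only the harmonic part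
matters. -/
theorem sepOp_G {k l : ℕ} {P : Pol p q} (hP : P ∈ HH p q k l) (a b : ℕ) (χ : Ent) (n : Fin 4) :
    sepOp p q n (G (P * (rX p q ^ a * rY p q ^ b)) χ) =
      sepVal p q n (k, l) • G (P * (rX p q ^ a * rY p q ^ b)) χ := by
  fin_cases n
  · change casX p q _ = (-2 * k * ((k : ℂ) + p - 2)) • _
    simp only [casX, LinearMap.sum_apply, Module.End.mul_apply, piG_rot_inl]
    have hE : eulS (bX p q) (P * rY p q ^ b) = (k : ℂ) • (P * rY p q ^ b) := by
      simpa using HH_eulX_mul hP 0 b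
    have hL : lapS (bX p q) (P * rY p q ^ b) = 0 := by simpa using HH_lapX_mul_zero hP b
    have h := sum_angS_sq_mul_rhoS_pow hE hL a
    have e : P * rY p q ^ b * rhoS (bX p q) ^ a = P * (rX p q ^ a * rY p q ^ b) := by ring
    rw [e, card_bX] at h
    rw [← LinearMap.smul_apply, ← map_smul, ← h]
    conv_rhs => rw [bX, Finset.sum_map]
    simp only [Finset.sum_map, map_sum, LinearMap.sum_apply, Function.Embedding.inl_apply]
  · change casY p q _ = (-2 * l * ((l : ℂ) + q - 2)) • _
    simp only [casY, LinearMap.sum_apply, Module.End.mul_apply, piG_rot_inr]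
    have hE : eulS (bY p q) (P * rX p q ^ a) = (l : ℂ) • (P * rX p q ^ a) := by
      simpa using HH_eulY_mul hP a 0
    have hL : lapS (bY p q) (P * rX p q ^ a) = 0 := by simpa using HH_lapY_mul_zero hP a
    have h := sum_angS_sq_mul_rhoS_pow hE hL b
    have e : P * rX p q ^ a * rhoS (bY p q) ^ b = P * (rX p q ^ a * rY p q ^ b) := by ring
    rw [e, card_bY] at h
    rw [← LinearMap.smul_apply, ← map_smul, ← h]
    conv_rhs => rw [bY, Finset.sum_map]
    simp only [Finset.sum_map, map_sum, LinearMap.sum_apply, Function.Embedding.inr_apply]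
  · change piK p q (negOne p, 1) _ = ((-1 : ℂ) ^ k) • _
    rw [piK_G, map_mul (polyK _), map_mul (polyK _), map_pow, map_pow, polyK_rX, polyK_rY, polyK_negOne_left hP,
      smul_mul_assoc, map_smul, LinearMap.smul_apply]
  · change piK p q (1, negOne q) _ = ((-1 : ℂ) ^ l) • _
    rw [piK_G, map_mul (polyK _), map_mul (polyK _), map_pow, map_pow, polyK_rX, polyK_rY, polyK_negOne_right hP,
      smul_mul_assoc, map_smul, LinearMap.smul_apply]

/-- Equal Casimir eigenvalues give k = k' or k + k' = 2 - n ≤ 1; in the latter case the parity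
decides. -/
theorem casimir_parity_injective {n k k' : ℕ} (hn : 0 < n)
    (h1 : (-2 : ℂ) * k * ((k : ℂ) + n - 2) = -2 * k' * ((k' : ℂ) + n - 2))
    (h2 : (-1 : ℂ) ^ k = (-1) ^ k') : k = k' := by
  have h3 : ((k : ℤ) - k') * (k + k' + n - 2) = 0 := by
    have : (((k : ℤ) - k') * (k + k' + n - 2) : ℂ) = 0 := by
      push_cast
      linear_combination (-1 / 2) * h1
    exact_mod_cast this
  have h4 : k % 2 = k' % 2 := by
    rcases Nat.even_or_odd k with hk | hk <;> rcases Nat.even_or_odd k' with hk' | hk'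
    · rw [Nat.even_iff.1 hk, Nat.even_iff.1 hk']
    · rw [hk.neg_one_pow, hk'.neg_one_pow] at h2
      norm_num at h2
    · rw [hk.neg_one_pow, hk'.neg_one_pow] at h2
      norm_num at h2
    · rw [Nat.odd_iff.1 hk, Nat.odd_iff.1 hk']
  rcases mul_eq_zero.1 h3 with h | h <;> omega

theorem exists_sepVal_ne (hp : 0 < p) (hq : 0 < q) {i j : ℕ × ℕ} (hij : i ≠ j) :
    ∃ n, sepVal p q n i ≠ sepVal p q n j := by
  by_contra! h
  exact hij (Prod.ext (casimir_parity_injective hp (h 0) (h 2))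
    (casimir_parity_injective hq (h 1) (h 3)))

/-- The functions of type `(k, l)`, as joint eigenvectors of the separating operators. -/
def isoE (p q : ℕ) (i : ℕ × ℕ) : Submodule ℂ (Smooth p q) where
  carrier := {f | ∀ n, sepOp p q n f = sepVal p q n i • f}
  add_mem' hf hg n := by rw [map_add, hf n, hg n, smul_add]
  zero_mem' n := by simp
  smul_mem' c f hf n := by rw [map_smul, hf n, smul_comm]

/-- Components of different `K`-types of an element of a `(𝔤, K)`-stable subspace. -/
theorem mem_of_sum_mem_of_isGKStable (hp : 0 < p) (hq : 0 < q) {N : Submodule ℂ (Smooth p q)}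
    (hN : IsGKStable (piG p q) (piK p q) N) {ι : Type*} {t : ι → ℕ × ℕ}
    (ht : Function.Injective t) {s : Finset ι} {g : ι → Smooth p q}
    (hg : ∀ i ∈ s, g i ∈ isoE p q (t i)) (h : ∑ i ∈ s, g i ∈ N) : ∀ i ∈ s, g i ∈ N := by
  classical
  intro i hi
  rw [← Finset.add_sum_erase s g hi] at h
  refine mem_of_add_sum_mem N i _ g (fun j hj => ?_) h
  obtain ⟨n, hn⟩ := exists_sepVal_ne hp hq fun h => (Finset.ne_of_mem_erase hj).symm (ht h)
  exact ⟨sepOp p q n, fun i => sepVal p q n (t i), fun f hf => sepOp_mem hN n hf, hg i hi n,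
    fun k hk => hg k (Finset.mem_of_mem_erase hk) n, hn⟩

/-- The functions of type `(k, l)` and weight determined by `δ`. -/
def piece (p q : ℕ) (i : ℕ × ℕ) (δ : ℤ) : Submodule ℂ (Smooth p q) :=
  Submodule.span ℂ {F | ∃ (P : Pol p q) (a b : ℕ) (χ : Ent), P ∈ HH p q i.1 i.2 ∧
    (b : ℤ) = a + δ ∧ F = G (P * (rX p q ^ a * rY p q ^ b)) χ}

theorem piece_le_isoE (i : ℕ × ℕ) (δ : ℤ) : piece p q i δ ≤ isoE p q i := by
  rw [piece, Submodule.span_le]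
  rintro _ ⟨P, a, b, χ, hP, -, rfl⟩ n
  exact sepOp_G hP a b χ n

theorem opH_piece {i : ℕ × ℕ} {δ : ℤ} {f : Smooth p q} (hf : f ∈ piece p q i δ) :
    opH p q f = ((i.2 : ℂ) + (q : ℂ) / 2 - (i.1 + (p : ℂ) / 2) + 2 * δ) • f := by
  induction hf using Submodule.span_induction with
  | zero => simp
  | add x y _ _ hx hy => rw [map_add, hx, hy, smul_add]
  | smul c x _ hx => rw [map_smul, hx, smul_comm]
  | mem x hx =>
    obtain ⟨P, a, b, χ, hP, hab, rfl⟩ := hx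
    rw [opH_G (HH_eulX_mul hP a b) (HH_eulY_mul hP a b)]
    congr 1
    have : (b : ℂ) = a + δ := by exact_mod_cast hab
    rw [this]
    ring

theorem bigE_le_iSup_piece : bigE p q ≤ ⨆ i : (ℕ × ℕ) × ℤ, piece p q i.1 i.2 := by
  rw [bigE, Submodule.span_le]
  rintro _ ⟨P, χ, rfl⟩
  induction mem_span_HH_mul P using Submodule.span_induction with
  | zero => simp
  | add x y _ _ hx hy => rw [map_add, LinearMap.add_apply]; exact add_mem hx hy
  | smul c x _ hx => rw [map_smul, LinearMap.smul_apply]; exact Submodule.smul_mem _ c hx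
  | mem x hx =>
    obtain ⟨k, l, a, b, R, hR, rfl⟩ := hx
    exact Submodule.mem_iSup_of_mem ((k, l), (b : ℤ) - a)
      (Submodule.subset_span ⟨R, a, b, χ, hR, by ring, rfl⟩)

/-- Components of an element of a subspace stable under `𝔤`, `K` and `H`. -/
theorem exists_pieces (hp : 0 < p) (hq : 0 < q) {N : Submodule ℂ (Smooth p q)}
    (hN : IsGKStable (piG p q) (piK p q) N) (hH : ∀ f ∈ N, opH p q f ∈ N) {f : Smooth p q}
    (hf : f ∈ bigE p q) (hfN : f ∈ N) :
    ∃ (s : Finset ((ℕ × ℕ) × ℤ)) (g : (ℕ × ℕ) × ℤ → Smooth p q),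
      (∀ i ∈ s, g i ∈ piece p q i.1 i.2 ∧ g i ∈ N) ∧ f = ∑ i ∈ s, g i := by
  obtain ⟨g, hg, rfl⟩ := (Submodule.mem_iSup_iff_exists_finsupp _ _).1 (bigE_le_iSup_piece hf)
  refine ⟨g.support, g, fun i hi => ⟨hg i, ?_⟩, rfl⟩
  change ∑ i ∈ g.support, g i ∈ N at hfN
  rw [← Finset.add_sum_erase g.support g hi] at hfN
  refine mem_of_add_sum_mem N i _ g (fun j hj => ?_) hfN
  have hij : i ≠ j := (Finset.ne_of_mem_erase hj).symm
  -- Components of the same type are separated by the weight, which determines δ; those of different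
  -- types by the Casimir operators and parities.
  by_cases h1 : i.1 = j.1
  · refine ⟨opH p q, fun i => (i.1.2 : ℂ) + (q : ℂ) / 2 - (i.1.1 + (p : ℂ) / 2) + 2 * i.2, hH,
      opH_piece (hg i), fun k _ => opH_piece (hg k), fun h2 => hij (Prod.ext h1 ?_)⟩
    simp only [h1] at h2
    have h3 : (i.2 : ℂ) = j.2 := by linear_combination (1 / 2) * h2
    exact_mod_cast h3
  · obtain ⟨n, hn⟩ := exists_sepVal_ne hp hq h1
    exact ⟨sepOp p q n, fun i => sepVal p q n i.1, fun f hf => sepOp_mem hN n hf,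
      piece_le_isoE _ _ (hg i) n, fun k _ => piece_le_isoE _ _ (hg k) n, hn⟩

end Separation

/-! ### Representations of `𝔰𝔩₂` -/

section Sl2

variable {W : Type*} [AddCommGroup W] [Module ℂ W] {e f h : Module.End ℂ W}

theorem sl2_weight (hf : ∀ v, h (f v) = f (h v) - (2 : ℂ) • f v) {μ : ℂ} {v : W} (hv : h v = μ • v)
    (n : ℕ) : h ((f ^ n) v) = (μ - 2 * n) • (f ^ n) v := by
  induction n with
  | zero => simpa using hv
  | succ n ih =>
    rw [pow_succ', Module.End.mul_apply, hf, ih, map_smul]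
    push_cast
    module

theorem sl2_raise_lower (ef : ∀ v, e (f v) = f (e v) + h v)
    (hf : ∀ v, h (f v) = f (h v) - (2 : ℂ) • f v) {μ : ℂ} {v : W} (hv : h v = μ • v)
    (ev : e v = 0) (n : ℕ) :
    e ((f ^ (n + 1)) v) = (((n : ℂ) + 1) * (μ - n)) • (f ^ n) v := by
  induction n with
  | zero =>
    rw [zero_add, pow_one, ef, ev, map_zero, zero_add, hv]
    simp
  | succ n ih =>
    rw [pow_succ', Module.End.mul_apply, ef, ih, sl2_weight hf hv, map_smul, ← Module.End.mul_apply,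
      ← pow_succ']
    push_cast
    module

/-- The vector just below the bottom of the string is itself primitive. Hence whether it vanishes
can be decided by the classification of primitive functions. -/
theorem sl2_raise_top (ef : ∀ v, e (f v) = f (e v) + h v)
    (hf : ∀ v, h (f v) = f (h v) - (2 : ℂ) • f v) {m : ℕ} {v : W} (hv : h v = (m : ℂ) • v)
    (ev : e v = 0) : e ((f ^ (m + 1)) v) = 0 := by
  rw [sl2_raise_lower ef hf hv ev, sub_self, mul_zero, zero_smul]

/-- The scalar is the product of (t + 1)(m - t) over t < n, and no factor vanishes as long as n ≤ m.
-/
theorem sl2_raise_pow_lower_pow (ef : ∀ v, e (f v) = f (e v) + h v)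
    (hf : ∀ v, h (f v) = f (h v) - (2 : ℂ) • f v) {m : ℕ} {v : W} (hv : h v = (m : ℂ) • v)
    (ev : e v = 0) {n : ℕ} (hn : n ≤ m) : ∃ c : ℂ, c ≠ 0 ∧ (e ^ n) ((f ^ n) v) = c • v := by
  induction n with
  | zero => exact ⟨1, one_ne_zero, by simp⟩
  | succ n ih =>
    obtain ⟨c, hc, h1⟩ := ih (by omega)
    refine ⟨(((n : ℂ) + 1) * (m - n)) * c, mul_ne_zero (mul_ne_zero (Nat.cast_add_one_ne_zero n)
      (sub_ne_zero.2 (by exact_mod_cast (by omega : m ≠ n)))) hc, ?_⟩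
    rw [pow_succ e, Module.End.mul_apply, sl2_raise_lower ef hf hv ev, map_smul, h1, smul_smul]

/-- The highest weight vectors of weight `m` generating a finite-dimensional module. -/
def primMod (e f h : Module.End ℂ W) (m : ℕ) : Submodule ℂ W where
  carrier := {v | h v = (m : ℂ) • v ∧ e v = 0 ∧ (f ^ (m + 1)) v = 0}
  add_mem' := by
    rintro a b ⟨h1, h2, h3⟩ ⟨h1', h2', h3'⟩
    exact ⟨by rw [map_add, h1, h1', smul_add], by rw [map_add, h2, h2', add_zero],
      by rw [map_add, h3, h3', add_zero]⟩
  zero_mem' := by simp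
  smul_mem' := by
    rintro c a ⟨h1, h2, h3⟩
    exact ⟨by rw [map_smul, h1, smul_comm], by rw [map_smul, h2, smul_zero],
      by rw [map_smul, h3, smul_zero]⟩

/-- This makes the nonvanishing conditions in the definition of M^±_m automatic, so that adding 0
yields a linear subspace. -/
theorem lower_pow_ne_zero (ef : ∀ v, e (f v) = f (e v) + h v)
    (hf : ∀ v, h (f v) = f (h v) - (2 : ℂ) • f v) {m : ℕ} {v : W} (hv : v ∈ primMod e f h m)
    (h0 : v ≠ 0) {j : ℕ} (hj : j ≤ m) : (f ^ j) v ≠ 0 := by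
  obtain ⟨c, hc, h1⟩ := sl2_raise_pow_lower_pow ef hf hv.1 hv.2.1 hj
  intro h2
  rw [h2, map_zero] at h1
  exact smul_ne_zero hc h0 h1.symm

/-- The highest weight vectors correspond to the lowest weight vectors. -/
theorem lower_pow_mem_primMod (ef : ∀ v, e (f v) = f (e v) + h v)
    (hf : ∀ v, h (f v) = f (h v) - (2 : ℂ) • f v) {m : ℕ} {v : W} (hv : v ∈ primMod e f h m) :
    (f ^ m) v ∈ primMod f e ((-1 : ℂ) • h) m := by
  refine ⟨?_, ?_, ?_⟩
  · rw [LinearMap.smul_apply, sl2_weight hf hv.1, smul_smul]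
    congr 1
    ring
  · rw [← Module.End.mul_apply, ← pow_succ']
    exact hv.2.2
  · obtain ⟨c, -, h1⟩ := sl2_raise_pow_lower_pow ef hf hv.1 hv.2.1 le_rfl
    rw [pow_succ', Module.End.mul_apply, h1, map_smul, hv.2.1, smul_zero]

end Sl2

/-! ### Primitive vectors -/

section Primitive

open MvPolynomial

variable {p q : ℕ}

theorem evalV_rename_inl (v : V p q) (h : MvPolynomial (Fin p) ℂ) :
    evalV v (rename Sum.inl h) = evalR v.1 h := by
  rw [evalV, aeval_rename]
  rfl

theorem evalV_rename_inr (v : V p q) (h : MvPolynomial (Fin q) ℂ) :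
    evalV v (rename Sum.inr h) = evalR v.2 h := by
  rw [evalV, aeval_rename]
  rfl

theorem evalV_smul_of_mem_HH {k l : ℕ} {P : Pol p q} (hP : P ∈ HH p q k l) (t : ℝ) (v : V p q) :
    evalV (t • v.1, v.2) P = (t : ℂ) ^ k * evalV v P := by
  refine HH_induction (motive := fun P => evalV (t • v.1, v.2) P = (t : ℂ) ^ k * evalV v P)
    (by simp) (fun P Q hP hQ => by rw [map_add, hP, hQ, map_add, mul_add])
    (fun h₁ H₁ h₂ H₂ => ?_) hP
  simp only [map_mul, evalV_rename_inl, evalV_rename_inr]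
  rw [evalR_smul (mem_Harm.1 H₁).1, mul_assoc]

theorem rho_smul {n : ℕ} (t : ℝ) (x : Fin n → ℝ) : rho (t • x) = t ^ 2 * rho x := by
  simp only [rho, Pi.smul_apply, smul_eq_mul, mul_pow, ← Finset.mul_sum]
  ring

theorem rho_single {n : ℕ} (i : Fin n) : rho (Pi.single i (1 : ℝ)) = 1 / 2 := by
  rw [rho, Finset.sum_eq_single i]
  · simp
  · intro j _ hj
    simp [hj]
  · simp

theorem rho_nonneg {n : ℕ} (x : Fin n → ℝ) : 0 ≤ rho x := by
  rw [rho]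
  positivity

theorem rho_mul_ne_zero (hp : 0 < p) (hq : 0 < q) : rX p q * rY p q ≠ 0 := by
  intro h
  have := congrArg (evalV ((Pi.single ⟨0, hp⟩ 1, Pi.single ⟨0, hq⟩ 1) : V p q)) h
  rw [map_mul, evalV_rX, evalV_rY, map_zero, rho_single, rho_single] at this
  norm_num at this

/-- Independence of functions `P_j(x, y) ρ_y^d χ_j(ρ_x ρ_y)`. -/
theorem eq_zero_of_sum_G_eq_zero (hp : 0 < p) (hq : 0 < q) {k l n : ℕ} {P : Fin n → Pol p q}
    (hP : ∀ j, P j ∈ HH p q k l) (hli : LinearIndependent ℂ P) (d : ℕ) {χ : Fin n → Ent}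
    (h : ∑ j, G (P j * rY p q ^ d) (χ j) = 0) (j : Fin n) : χ j = 0 := by
  refine ent_eq_zero_of_pos fun t ht => ?_
  have key : ∑ j, (χ j).1 t • P j = 0 := by
    have : (rX p q * rY p q) * ∑ j, (χ j).1 t • P j = 0 := by
      refine evalV_injective fun v => ?_
      rw [map_mul, map_zero, map_mul, evalV_rX, evalV_rY]
      by_cases h0 : rho v.1 * rho v.2 = 0
      · rw [← Complex.ofReal_mul, h0, Complex.ofReal_zero, zero_mul]
      · have hx := rho_nonneg v.1
        have hy := rho_nonneg v.2
        have hpos : 0 < rho v.1 * rho v.2 := lt_of_le_of_ne (mul_nonneg hx hy) (Ne.symm h0)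
        -- Rescaling x by c moves ρ_x ρ_y to the prescribed t and only multiplies each P_j by c^k.
        -- For fixed t the relation becomes a linear one among the P_j.
        set c := Real.sqrt (t / (rho v.1 * rho v.2)) with hc
        have hc2 : c ^ 2 * rho v.1 * rho v.2 = t := by
          rw [hc, Real.sq_sqrt (by positivity), mul_assoc, div_mul_cancel₀ _ h0]
        have hc0 : (c : ℂ) ≠ 0 := by
          intro h'
          have : c = 0 := by exact_mod_cast h'
          rw [this] at hc2
          simp at hc2
          exact ht.ne hc2
        have hev := congrArg (fun f : Smooth p q => f.1 (c • v.1, v.2)) h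
        have e : (∑ j, G (P j * rY p q ^ d) (χ j)).1 (c • v.1, v.2) =
            ((c : ℂ) ^ k * (rho v.2 : ℂ) ^ d) * ∑ j, evalV v (P j) * (χ j).1 t := by
          rw [AddSubmonoidClass.coe_finsetSum, Finset.sum_apply, Finset.mul_sum]
          refine Finset.sum_congr rfl fun j _ => ?_
          rw [G_apply, map_mul, map_mul, map_pow, evalV_smul_of_mem_HH (hP j), evalV_rX, evalV_rY]
          simp only [rho_smul]
          rw [← Complex.ofReal_mul, hc2]
          ring
        change (∑ j, G (P j * rY p q ^ d) (χ j)).1 (c • v.1, v.2) = 0 at hev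
        rw [e] at hev
        have hy0 : (rho v.2 : ℂ) ≠ 0 := by
          intro h'
          apply h0
          have : rho v.2 = 0 := by exact_mod_cast h'
          rw [this, mul_zero]
        have h1 := (mul_eq_zero.1 hev).resolve_left
          (mul_ne_zero (pow_ne_zero _ hc0) (pow_ne_zero _ hy0))
        have h2 : evalV v (∑ j, (χ j).1 t • P j) = 0 := by
          rw [map_sum, ← h1]
          refine Finset.sum_congr rfl fun j _ => ?_
          rw [map_smul, smul_eq_mul, mul_comm]
        rw [h2, mul_zero]
    exact (mul_eq_zero.1 this).resolve_left (rho_mul_ne_zero hp hq)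
  exact Fintype.linearIndependent_iff.1 hli _ key j

theorem eq_zero_of_G_eq_zero (hp : 0 < p) (hq : 0 < q) {k l : ℕ} {P : Pol p q}
    (hP : P ∈ HH p q k l) (h0 : P ≠ 0) (d : ℕ) {χ : Ent} (h : G (P * rY p q ^ d) χ = 0) :
    χ = 0 :=
  eq_zero_of_sum_G_eq_zero hp hq (P := fun _ : Fin 1 => P) (fun _ => hP)
    (LinearIndependent.of_subsingleton 0 h0) d (χ := fun _ => χ) (by simpa using h) 0

theorem G_mul_rho_pow (P : Pol p q) (n : ℕ) (χ : Ent) :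
    G (P * (rX p q * rY p q) ^ n) χ = G P (entZ ^ n * χ) := by
  induction n generalizing χ with
  | zero => simp
  | succ n ih => rw [pow_succ, ← mul_assoc, G_mul_rho, ih, ← mul_assoc, ← pow_succ]

/-- Multiplication by ρ_y^e clears a negative δ. Then ρ_x^a ρ_y^{b+e} = (ρ_x ρ_y)^a ρ_y^d, and the
first factor enters χ as z^a. For δ < 0 every a is positive, whence the vanishing at 0. -/
theorem exists_normal_form {i : ℕ × ℕ} {δ : ℤ} {e d : ℕ} (hed : (e : ℤ) + δ = d) {f : Smooth p q}
    (hf : f ∈ piece p q i δ) :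
    ∃ χ : Fin (Module.finrank ℂ (HH p q i.1 i.2)) → Ent,
      polyMul (rY p q ^ e) f =
        ∑ j, G ((Module.finBasis ℂ (HH p q i.1 i.2) j).1 * rY p q ^ d) (χ j) ∧
      (δ < 0 → ∀ j, (χ j).1 0 = 0) := by
  set b := Module.finBasis ℂ (HH p q i.1 i.2)
  induction hf using Submodule.span_induction with
  | zero => exact ⟨0, by simp, fun _ _ => rfl⟩
  | add x y _ _ hx hy =>
    obtain ⟨χ, h1, h2⟩ := hx
    obtain ⟨θ, h3, h4⟩ := hy
    refine ⟨χ + θ, ?_, fun hδ j => ?_⟩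
    · simp only [map_add, h1, h3, Pi.add_apply, Finset.sum_add_distrib]
    · change (χ j).1 0 + (θ j).1 0 = 0
      rw [h2 hδ, h4 hδ, add_zero]
  | smul c x _ hx =>
    obtain ⟨χ, h1, h2⟩ := hx
    refine ⟨c • χ, ?_, fun hδ j => ?_⟩
    · simp only [map_smul, h1, Pi.smul_apply, Finset.smul_sum]
    · change c * (χ j).1 0 = 0
      rw [h2 hδ, mul_zero]
  | mem x hx =>
    obtain ⟨P, a, b', χ, hP, hab, rfl⟩ := hx
    have hb : e + b' = a + d := by omega
    refine ⟨fun j => b.repr ⟨P, hP⟩ j • (entZ ^ a * χ), ?_, fun hδ j => ?_⟩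
    · have e1 : rY p q ^ e * (P * (rX p q ^ a * rY p q ^ b')) =
          P * rY p q ^ d * (rX p q * rY p q) ^ a := by
        have : rY p q ^ e * rY p q ^ b' = rY p q ^ a * rY p q ^ d := by
          rw [← pow_add, ← pow_add, hb]
        rw [mul_pow]
        linear_combination (P * rX p q ^ a) * this
      rw [polyMul_G, e1, G_mul_rho_pow]
      have e2 : P = ∑ j, b.repr ⟨P, hP⟩ j • (b j).1 := by
        have := congrArg Subtype.val (b.sum_repr ⟨P, hP⟩)
        rw [AddSubmonoidClass.coe_finsetSum] at this
        exact this.symm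
      conv_lhs => rw [e2, Finset.sum_mul, map_sum, LinearMap.sum_apply]
      refine Finset.sum_congr rfl fun j _ => ?_
      rw [smul_mul_assoc, map_smul, map_smul, LinearMap.smul_apply]
    · have ha : a ≠ 0 := by omega
      change b.repr ⟨P, hP⟩ j * (entZ ^ a * χ).1 0 = 0
      have : (entZ ^ a * χ).1 0 = 0 ^ a * χ.1 0 := rfl
      rw [this, zero_pow ha, zero_mul, mul_zero]

theorem opXp_polyMul {Q : Pol p q} (hQ : ∀ a ∈ bX p q, pderiv a Q = 0) (f : Smooth p q) :
    opXp p q (polyMul Q f) = polyMul Q (opXp p q f) := by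
  rw [opXp_apply, opXp_apply, map_sub, map_smul, map_sum]
  congr 1
  · congr 1
    refine Finset.sum_congr rfl fun a ha => ?_
    rw [dd_polyMul_apply, hQ a ha, map_zero, LinearMap.zero_apply, add_zero, dd_polyMul_apply,
      hQ a ha, map_zero, LinearMap.zero_apply, add_zero]
  · rw [← Module.End.mul_apply, ← Module.End.mul_apply, polyMul_comm]

/-- The polynomial is harmonic in x, so only the Bessel term of X⁺ survives. -/
theorem opXp_G_rY_pow {k l : ℕ} {P : Pol p q} (hP : P ∈ HH p q k l) (d : ℕ) (χ : Ent) :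
    opXp p q (G (P * rY p q ^ d) χ) =
      -G (P * rY p q ^ (d + 1)) (besselOp ((k : ℂ) + (p : ℂ) / 2) χ) := by
  have h := opXp_G (HH_eulX_mul hP 0 d) χ
  rw [HH_lapX_mul_zero hP, map_zero, LinearMap.zero_apply, smul_zero, zero_sub, pow_zero, one_mul,
    Nat.cast_zero, mul_zero, add_zero, mul_assoc, ← pow_succ] at h
  exact h

theorem goodParam_kappa (k : ℕ) {n : ℕ} (hn : 0 < n) : GoodParam ((k : ℂ) + (n : ℂ) / 2) := by
  intro j h
  have h1 : ((k : ℝ) + (n : ℝ) / 2 : ℝ) = -(j : ℝ) := by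
    have := congrArg Complex.re h
    simpa using this
  have h2 : (0 : ℝ) < n := by exact_mod_cast hn
  have h3 : (0 : ℝ) ≤ k := Nat.cast_nonneg k
  have h4 : (0 : ℝ) ≤ j := Nat.cast_nonneg j
  linarith

theorem eq_zero_of_polyMul_rY_pow (hq : 0 < q) (e : ℕ) {f : Smooth p q}
    (h : polyMul (rY p q ^ e) f = 0) : f = 0 := by
  have h1 : ∀ v : V p q, rho v.2 ≠ 0 → f.1 v = 0 := by
    intro v hv
    have h2 : (polyMul (rY p q ^ e) f).1 v = 0 := by rw [h]; rfl
    rw [polyMul_apply, map_pow, evalV_rY] at h2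
    exact (mul_eq_zero.1 h2).resolve_left (pow_ne_zero _ (by exact_mod_cast hv))
  refine smooth_ext fun v => ?_
  by_cases hv : rho v.2 = 0
  · have hv2 : v.2 = 0 := by
      rw [rho, div_eq_zero_iff, or_iff_left (by norm_num),
        Finset.sum_eq_zero_iff_of_nonneg fun i _ => sq_nonneg _] at hv
      funext i
      exact pow_eq_zero_iff (by norm_num) |>.1 (hv i (Finset.mem_univ i))
    -- At y = 0 the value is recovered by continuity along a line, since ρ_y ≠ 0 elsewhere on it.
    have hc : Continuous fun t : ℝ => f.1 (v.1, t • (Pi.single ⟨0, hq⟩ 1 : Fin q → ℝ)) :=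
      (Smooth.contDiff f).continuous.comp (by fun_prop)
    have h3 := Continuous.ext_on (dense_compl_singleton (0 : ℝ)) hc
      (continuous_const (y := (0 : ℂ))) (fun t ht => h1 _ (by
        simp only [rho_smul, rho_single]
        have : t ≠ 0 := ht
        positivity))
    have h4 := congrFun h3 0
    simp only [zero_smul] at h4
    rw [← hv2] at h4
    exact h4
  · exact h1 v hv

/-- The primitive functions of a given type and weight. -/
theorem primitive_piece (hp : 0 < p) (hq : 0 < q) {i : ℕ × ℕ} {δ : ℤ} {f : Smooth p q}
    (hf : f ∈ piece p q i δ) (h : opXp p q f = 0) {e d : ℕ} (hed : (e : ℤ) + δ = d) :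
    ∃ P ∈ HH p q i.1 i.2, polyMul (rY p q ^ e) f =
        G (P * rY p q ^ d) (psiE ((i.1 : ℂ) + (p : ℂ) / 2)) ∧ (δ < 0 → P = 0) := by
  obtain ⟨χ, h1, h2⟩ := exists_normal_form hed hf
  set b := Module.finBasis ℂ (HH p q i.1 i.2)
  have hX : opXp p q (polyMul (rY p q ^ e) f) = 0 := by
    rw [opXp_polyMul (fun a ha => pderiv_rhoS_pow_of_disjoint disjoint_bX_bY e ha), h, map_zero]
  rw [h1, map_sum] at hX
  simp only [opXp_G_rY_pow (b _).2, Finset.sum_neg_distrib, neg_eq_zero] at hX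
  have hli : LinearIndependent ℂ fun j => (b j).1 :=
    b.linearIndependent.map' (HH p q i.1 i.2).subtype (Submodule.ker_subtype _)
  have h3 := eq_zero_of_sum_G_eq_zero hp hq (fun j => (b j).2) hli (d + 1) hX
  -- By independence each χ_j solves the Bessel equation, so it is a multiple of Ψ_κ; the values at
  -- 0 are the coefficients of the required P.
  have h4 : ∀ j, χ j = (χ j).1 0 • psiE ((i.1 : ℂ) + (p : ℂ) / 2) := fun j =>
    eq_smul_psiE (goodParam_kappa i.1 hp) (h3 j)
  refine ⟨∑ j, (χ j).1 0 • (b j).1, sum_mem fun j _ => Submodule.smul_mem _ _ (b j).2, ?_,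
    fun hδ => Finset.sum_eq_zero fun j _ => by rw [h2 hδ, zero_smul]⟩
  rw [h1, Finset.sum_mul, map_sum, LinearMap.sum_apply]
  refine Finset.sum_congr rfl fun j _ => ?_
  rw [smul_mul_assoc, map_smul, LinearMap.smul_apply, ← map_smul, ← h4]

/-- With e = |δ| and d = 0, every χ_j is a multiple of Ψ_κ that vanishes at 0, hence zero. -/
theorem primitive_piece_neg (hp : 0 < p) (hq : 0 < q) {i : ℕ × ℕ} {δ : ℤ} {f : Smooth p q}
    (hf : f ∈ piece p q i δ) (h : opXp p q f = 0) (hδ : δ < 0) : f = 0 := by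
  obtain ⟨P, -, h1, h2⟩ := primitive_piece hp hq hf h (e := δ.natAbs) (d := 0) (by omega)
  rw [h2 hδ, zero_mul, map_zero, LinearMap.zero_apply] at h1
  exact eq_zero_of_polyMul_rY_pow hq _ h1

theorem primitive_piece_nonneg (hp : 0 < p) (hq : 0 < q) {i : ℕ × ℕ} {d : ℕ} {f : Smooth p q}
    (hf : f ∈ piece p q i d) (h : opXp p q f = 0) :
    ∃ P ∈ HH p q i.1 i.2, f = G (P * rY p q ^ d) (psiE ((i.1 : ℂ) + (p : ℂ) / 2)) := by
  obtain ⟨P, hP, h1, -⟩ := primitive_piece hp hq hf h (e := 0) (d := d) (by simp)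
  refine ⟨P, hP, ?_⟩
  rw [pow_zero, map_one] at h1
  exact h1

/-! ### The lowering operator -/

/-- Only the value of the new entire function at 0 is recorded. The term of X⁻ carrying ρ_x acquires
a factor z and does not affect it, so nonvanishing can be followed through iterates. -/
theorem opXm_G_rY_pow_succ {k l : ℕ} {P : Pol p q} (hP : P ∈ HH p q k l) (d : ℕ) (χ : Ent) :
    ∃ θ : Ent, opXm p q (G (P * rY p q ^ (d + 1)) χ) = G (P * rY p q ^ d) θ ∧
      θ.1 0 = (((d : ℂ) + 1) * (l + (q : ℂ) / 2 + d)) * χ.1 0 := by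
  have h := opXm_G (HH_eulY_mul hP 0 (d + 1)) χ
  rw [HH_lapY_mul_succ hP, pow_zero, one_mul, one_mul, map_smul, LinearMap.smul_apply,
    smul_smul] at h
  set B := besselOp ((l : ℂ) + 2 * ((d + 1 : ℕ) : ℂ) + (q : ℂ) / 2) χ with hB
  have e : P * rY p q ^ (d + 1) * rX p q = P * rY p q ^ d * (rX p q * rY p q) := by ring
  refine ⟨(((d : ℂ) + 1) * (l + (q : ℂ) / 2 + d)) • χ + entZ * B, ?_, ?_⟩
  · rw [h, e, G_mul_rho, map_add, map_smul]
    congr 2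
    ring
  · change (((d : ℂ) + 1) * (l + (q : ℂ) / 2 + d)) * χ.1 0 + 0 * B.1 0 = _
    ring

theorem opXm_pow_G {k l : ℕ} (hq : 0 < q) {P : Pol p q} (hP : P ∈ HH p q k l) (d n : ℕ) {χ : Ent}
    (hχ : χ.1 0 ≠ 0) : ∃ θ : Ent, (opXm p q ^ n) (G (P * rY p q ^ (d + n)) χ) =
      G (P * rY p q ^ d) θ ∧ θ.1 0 ≠ 0 := by
  induction n generalizing χ with
  | zero => exact ⟨χ, rfl, hχ⟩
  | succ n ih =>
    obtain ⟨θ, h1, h2⟩ := opXm_G_rY_pow_succ hP (d + n) χ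
    obtain ⟨η, h3, h4⟩ := ih (χ := θ) (by
      rw [h2]
      refine mul_ne_zero (mul_ne_zero (Nat.cast_add_one_ne_zero _) ?_) hχ
      exact (goodParam_kappa l hq).add_natCast (d + n))
    refine ⟨η, ?_, h4⟩
    rw [pow_succ, Module.End.mul_apply, ← add_assoc, h1, h3]

theorem opXm_mem_piece {i : ℕ × ℕ} {δ : ℤ} {f : Smooth p q} (hf : f ∈ piece p q i δ) :
    opXm p q f ∈ piece p q i (δ - 1) := by
  induction hf using Submodule.span_induction with
  | zero => simp
  | add x y _ _ hx hy => rw [map_add]; exact add_mem hx hy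
  | smul c x _ hx => rw [map_smul]; exact Submodule.smul_mem _ c hx
  | mem x hx =>
    obtain ⟨P, a, b, χ, hP, hab, rfl⟩ := hx
    rw [opXm_G (HH_eulY_mul hP a b)]
    refine add_mem (Submodule.smul_mem _ _ ?_) ?_
    · rcases b with _ | b
      · rw [HH_lapY_mul_zero hP, map_zero]
        exact zero_mem _
      · rw [HH_lapY_mul_succ hP, map_smul]
        exact Submodule.smul_mem _ _ (Submodule.subset_span ⟨P, a, b, χ, hP, by
          push_cast at hab
          omega, rfl⟩)
    · have e : P * (rX p q ^ a * rY p q ^ b) * rX p q = P * (rX p q ^ (a + 1) * rY p q ^ b) := by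
        ring
      rw [e]
      exact Submodule.subset_span ⟨P, a + 1, b, _, hP, by push_cast; omega, rfl⟩

theorem opXm_pow_mem_piece {i : ℕ × ℕ} {δ : ℤ} {f : Smooth p q} (hf : f ∈ piece p q i δ) (n : ℕ) :
    (opXm p q ^ n) f ∈ piece p q i (δ - n) := by
  induction n with
  | zero => simpa using hf
  | succ n ih =>
    rw [pow_succ', Module.End.mul_apply]
    have := opXm_mem_piece ih
    push_cast
    rwa [sub_sub] at this

end Primitive

/-! ### The modules `M^±_m` and their `K`-types -/

section Modules

open MvPolynomial

variable {p q : ℕ}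

theorem map_mem_primMod {W : Type*} [AddCommGroup W] [Module ℂ W] {A e f h : Module.End ℂ W}
    (he : ∀ v, A (e v) = e (A v)) (hf : ∀ v, A (f v) = f (A v)) (hh : ∀ v, A (h v) = h (A v))
    {m : ℕ} {v : W} (hv : v ∈ primMod e f h m) : A v ∈ primMod e f h m := by
  have hfn : ∀ (n : ℕ) v, A ((f ^ n) v) = (f ^ n) (A v) := by
    intro n
    induction n with
    | zero => simp
    | succ n ih =>
      intro v
      rw [pow_succ, Module.End.mul_apply, Module.End.mul_apply, ih, hf]
  exact ⟨by rw [← hh, hv.1, map_smul], by rw [← he, hv.2.1, map_zero],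
    by rw [← hfn, hv.2.2, map_zero]⟩

/-- The highest weight vectors of weight `m` in `C^∞(V)`. -/
abbrev primP (p q m : ℕ) : Submodule ℂ (Smooth p q) := primMod (opXp p q) (opXm p q) (opH p q) m

/-- The lowest weight vectors of weight `-m` in `C^∞(V)`. -/
abbrev primM (p q m : ℕ) : Submodule ℂ (Smooth p q) :=
  primMod (opXm p q) (opXp p q) ((-1 : ℂ) • opH p q) m

theorem piG_opXp (Y : 𝔤 p q) (f : Smooth p q) :
    piG p q Y (opXp p q f) = opXp p q (piG p q Y f) :=
  congrArg (fun T : Module.End ℂ (Smooth p q) => T f) (commute_piG_opXp Y).eq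

theorem piG_opXm (Y : 𝔤 p q) (f : Smooth p q) :
    piG p q Y (opXm p q f) = opXm p q (piG p q Y f) :=
  congrArg (fun T : Module.End ℂ (Smooth p q) => T f) (commute_piG_opXm Y).eq

theorem piK_opXp (k : K p q) (f : Smooth p q) :
    piK p q k (opXp p q f) = opXp p q (piK p q k f) :=
  congrArg (fun T : Module.End ℂ (Smooth p q) => T f) (commute_piK_opXp k).eq

theorem piK_opXm (k : K p q) (f : Smooth p q) :
    piK p q k (opXm p q f) = opXm p q (piK p q k f) :=
  congrArg (fun T : Module.End ℂ (Smooth p q) => T f) (commute_piK_opXm k).eq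

theorem primP_stable (m : ℕ) : IsGKStable (piG p q) (piK p q) (primP p q m) :=
  ⟨fun Y _ hf => map_mem_primMod (piG_opXp Y) (piG_opXm Y) (piG_opH Y) hf,
    fun k _ hf => map_mem_primMod (piK_opXp k) (piK_opXm k) (piK_opH k) hf⟩

theorem opXm_opXp (f : Smooth p q) :
    opXm p q (opXp p q f) = opXp p q (opXm p q f) + ((-1 : ℂ) • opH p q) f := by
  rw [opXp_opXm, LinearMap.smul_apply]
  module

theorem neg_opH_opXp (f : Smooth p q) : ((-1 : ℂ) • opH p q) (opXp p q f) =
    opXp p q (((-1 : ℂ) • opH p q) f) - (2 : ℂ) • opXp p q f := by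
  rw [LinearMap.smul_apply, LinearMap.smul_apply, opH_opXp, map_smul]
  module

/-- The exponent of `ρ_y` in the `K`-type with the given index. -/
def dIdx {m : ℕ} (i : KIndex p q m) : ℕ := Classical.choose i.2

theorem dIdx_le {m : ℕ} (i : KIndex p q m) : dIdx i ≤ m := (Classical.choose_spec i.2).1

theorem dIdx_spec {m : ℕ} (i : KIndex p q m) :
    (i.1.1 : ℚ) - i.1.2 + ((p : ℚ) - q) / 2 = -m + 2 * dIdx i := (Classical.choose_spec i.2).2

theorem dIdx_spec_complex {m : ℕ} (i : KIndex p q m) :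
    (i.1.1 : ℂ) - i.1.2 + ((p : ℂ) - q) / 2 = -m + 2 * dIdx i := by
  have := congrArg (fun t : ℚ => (t : ℂ)) (dIdx_spec i)
  push_cast at this
  exact this

/-- The `K`-type with index `i` in the space of highest weight vectors. -/
def vecP {m : ℕ} (i : KIndex p q m) : Harm i.1.1 p ⊗[ℂ] Harm i.1.2 q →ₗ[ℂ] Smooth p q :=
  G.flip (psiE ((i.1.1 : ℂ) + (p : ℂ) / 2)) ∘ₗ LinearMap.mulRight ℂ (rY p q ^ dIdx i) ∘ₗ
    theta i.1.1 i.1.2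

theorem vecP_apply {m : ℕ} (i : KIndex p q m) (w : Harm i.1.1 p ⊗[ℂ] Harm i.1.2 q) :
    vecP i w = G (theta i.1.1 i.1.2 w * rY p q ^ dIdx i) (psiE ((i.1.1 : ℂ) + (p : ℂ) / 2)) := rfl

theorem theta_mem_HH {k l : ℕ} (w : Harm k p ⊗[ℂ] Harm l q) : theta k l w ∈ HH p q k l := ⟨w, rfl⟩

theorem piK_vecP {m : ℕ} (i : KIndex p q m) (k : K p q) (w : Harm i.1.1 p ⊗[ℂ] Harm i.1.2 q) :
    piK p q k (vecP i w) = vecP i (kTypeRep p q i.1.1 i.1.2 k w) := by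
  rw [vecP_apply, vecP_apply, piK_G, map_mul (polyK k), map_pow, polyK_rY, theta_kTypeRep]

theorem vecP_mem_piece {m : ℕ} (i : KIndex p q m) (w : Harm i.1.1 p ⊗[ℂ] Harm i.1.2 q) :
    vecP i w ∈ piece p q i.1 (dIdx i) :=
  Submodule.subset_span ⟨_, 0, dIdx i, _, theta_mem_HH w, by simp, by
    rw [pow_zero, one_mul]; rfl⟩

theorem vecP_eq_zero (hp : 0 < p) (hq : 0 < q) {m : ℕ} (i : KIndex p q m)
    {w : Harm i.1.1 p ⊗[ℂ] Harm i.1.2 q} (h : vecP i w = 0) : w = 0 := by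
  apply theta_eq_zero hp hq
  by_contra h0
  have h1 := eq_zero_of_G_eq_zero hp hq (theta_mem_HH w) h0 _ h
  have h2 := psiE_zero (goodParam_kappa i.1.1 hp)
  rw [h1] at h2
  exact zero_ne_one h2

theorem vecP_mem (hp : 0 < p) (hq : 0 < q) {m : ℕ} (i : KIndex p q m)
    (w : Harm i.1.1 p ⊗[ℂ] Harm i.1.2 q) : vecP i w ∈ spaceE p q ⊓ primP p q m := by
  have hH : opH p q (vecP i w) = (m : ℂ) • vecP i w := by
    rw [opH_piece (vecP_mem_piece i w)]
    congr 1
    push_cast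
    linear_combination -dIdx_spec_complex i
  have hX : opXp p q (vecP i w) = 0 := by
    rw [vecP_apply, opXp_G_rY_pow (theta_mem_HH w), besselOp_psiE (goodParam_kappa i.1.1 hp),
      map_zero, neg_zero]
  refine ⟨?_, hH, hX, ?_⟩
  · have := G_mem_spaceE (theta_mem_HH w) 0 (dIdx i) (goodParam_kappa i.1.1 hp)
    rw [pow_zero, one_mul] at this
    exact this
  -- (X⁻)^{m+1} produces a primitive vector with δ = d - m - 1 < 0, which must be zero.
  · refine primitive_piece_neg hp hq (opXm_pow_mem_piece (vecP_mem_piece i w) (m + 1))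
      (sl2_raise_top opXp_opXm opH_opXm hH hX) ?_
    have := dIdx_le i
    push_cast
    omega

/-- The components of a primitive vector are primitive, so those with δ = d ≥ 0 have the form P
ρ_y^d Ψ_κ and the others vanish. If d > m, then (X⁻)^{m+1} would leave an entire factor nonzero at
0. The weight equation then places (k, l) in the index set. -/
theorem primP_le_iSup (hp : 0 < p) (hq : 0 < q) (m : ℕ) :
    bigE p q ⊓ primP p q m ≤ ⨆ i : KIndex p q m, LinearMap.range (vecP i) := by
  rintro f ⟨hf, hfN⟩
  obtain ⟨s, g, hg, rfl⟩ := exists_pieces hp hq (primP_stable m) (fun f hf => by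
    rw [hf.1]
    exact Submodule.smul_mem _ _ hf) hf hfN
  refine sum_mem fun i hi => ?_
  obtain ⟨hpc, hH, hX, hXm⟩ := hg i hi
  by_cases h0 : g i = 0
  · rw [h0]
    exact zero_mem _
  rcases lt_or_ge i.2 0 with hδ | hδ
  · exact absurd (primitive_piece_neg hp hq hpc hX hδ) h0
  obtain ⟨d, hd⟩ := Int.eq_ofNat_of_zero_le hδ
  rw [hd] at hpc
  obtain ⟨P, hP, he⟩ := primitive_piece_nonneg hp hq hpc hX
  have hP0 : P ≠ 0 := by
    rintro rfl
    apply h0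
    rw [he, zero_mul, map_zero, LinearMap.zero_apply]
  have hdm : d ≤ m := by
    by_contra hlt
    obtain ⟨θ, h1, h2⟩ := opXm_pow_G hq hP (d - (m + 1)) (m + 1)
      (χ := psiE ((i.1.1 : ℂ) + (p : ℂ) / 2)) (by
        rw [psiE_zero (goodParam_kappa i.1.1 hp)]
        exact one_ne_zero)
    rw [show d - (m + 1) + (m + 1) = d by omega, ← he, hXm] at h1
    rw [eq_zero_of_G_eq_zero hp hq hP hP0 _ h1.symm] at h2
    exact h2 rfl
  have hw : (i.1.1 : ℂ) - i.1.2 + ((p : ℂ) - q) / 2 = -m + 2 * d := by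
    rw [opH_piece hpc] at hH
    have := smul_left_injective ℂ h0 hH
    push_cast at this
    linear_combination -this
  have hw' : (i.1.1 : ℚ) - i.1.2 + ((p : ℚ) - q) / 2 = -m + 2 * d := by
    have h : (((i.1.1 : ℚ) - i.1.2 + ((p : ℚ) - q) / 2 : ℚ) : ℂ) = ((-m + 2 * d : ℚ) : ℂ) := by
      push_cast
      exact hw
    exact_mod_cast h
  let i' : KIndex p q m := ⟨i.1, d, hdm, hw'⟩
  have hdd : dIdx i' = d := by
    have h := dIdx_spec i'
    rw [hw'] at h
    have : (d : ℚ) = dIdx i' := by linear_combination (1 / 2) * h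
    exact_mod_cast this.symm
  obtain ⟨w, rfl⟩ := hP
  refine Submodule.mem_iSup_of_mem i' ⟨w, ?_⟩
  rw [vecP_apply, hdd, he]

/-- The left side is visibly stable under 𝔤 and K, the right side is M⁺_m; equality holds because
the primitive vectors found in the larger space already involve only the functions Ψ_κ. -/
theorem primP_eq (hp : 0 < p) (hq : 0 < q) (m : ℕ) :
    bigE p q ⊓ primP p q m = spaceE p q ⊓ primP p q m := by
  apply le_antisymm
  · refine (primP_le_iSup hp hq m).trans (iSup_le fun i => ?_)
    rintro _ ⟨w, rfl⟩
    exact vecP_mem hp hq i w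
  · exact inf_le_inf_right _ spaceE_le_bigE

theorem span_eq_of_subset_insert {W : Type*} [AddCommGroup W] [Module ℂ W] {S : Set W}
    {M : Submodule ℂ W} (h1 : S ⊆ M) (h2 : (M : Set W) ⊆ insert 0 S) :
    Submodule.span ℂ S = M ∧ (Submodule.span ℂ S : Set W) = insert 0 S := by
  have h : Submodule.span ℂ S = M := by
    refine le_antisymm (Submodule.span_le.2 h1) fun x hx => ?_
    rcases h2 hx with rfl | hx
    · exact zero_mem _
    · exact Submodule.subset_span hx
  refine ⟨h, ?_⟩
  rw [h]
  exact Set.Subset.antisymm h2 (Set.insert_subset M.zero_mem h1)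

theorem modPlus_eq_and (m : ℕ) : modPlus p q m = spaceE p q ⊓ primP p q m ∧
    (modPlus p q m : Set (Smooth p q)) = insert 0 (setPlus p q m) := by
  refine span_eq_of_subset_insert ?_ ?_
  · rintro f ⟨h1, h2, h3, -, h5⟩
    exact ⟨h1, h2, h3, h5⟩
  · rintro f ⟨h1, h2⟩
    by_cases h0 : f = 0
    · exact Or.inl h0
    · exact Or.inr ⟨h1, h2.1, h2.2.1,
        fun j _ hj => lower_pow_ne_zero opXp_opXm opH_opXm h2 h0 hj, h2.2.2⟩

theorem modMinus_eq_and (m : ℕ) : modMinus p q m = spaceE p q ⊓ primM p q m ∧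
    (modMinus p q m : Set (Smooth p q)) = insert 0 (setMinus p q m) := by
  refine span_eq_of_subset_insert ?_ ?_
  · rintro f ⟨h1, h2, h3, -, h5⟩
    refine ⟨h1, ?_, h3, h5⟩
    rw [LinearMap.smul_apply, h2]
    module
  · rintro f ⟨h1, h2⟩
    by_cases h0 : f = 0
    · exact Or.inl h0
    · refine Or.inr ⟨h1, ?_, h2.2.1,
        fun j _ hj => lower_pow_ne_zero opXm_opXp neg_opH_opXp h2 h0 hj, h2.2.2⟩
      have := h2.1
      rw [LinearMap.smul_apply] at this
      have h3 : opH p q f = (-1 : ℂ) • ((-1 : ℂ) • opH p q f) := by module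
      rw [h3, this]
      module

theorem pow_mem_spaceE {A : Module.End ℂ (Smooth p q)} (hA : ∀ f ∈ spaceE p q, A f ∈ spaceE p q)
    (n : ℕ) {f : Smooth p q} (hf : f ∈ spaceE p q) : (A ^ n) f ∈ spaceE p q := by
  induction n with
  | zero => simpa using hf
  | succ n ih =>
    rw [pow_succ', Module.End.mul_apply]
    exact hA _ ih

theorem opXm_pow_mem_modMinus {m : ℕ} {f : Smooth p q} (hf : f ∈ modPlus p q m) :
    (opXm p q ^ m) f ∈ modMinus p q m := by
  rw [(modPlus_eq_and m).1] at hf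
  rw [(modMinus_eq_and m).1]
  exact ⟨pow_mem_spaceE (fun _ => opXm_mem_spaceE) m hf.1,
    lower_pow_mem_primMod opXp_opXm opH_opXm hf.2⟩

theorem opXp_pow_mem_modPlus {m : ℕ} {f : Smooth p q} (hf : f ∈ modMinus p q m) :
    (opXp p q ^ m) f ∈ modPlus p q m := by
  rw [(modMinus_eq_and m).1] at hf
  rw [(modPlus_eq_and m).1]
  refine ⟨pow_mem_spaceE (fun _ => opXp_mem_spaceE) m hf.1, ?_⟩
  have h := lower_pow_mem_primMod opXm_opXp neg_opH_opXp hf.2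
  rwa [smul_smul, neg_mul_neg, one_mul, one_smul] at h

theorem opXp_pow_opXm_pow {m : ℕ} {f : Smooth p q} (hf : f ∈ modPlus p q m) :
    ∃ c : ℂ, c ≠ 0 ∧ (opXp p q ^ m) ((opXm p q ^ m) f) = c • f := by
  rw [(modPlus_eq_and m).1] at hf
  exact sl2_raise_pow_lower_pow opXp_opXm opH_opXm hf.2.1 hf.2.2.1 le_rfl

theorem opXm_pow_opXp_pow {m : ℕ} {f : Smooth p q} (hf : f ∈ modMinus p q m) :
    ∃ c : ℂ, c ≠ 0 ∧ (opXm p q ^ m) ((opXp p q ^ m) f) = c • f := by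
  rw [(modMinus_eq_and m).1] at hf
  exact sl2_raise_pow_lower_pow opXm_opXp neg_opH_opXp hf.2.1 hf.2.2.1 le_rfl

/-- Surjectivity comes from (X⁺)^m, an inverse up to a nonzero scalar. Since (X⁻)^m commutes with 𝔤
and K, results on M⁺_m transfer. -/
theorem modMinus_eq_map (m : ℕ) : modMinus p q m = (modPlus p q m).map (opXm p q ^ m) := by
  apply le_antisymm
  · intro f hf
    obtain ⟨c, hc, h⟩ := opXm_pow_opXp_pow hf
    refine ⟨c⁻¹ • (opXp p q ^ m) f, Submodule.smul_mem _ _ (opXp_pow_mem_modPlus hf), ?_⟩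
    rw [map_smul, h, smul_smul, inv_mul_cancel₀ hc, one_smul]
  · rintro _ ⟨f, hf, rfl⟩
    exact opXm_pow_mem_modMinus hf

theorem isGKStable_map {N : Submodule ℂ (Smooth p q)} (hN : IsGKStable (piG p q) (piK p q) N)
    {A : Module.End ℂ (Smooth p q)} (h1 : ∀ Y, Commute (piG p q Y) A)
    (h2 : ∀ k, Commute (piK p q k) A) : IsGKStable (piG p q) (piK p q) (N.map A) := by
  constructor
  · rintro Y _ ⟨f, hf, rfl⟩
    exact ⟨_, hN.1 Y f hf, (congrArg (fun T : Module.End ℂ (Smooth p q) => T f) (h1 Y).eq).symm⟩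
  · rintro k _ ⟨f, hf, rfl⟩
    exact ⟨_, hN.2 k f hf, (congrArg (fun T : Module.End ℂ (Smooth p q) => T f) (h2 k).eq).symm⟩

theorem modPlus_stable (hp : 0 < p) (hq : 0 < q) (m : ℕ) :
    IsGKStable (piG p q) (piK p q) (modPlus p q m) := by
  rw [(modPlus_eq_and m).1, ← primP_eq hp hq]
  exact ⟨fun Y f hf => ⟨piG_mem_bigE Y hf.1, (primP_stable m).1 Y f hf.2⟩,
    fun k f hf => ⟨piK_mem_bigE k hf.1, (primP_stable m).2 k f hf.2⟩⟩

theorem modMinus_stable (hp : 0 < p) (hq : 0 < q) (m : ℕ) :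
    IsGKStable (piG p q) (piK p q) (modMinus p q m) := by
  rw [modMinus_eq_map]
  exact isGKStable_map (modPlus_stable hp hq m) (fun Y => (commute_piG_opXm Y).pow_right m)
    (fun k => (commute_piK_opXm k).pow_right m)

theorem modPlus_isGKModule (hp : 0 < p) (hq : 0 < q) (m : ℕ) :
    IsGKModule (piG p q) (piK p q) (modPlus p q m) := by
  refine isGKModule_of_le_bigE ?_ (modPlus_stable hp hq m)
  rw [(modPlus_eq_and m).1]
  exact inf_le_left.trans spaceE_le_bigE

theorem modMinus_isGKModule (hp : 0 < p) (hq : 0 < q) (m : ℕ) :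
    IsGKModule (piG p q) (piK p q) (modMinus p q m) := by
  refine isGKModule_of_le_bigE ?_ (modMinus_stable hp hq m)
  rw [(modMinus_eq_and m).1]
  exact inf_le_left.trans spaceE_le_bigE

/-! ### Linear maps out of direct sums -/

section DirectSums

variable {ι W : Type*} {U : ι → Type*} [∀ i, AddCommMonoid (U i)] [∀ i, Module ℂ (U i)]
  [AddCommGroup W] [Module ℂ W] [DecidableEq ι]

theorem toModule_of (φ : ∀ i, U i →ₗ[ℂ] W) (i : ι) (w : U i) :
    DirectSum.toModule ℂ ι W φ (DirectSum.of U i w) = φ i w := DirectSum.toModule_lof ℂ i w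

theorem range_toModule (φ : ∀ i, U i →ₗ[ℂ] W) :
    LinearMap.range (DirectSum.toModule ℂ ι W φ) = ⨆ i, LinearMap.range (φ i) := by
  apply le_antisymm
  · rintro _ ⟨x, rfl⟩
    induction x using DirectSum.induction_on with
    | zero => rw [map_zero]; exact zero_mem _
    | of i w =>
      rw [toModule_of]
      exact Submodule.mem_iSup_of_mem i ⟨w, rfl⟩
    | add x y hx hy => rw [map_add]; exact add_mem hx hy
  · refine iSup_le fun i => ?_
    rintro _ ⟨w, rfl⟩
    exact ⟨DirectSum.of U i w, toModule_of φ i w⟩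

/-- Independence is phrased through differences of images because the summands are only assumed to
be additive monoids. -/
theorem toModule_injective {φ : ∀ i, U i →ₗ[ℂ] W} (hφ : ∀ i, Function.Injective (φ i))
    (h : ∀ (s : Finset ι) (x y : ∀ i, U i), ∑ i ∈ s, (φ i (x i) - φ i (y i)) = 0 →
      ∀ i ∈ s, φ i (x i) - φ i (y i) = 0) :
    Function.Injective (DirectSum.toModule ℂ ι W φ) := by
  classical
  intro x y hxy
  have e : ∀ x : ⨁ i, U i, ∀ s : Finset ι, DFinsupp.support x ⊆ s →
      DirectSum.toModule ℂ ι W φ x = ∑ i ∈ s, φ i (x i) := by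
    intro x s hs
    conv_lhs => rw [← DirectSum.sum_support_of x, map_sum]
    rw [Finset.sum_congr rfl fun i _ => toModule_of φ i (x i)]
    refine Finset.sum_subset hs fun i _ hi => ?_
    rw [DFinsupp.notMem_support_iff.1 hi, map_zero]
  set s := DFinsupp.support x ∪ DFinsupp.support y with hs
  rw [e x s Finset.subset_union_left, e y s Finset.subset_union_right, ← sub_eq_zero,
    ← Finset.sum_sub_distrib] at hxy
  have h1 := h s x y hxy
  apply DFinsupp.ext
  intro i
  by_cases hi : i ∈ s
  · exact hφ i (sub_eq_zero.1 (h1 i hi))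
  · rw [hs, Finset.mem_union, not_or] at hi
    exact (DFinsupp.notMem_support_iff.1 hi.1).trans (DFinsupp.notMem_support_iff.1 hi.2).symm

theorem toModule_directSum {Γ : Type*} [Group Γ] (ρ : ∀ i, Representation ℂ Γ (U i))
    (σ : Representation ℂ Γ W) {φ : ∀ i, U i →ₗ[ℂ] W}
    (h : ∀ i g w, φ i (ρ i g w) = σ g (φ i w)) (g : Γ) (x : ⨁ i, U i) :
    DirectSum.toModule ℂ ι W φ (Representation.directSum ρ g x) =
      σ g (DirectSum.toModule ℂ ι W φ x) := by
  induction x using DirectSum.induction_on with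
  | zero => simp
  | of i w =>
    have h2 : Representation.directSum ρ g (DirectSum.of U i w) = DirectSum.of U i (ρ i g w) :=
      DirectSum.lmap_lof _ i w
    rw [toModule_of, h2, toModule_of, h]
  | add x y hx hy => simp only [map_add, hx, hy]

theorem injective_of_ker {M : Type*} [AddCommMonoid M] [Module ℂ M] {φ : M →ₗ[ℂ] W}
    (h : ∀ w, φ w = 0 → w = 0) : Function.Injective φ := by
  intro a b hab
  have h1 : a + (-1 : ℂ) • b = 0 := h _ (by rw [map_add, map_smul, hab]; module)
  have h2 : (-1 : ℂ) • b + b = 0 := by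
    conv_lhs => rw [← one_smul ℂ b, smul_smul, ← add_smul]
    simp
  rw [← zero_add b, ← h1, add_assoc, h2, add_zero]

end DirectSums

theorem isGKStable_bot : IsGKStable (piG p q) (piK p q) ⊥ := by
  constructor
  · intro Y f hf
    rw [Submodule.mem_bot] at hf ⊢
    rw [hf, map_zero]
  · intro k f hf
    rw [Submodule.mem_bot] at hf ⊢
    rw [hf, map_zero]

open Classical in
/-- The sum of the `K`-types, as functions. -/
def sumP (p q m : ℕ) :
    (⨁ i : KIndex p q m, Harm i.1.1 p ⊗[ℂ] Harm i.1.2 q) →ₗ[ℂ] Smooth p q :=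
  DirectSum.toModule ℂ _ _ fun i => vecP i

theorem range_sumP (hp : 0 < p) (hq : 0 < q) (m : ℕ) :
    LinearMap.range (sumP p q m) = modPlus p q m := by
  rw [(modPlus_eq_and m).1, sumP, range_toModule]
  apply le_antisymm
  · refine iSup_le fun i => ?_
    rintro _ ⟨w, rfl⟩
    exact vecP_mem hp hq i w
  · rw [← primP_eq hp hq]
    exact primP_le_iSup hp hq m

/-- Separation of K-types, applied to the stable subspace 0, makes each component of a vanishing sum
vanish. -/
theorem sumP_injective (hp : 0 < p) (hq : 0 < q) (m : ℕ) : Function.Injective (sumP p q m) := by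
  refine toModule_injective (fun i => injective_of_ker fun w hw => vecP_eq_zero hp hq i hw)
    fun s x y hxy i hi => (Submodule.mem_bot ℂ).1 ?_
  exact mem_of_sum_mem_of_isGKStable hp hq isGKStable_bot (t := fun i : KIndex p q m => i.1)
    Subtype.val_injective (fun i _ => sub_mem (piece_le_isoE _ _ (vecP_mem_piece i (x i)))
      (piece_le_isoE _ _ (vecP_mem_piece i (y i)))) ((Submodule.mem_bot ℂ).2 hxy) i hi

theorem sumP_kTypeSum (m : ℕ) (k : K p q)
    (x : ⨁ i : KIndex p q m, Harm i.1.1 p ⊗[ℂ] Harm i.1.2 q) :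
    sumP p q m (kTypeSum p q m k x) = piK p q k (sumP p q m x) :=
  toModule_directSum _ (piK p q) (fun i g w => (piK_vecP i g w).symm) k x

theorem modPlus_hasKTypeFormula (hp : 0 < p) (hq : 0 < q) (m : ℕ) :
    HasKTypeFormula p q m (modPlus p q m) := by
  rw [← range_sumP hp hq]
  exact ⟨LinearEquiv.ofInjective _ (sumP_injective hp hq m), fun k w => sumP_kTypeSum m k w⟩

theorem modMinus_hasKTypeFormula (hp : 0 < p) (hq : 0 < q) (m : ℕ) :
    HasKTypeFormula p q m (modMinus p q m) := by
  obtain ⟨e, he⟩ := modPlus_hasKTypeFormula hp hq m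
  let T : modPlus p q m →ₗ[ℂ] modMinus p q m :=
    (opXm p q ^ m).restrict fun _ hf => opXm_pow_mem_modMinus hf
  have hT : Function.Bijective T := by
    constructor
    · intro f g hfg
      obtain ⟨c, hc, h⟩ := opXp_pow_opXm_pow (sub_mem f.2 g.2)
      have h0 : (opXm p q ^ m) f.1 = (opXm p q ^ m) g.1 := congrArg Subtype.val hfg
      rw [map_sub, h0, sub_self, map_zero] at h
      exact Subtype.ext (sub_eq_zero.1 ((smul_eq_zero.1 h.symm).resolve_left hc))
    · rintro ⟨f, hf⟩
      rw [modMinus_eq_map] at hf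
      obtain ⟨f', hf', rfl⟩ := hf
      exact ⟨⟨f', hf'⟩, rfl⟩
  refine ⟨e.trans (LinearEquiv.ofBijective T hT), fun k w => ?_⟩
  change (opXm p q ^ m) (e (kTypeSum p q m k w)).1 = piK p q k ((opXm p q ^ m) (e w).1)
  rw [he]
  exact (congrArg (fun A : Module.End ℂ (Smooth p q) => A (e w).1)
    ((commute_piK_opXm k).pow_right m).eq).symm

end Modules

/-! ### Multiplication of harmonic polynomials by coordinates -/

section HarmSteps

open MvPolynomial

variable {n : ℕ}

/-- `x_i h = h⁺ + ρ g` and `∂_i h = (k + n/2 - 1) g` with `h`, `h⁺`, `g` harmonic of degrees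
`k`, `k + 1`, `k - 1`. -/
structure HarmStep (k : ℕ) (i : Fin n) (h hplus g : MvPolynomial (Fin n) ℂ) : Prop where
  mem : h ∈ Harm k n
  plus_mem : hplus ∈ Harm (k + 1) n
  minus_mem : g ∈ Harm (k - 1) n
  X_mul : X i * h = hplus + ((1 / 2 : ℂ) • sqNorm n) * g
  pderiv_eq : pderiv i h = ((k : ℂ) + (n : ℂ) / 2 - 1) • g

theorem polyLaplacian_eq_lapS (f : MvPolynomial (Fin n) ℂ) :
    polyLaplacian n f = lapS Finset.univ f := by
  rw [polyLaplacian_apply, lapS_apply]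

theorem half_sqNorm : (1 / 2 : ℂ) • sqNorm n = rhoS Finset.univ := rfl

theorem polyLaplacian_X_mul (i : Fin n) (f : MvPolynomial (Fin n) ℂ) :
    polyLaplacian n (X i * f) = X i * polyLaplacian n f + (2 : ℂ) • pderiv i f := by
  rw [polyLaplacian_apply, polyLaplacian_apply, Finset.mul_sum]
  have h : ∀ j, pderiv j (pderiv j (X i * f)) = X i * pderiv j (pderiv j f) +
      if j = i then (2 : ℂ) • pderiv i f else 0 := by
    intro j
    simp only [Derivation.leibniz, smul_eq_mul, map_add, pderiv_X, Pi.single_apply]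
    by_cases hj : j = i
    · subst hj
      simp [two_smul]
      ring
    · simp [hj, Ne.symm hj]
  simp only [h, Finset.sum_add_distrib, Finset.sum_ite_eq', Finset.mem_univ, if_true]

theorem pderiv_mem_Harm {k : ℕ} {h : MvPolynomial (Fin n) ℂ} (hh : h ∈ Harm k n) (i : Fin n) :
    pderiv i h ∈ Harm (k - 1) n := by
  rw [mem_Harm] at hh ⊢
  refine ⟨hh.1.pderiv, ?_⟩
  have h1 := congrArg (pderiv i) hh.2
  rw [polyLaplacian_apply, map_sum, map_zero] at h1
  rw [polyLaplacian_apply, ← h1]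
  refine Finset.sum_congr rfl fun j _ => ?_
  rw [pderiv_comm j i h, pderiv_comm j i]

/-- With g = ∂_i h / (k + n/2 - 1) the Laplacian of ρ g is 2 ∂_i h, which is also the Laplacian of
x_i h. Degree zero is separate: there the derivative vanishes, and so does the denominator when n =
2. -/
theorem exists_harmStep (hn : 2 ≤ n) {k : ℕ} {h : MvPolynomial (Fin n) ℂ} (hh : h ∈ Harm k n)
    (i : Fin n) : ∃ hplus g, HarmStep k i h hplus g := by
  rcases k with _ | k
  · have h0 : pderiv i h = 0 := by
      rw [isHomogeneous_zero_eq_C (mem_Harm.1 hh).1, pderiv_C]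
    refine ⟨X i * h, 0, hh, ?_, zero_mem _, by simp, by rw [h0, smul_zero]⟩
    rw [mem_Harm]
    refine ⟨?_, ?_⟩
    · have := (isHomogeneous_X ℂ i).mul (mem_Harm.1 hh).1
      rwa [add_comm] at this
    · rw [polyLaplacian_X_mul, (mem_Harm.1 hh).2, h0, mul_zero, smul_zero, add_zero]
  · set c : ℂ := ((k + 1 : ℕ) : ℂ) + (n : ℂ) / 2 - 1 with hc
    have hck : c = (k : ℂ) + (n : ℂ) / 2 := by rw [hc]; push_cast; ring
    have hc0 : c ≠ 0 := by
      rw [hck]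
      exact (goodParam_kappa k (by omega)).ne_zero
    set g := c⁻¹ • pderiv i h with hg
    have hgm : g ∈ Harm k n := Submodule.smul_mem _ _ (pderiv_mem_Harm hh i)
    refine ⟨X i * h - ((1 / 2 : ℂ) • sqNorm n) * g, g, hh, ?_, hgm, by ring, ?_⟩
    · rw [mem_Harm]
      refine ⟨?_, ?_⟩
      · have h1 := (isHomogeneous_X ℂ i).mul (mem_Harm.1 hh).1
        have hsq : ((1 / 2 : ℂ) • sqNorm n).IsHomogeneous 2 := by
          rw [smul_eq_C_mul]
          have : (sqNorm n).IsHomogeneous 2 :=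
            IsHomogeneous.sum _ _ _ fun i _ => by simpa using (isHomogeneous_X ℂ i).pow 2
          simpa using (isHomogeneous_C _ _).mul this
        have h2 := hsq.mul (mem_Harm.1 hgm).1
        rw [show 1 + (k + 1) = k + 1 + 1 by ring] at h1
        rw [show 2 + k = k + 1 + 1 by ring] at h2
        exact h1.sub h2
      · have he : eulS Finset.univ g = (k : ℂ) • g := by
          rw [eulS_apply, (mem_Harm.1 hgm).1.sum_X_mul_pderiv, Nat.cast_smul_eq_nsmul]
        have hl : lapS Finset.univ g = 0 := by
          rw [← polyLaplacian_eq_lapS]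
          exact (mem_Harm.1 hgm).2
        have h1 := lapS_mul_rhoS_pow he hl 0
        rw [zero_add, pow_one, pow_zero, mul_one, Finset.card_univ, Fintype.card_fin] at h1
        rw [map_sub, polyLaplacian_X_mul, (mem_Harm.1 hh).2, mul_zero, zero_add, half_sqNorm,
          mul_comm, polyLaplacian_eq_lapS, h1, hg, smul_smul, sub_eq_zero]
        congr 1
        have e : (2 : ℂ) * (((0 : ℕ) : ℂ) + 1) * ((k : ℂ) + (n : ℂ) / 2 + ((0 : ℕ) : ℂ)) =
            2 * c := by
          rw [hck]
          push_cast
          ring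
        rw [e, mul_assoc, mul_inv_cancel₀ hc0, mul_one]
    · rw [hg, smul_smul, mul_inv_cancel₀ hc0, one_smul]

/-- Powers of the isotropic linear form x₀ + √-1 x₁ are harmonic; this needs two variables. -/
theorem exists_harm_ne_zero (hn : 2 ≤ n) (k : ℕ) : ∃ h ∈ Harm k n, h ≠ 0 := by
  let i₀ : Fin n := ⟨0, by omega⟩
  let i₁ : Fin n := ⟨1, by omega⟩
  have h01 : i₁ ≠ i₀ := by simp [i₀, i₁]
  set f : MvPolynomial (Fin n) ℂ := X i₀ + C Complex.I * X i₁ with hf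
  set c : Fin n → ℂ := Pi.single i₀ 1 + Pi.single i₁ Complex.I with hc
  have hd : ∀ i, pderiv i f = C (c i) := by
    intro i
    rw [hf, hc, map_add, Derivation.leibniz, pderiv_X, pderiv_X]
    simp only [Pi.single_apply, Pi.add_apply, pderiv_C, smul_eq_mul,
      eq_comm (a := i)]
    split_ifs <;> simp
  have hcc : ∑ i, c i ^ 2 = 0 := by
    have : ∀ i, c i ^ 2 = (if i = i₀ then 1 else 0) + (if i = i₁ then -1 else 0) := by
      intro i
      simp only [hc, Pi.add_apply, Pi.single_apply]
      by_cases h0 : i = i₀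
      · have : i ≠ i₁ := by rw [h0]; exact h01.symm
        simp [h0, h01.symm]
      · by_cases h1 : i = i₁
        · simp [h1, h01]
        · simp [h0, h1]
    simp [this, Finset.sum_add_distrib]
  refine ⟨f ^ k, mem_Harm.2 ⟨?_, ?_⟩, ?_⟩
  · have : f.IsHomogeneous 1 := by
      refine (isHomogeneous_X ℂ i₀).add ?_
      simpa using (isHomogeneous_C (Fin n) Complex.I).mul (isHomogeneous_X ℂ i₁)
    simpa using this.pow k
  · rw [polyLaplacian_apply]
    have : ∀ i, pderiv i (pderiv i (f ^ k)) =
        (k : MvPolynomial (Fin n) ℂ) * (((k - 1 : ℕ) : MvPolynomial (Fin n) ℂ) * f ^ (k - 1 - 1)) * C (c i ^ 2) := by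
      intro i
      rw [Derivation.leibniz_pow, hd, nsmul_eq_mul, smul_eq_mul, Derivation.leibniz,
        Derivation.leibniz, Derivation.leibniz_pow, hd]
      simp only [Derivation.map_natCast, pderiv_C, smul_eq_mul,
        nsmul_eq_mul, map_pow]
      ring
    simp only [this]
    rw [← Finset.mul_sum, ← map_sum, hcc, map_zero, mul_zero]
  · apply pow_ne_zero
    intro h
    have := congrArg (evalR (Pi.single i₀ 1)) h
    rw [hf, map_add, map_mul, evalR_X, evalR_X, map_zero, Pi.single_eq_same,
      Pi.single_eq_of_ne h01] at this
    simp at this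

theorem sqNorm_mul_eq_zero_of_mem_Harm {k : ℕ} {v : MvPolynomial (Fin n) ℂ} (h : sqNorm n * v ∈ Harm k n) :
    sqNorm n * v = 0 := by
  apply fischer_self_eq_zero
  rw [fischer_sqNorm_mul, (mem_Harm.1 h).2, map_zero]

/-- Apply the steps to the derivatives of a harmonic u of degree k + 1. If all upper components
vanished, Euler's identity ∑ x_i ∂_i u = (k+1) u would make u divisible by |x|², hence zero. -/
theorem exists_harmStep_plus_ne_zero (hn : 2 ≤ n) (k : ℕ) :
    ∃ i h hplus g, HarmStep (n := n) k i h hplus g ∧ hplus ≠ 0 := by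
  obtain ⟨u, hu, hu0⟩ := exists_harm_ne_zero hn (k + 1)
  by_contra! hcon
  choose hp g hstep using fun i => exists_harmStep hn (pderiv_mem_Harm hu i) i
  have hE := (mem_Harm.1 hu).1.sum_X_mul_pderiv
  have h1 : ∀ i, X i * pderiv i u = sqNorm n * ((1 / 2 : ℂ) • g i) := by
    intro i
    rw [(hstep i).X_mul, hcon i _ _ _ (hstep i), zero_add, smul_mul_assoc, mul_smul_comm]
  simp only [h1] at hE
  rw [← Finset.mul_sum] at hE
  have h2 := sqNorm_mul_eq_zero_of_mem_Harm (k := k + 1) (by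
    rw [hE]
    exact nsmul_mem hu _)
  rw [h2, ← Nat.cast_smul_eq_nsmul ℂ] at hE
  exact smul_ne_zero (by exact_mod_cast Nat.succ_ne_zero k) hu0 hE.symm

/-- If all lower components vanished, all derivatives of u would vanish, and so would u by Euler's
identity. -/
theorem exists_harmStep_minus_ne_zero (hn : 2 ≤ n) (k : ℕ) :
    ∃ i h hplus g, HarmStep (n := n) (k + 1) i h hplus g ∧ g ≠ 0 := by
  obtain ⟨u, hu, hu0⟩ := exists_harm_ne_zero hn (k + 1)
  by_contra! hcon
  have hE := (mem_Harm.1 hu).1.sum_X_mul_pderiv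
  have h1 : ∀ i, pderiv i u = 0 := by
    intro i
    obtain ⟨hp, g, hs⟩ := exists_harmStep hn hu i
    rw [hs.pderiv_eq, hcon i _ _ _ hs, smul_zero]
  simp only [h1, mul_zero, Finset.sum_const_zero] at hE
  rw [← Nat.cast_smul_eq_nsmul ℂ] at hE
  exact smul_ne_zero (by exact_mod_cast Nat.succ_ne_zero k) hu0 hE.symm

end HarmSteps

/-! ### The noncompact part of `𝔤` -/

section Boosts

open MvPolynomial

variable {p q : ℕ}

theorem besselOp_apply (κ : ℂ) (χ : Ent) (z : ℂ) :
    (besselOp κ χ).1 z = z * (entD (entD χ)).1 z + κ * (entD χ).1 z + χ.1 z := rfl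

theorem entZ_mul_apply (χ : Ent) (z : ℂ) : (entZ * χ).1 z = z * χ.1 z := rfl

theorem boost_mem (i : Fin p) (j : Fin q) :
    Matrix.single (Sum.inl i) (Sum.inr j) (1 : ℂ) + Matrix.single (Sum.inr j) (Sum.inl i) 1 ∈
      LieAlgebra.Orthogonal.so' (Fin p) (Fin q) ℂ := by
  rw [mem_𝔤_iff]
  have e : Matrix.single (Sum.inl i) (Sum.inr j) (1 : ℂ) + Matrix.single (Sum.inr j) (Sum.inl i) 1 =
      Matrix.fromBlocks 0 (Matrix.single i j 1) (Matrix.single j i 1) 0 := by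
    ext (a | a) (b | b) <;> simp [Matrix.single_apply]
  rw [e, Matrix.fromBlocks_transpose, Matrix.fromBlocks_neg, Matrix.fromBlocks_multiply,
    Matrix.fromBlocks_multiply]
  simp [Matrix.transpose_single]

/-- The matrix `E_{i,p+j} + E_{p+j,i}`. -/
def boost (i : Fin p) (j : Fin q) : 𝔤 p q := ⟨_, boost_mem i j⟩

theorem piG_boost (i : Fin p) (j : Fin q) (f : Smooth p q) :
    piG p q (boost i j) f = Complex.I •
      (polyMul (X (Sum.inl i)) (polyMul (X (Sum.inr j)) f) +
        dd (Sum.inl i) (dd (Sum.inr j) f)) := by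
  have h1 : ∀ a b, (boost i j : 𝔤 p q).1 (Sum.inl a) (Sum.inl b) = 0 := fun a b => by
    simp [boost]
  have h2 : ∀ a b, (boost i j : 𝔤 p q).1 (Sum.inr a) (Sum.inr b) = 0 := fun a b => by
    simp [boost]
  have h3 : ∀ a b, (boost i j : 𝔤 p q).1 (Sum.inl a) (Sum.inr b) =
      if i = a ∧ j = b then 1 else 0 := fun a b => by
    simp [boost, Matrix.single_apply]
  rw [piG_apply]
  simp only [h1, h2, h3, zero_smul, Finset.sum_const_zero, zero_add]
  rw [Finset.sum_eq_single i, Finset.sum_eq_single j]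
  · simp
  · intro b _ hb
    simp [hb.symm]
  · simp
  · intro a _ ha
    simp [ha.symm]
  · simp

theorem dd_dd_G (i : Fin p) (j : Fin q) (P : Pol p q) (χ : Ent) :
    dd (Sum.inl i) (dd (Sum.inr j) (G P χ)) =
      G (pderiv (Sum.inl i) (pderiv (Sum.inr j) P)) χ +
      G (pderiv (Sum.inr j) P * (X (Sum.inl i) * rY p q) +
        (pderiv (Sum.inl i) P * (X (Sum.inr j) * rX p q) +
          P * (X (Sum.inl i) * X (Sum.inr j)))) (entD χ) +
      G (P * (X (Sum.inr j) * rX p q) * (X (Sum.inl i) * rY p q)) (entD (entD χ)) := by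
  have hi : (Sum.inl i : Fin p ⊕ Fin q) ∈ bX p q := by simp [bX]
  have hj : (Sum.inr j : Fin p ⊕ Fin q) ∈ bY p q := by simp [bY]
  have e : pderiv (Sum.inl i) (P * (X (Sum.inr j) * rX p q)) =
      pderiv (Sum.inl i) P * (X (Sum.inr j) * rX p q) +
        P * (X (Sum.inl i) * X (Sum.inr j)) := by
    rw [Derivation.leibniz, Derivation.leibniz, pderiv_rhoS, if_pos hi,
      pderiv_X_of_ne Sum.inr_ne_inl]
    simp only [smul_eq_mul]
    ring
  rw [dd_G, map_add, dd_G, dd_G, pderiv_rho_of_mem_bY hj, pderiv_rho_of_mem_bX hi, e,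
    map_add G (pderiv (Sum.inr j) P * _), LinearMap.add_apply]
  abel

theorem pderiv_inr_mul_rY_pow (j : Fin q) (P : Pol p q) (d : ℕ) :
    pderiv (Sum.inr j) (P * rY p q ^ d) =
      pderiv (Sum.inr j) P * rY p q ^ d + P * ((d : Pol p q) * rY p q ^ (d - 1) * X (Sum.inr j)) := by
  have hj : (Sum.inr j : Fin p ⊕ Fin q) ∈ bY p q := by simp [bY]
  rw [Derivation.leibniz, Derivation.leibniz_pow, pderiv_rhoS, if_pos hj]
  simp only [smul_eq_mul, nsmul_eq_mul]
  ring

theorem pderiv_inl_mul_of_rY (i : Fin p) (P : Pol p q) (d : ℕ) :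
    pderiv (Sum.inl i) (P * rY p q ^ d) = pderiv (Sum.inl i) P * rY p q ^ d := by
  have hi : (Sum.inl i : Fin p ⊕ Fin q) ∈ bX p q := by simp [bX]
  rw [Derivation.leibniz, pderiv_rhoS_pow_of_disjoint disjoint_bX_bY d hi, smul_zero, zero_add,
    smul_eq_mul, mul_comm]

/-- The action of a noncompact element of `𝔤`, decomposed into `K`-types. -/
theorem piG_boost_G {k l : ℕ} {i : Fin p} {j : Fin q} {h₁ a₁ g₁ : MvPolynomial (Fin p) ℂ}
    {h₂ a₂ g₂ : MvPolynomial (Fin q) ℂ} (H₁ : HarmStep k i h₁ a₁ g₁) (H₂ : HarmStep l j h₂ a₂ g₂)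
    {κ κ' : ℂ} (hκ : κ = (k : ℂ) + (p : ℂ) / 2) (hκ' : κ' = (l : ℂ) + (q : ℂ) / 2)
    (d : ℕ) (χ : Ent) :
    piG p q (boost i j) (G (rename Sum.inl h₁ * rename Sum.inr h₂ * rY p q ^ d) χ) = Complex.I •
      (G (rename Sum.inl a₁ * rename Sum.inr a₂ * (rX p q ^ 0 * rY p q ^ d))
          (besselOp (d + 1) χ) +
        G (rename Sum.inl a₁ * rename Sum.inr g₂ * (rX p q ^ 0 * rY p q ^ (d + 1)))
          (besselOp (κ' + d) χ) +
        (G (rename Sum.inl g₁ * rename Sum.inr a₂ * (rX p q ^ 0 * rY p q ^ (d - 1)))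
            ((d * (κ - 1)) • χ) +
          G (rename Sum.inl g₁ * rename Sum.inr a₂ * (rX p q ^ 1 * rY p q ^ d))
            (besselOp (κ + d) χ)) +
        G (rename Sum.inl g₁ * rename Sum.inr g₂ * (rX p q ^ 0 * rY p q ^ d))
          (((κ - 1) * (κ' - 1 + d)) • χ + entZ * besselOp (κ + κ' + d - 1) χ)) := by
  have x₁ : X (Sum.inl i) * rename Sum.inl h₁ = rename Sum.inl a₁ + rX p q * rename Sum.inl g₁ := by
    have := congrArg (rename (R := ℂ) (Sum.inl : Fin p → Fin p ⊕ Fin q)) H₁.X_mul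
    rwa [map_mul, rename_X, map_add, map_mul, map_smul, rename_sqNorm_inl, smul_smul,
      show (1 / 2 : ℂ) * 2 = 1 by norm_num, one_smul] at this
  have x₂ : X (Sum.inr j) * rename Sum.inr h₂ = rename Sum.inr a₂ + rY p q * rename Sum.inr g₂ := by
    have := congrArg (rename (R := ℂ) (Sum.inr : Fin q → Fin p ⊕ Fin q)) H₂.X_mul
    rwa [map_mul, rename_X, map_add, map_mul, map_smul, rename_sqNorm_inr, smul_smul,
      show (1 / 2 : ℂ) * 2 = 1 by norm_num, one_smul] at this
  have e₂ : pderiv (Sum.inr j) (rename Sum.inl h₁ * rename Sum.inr h₂ * rY p q ^ d) =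
      (κ' - 1) • (rename Sum.inl h₁ * rename Sum.inr g₂ * rY p q ^ d) +
        rename Sum.inl h₁ * rename Sum.inr h₂ *
          ((d : Pol p q) * rY p q ^ (d - 1) * X (Sum.inr j)) := by
    rw [pderiv_inr_mul_rY_pow, pderiv_inr_mul, H₂.pderiv_eq, map_smul, mul_smul_comm,
      smul_mul_assoc, hκ']
  have e₁ : pderiv (Sum.inl i) (rename Sum.inl h₁ * rename Sum.inr h₂ * rY p q ^ d) =
      (κ - 1) • (rename Sum.inl g₁ * rename Sum.inr h₂ * rY p q ^ d) := by
    rw [pderiv_inl_mul_of_rY, pderiv_inl_mul, H₁.pderiv_eq, map_smul, smul_mul_assoc,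
      smul_mul_assoc, hκ]
  have e₁₂ : pderiv (Sum.inl i) (pderiv (Sum.inr j)
        (rename Sum.inl h₁ * rename Sum.inr h₂ * rY p q ^ d)) =
      (κ' - 1) • (κ - 1) • (rename Sum.inl g₁ * rename Sum.inr g₂ * rY p q ^ d) +
        (κ - 1) • (rename Sum.inl g₁ * rename Sum.inr h₂ *
          ((d : Pol p q) * rY p q ^ (d - 1) * X (Sum.inr j))) := by
    have e : rename Sum.inl h₁ * rename Sum.inr h₂ *
        ((d : Pol p q) * rY p q ^ (d - 1) * X (Sum.inr j)) =
        (d : ℕ) • (rename Sum.inl h₁ * rename Sum.inr (h₂ * X j) * rY p q ^ (d - 1)) := by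
      rw [map_mul, rename_X, nsmul_eq_mul]
      ring
    rw [e₂, map_add, Derivation.map_smul, e, map_nsmul, pderiv_inl_mul_of_rY,
      pderiv_inl_mul_of_rY, pderiv_inl_mul, pderiv_inl_mul, H₁.pderiv_eq, map_smul, ← hκ,
      map_mul, rename_X, nsmul_eq_mul]
    simp only [smul_mul_assoc, mul_smul_comm]
    congr 2
    ring
  rw [piG_boost, dd_dd_G, e₁₂, e₁, e₂, polyMul_G, polyMul_G]
  congr 1
  refine smooth_ext fun v => ?_
  have y₁ := congrArg (evalV v) x₁
  have y₂ := congrArg (evalV v) x₂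
  -- The truncated exponent d - 1 is harmless at d = 0 because of the factor d. This relation and
  -- the two splittings of x_i h₁ and y_j h₂ reduce the claim to a ring identity in the values at v.
  have hS : (d : ℂ) * evalV v (rY p q) ^ (d - 1) * evalV v (rY p q) =
      d * evalV v (rY p q) ^ d := by
    rcases d with _ | d
    · simp
    · rw [Nat.add_sub_cancel, mul_assoc, ← pow_succ]
  simp only [map_mul, map_add] at y₁ y₂
  simp only [map_add, LinearMap.add_apply, map_smul, LinearMap.smul_apply, Submodule.coe_add,
    SetLike.val_smul, Pi.add_apply, Pi.smul_apply, smul_eq_mul, G_apply, map_mul, map_pow,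
    map_natCast, pow_zero, one_mul, pow_one, besselOp_apply, entZ_mul_apply]
  rw [pow_succ]
  generalize χ.1 (evalV v (rX p q) * evalV v (rY p q)) = c₀
  generalize (entD χ).1 (evalV v (rX p q) * evalV v (rY p q)) = c₁
  generalize (entD (entD χ)).1 (evalV v (rX p q) * evalV v (rY p q)) = c₂
  generalize evalV v (rX p q) = r at y₁ ⊢
  generalize evalV v (rY p q) ^ (d - 1) = t at hS ⊢
  generalize evalV v (rY p q) ^ d = w at hS ⊢
  generalize evalV v (rY p q) = s at hS y₂ ⊢
  generalize evalV v (rename Sum.inl h₁) = b₁ at y₁ ⊢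
  generalize evalV v (rename Sum.inr h₂) = b₂ at y₂ ⊢
  generalize evalV v (X (Sum.inl i)) = x at y₁ ⊢
  generalize evalV v (X (Sum.inr j)) = y at y₂ ⊢
  generalize evalV v (rename Sum.inl a₁) = a₁' at y₁ ⊢
  generalize evalV v (rename Sum.inr a₂) = a₂' at y₂ ⊢
  generalize evalV v (rename Sum.inl g₁) = g₁' at y₁ ⊢
  generalize evalV v (rename Sum.inr g₂) = g₂' at y₂ ⊢
  linear_combination ((w * c₀ + d * t * s * c₁ + w * c₁ + w * r * s * c₂) * (y * b₂) +
      (κ' - 1) * g₂' * w * s * c₁) * y₁ +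
    ((w * c₀ + d * t * s * c₁ + w * c₁ + w * r * s * c₂) * (a₁' + r * g₁') +
      (κ - 1) * g₁' * (d * t * c₀ + r * w * c₁)) * y₂ +
    ((a₁' + r * g₁') * (a₂' + s * g₂') * c₁ + (κ - 1) * g₁' * g₂' * c₀) * hS

end Boosts

/-! ### Irreducibility -/

section Irreducible

open MvPolynomial

variable {p q m : ℕ} {N : Submodule ℂ (Smooth p q)}

theorem G_mem_isoE {k l : ℕ} {P : Pol p q} (hP : P ∈ HH p q k l) (a b : ℕ) (χ : Ent) :
    G (P * (rX p q ^ a * rY p q ^ b)) χ ∈ isoE p q (k, l) :=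
  fun n => sepOp_G hP a b χ n

theorem modPlus_eq_iSup (hp : 0 < p) (hq : 0 < q) (m : ℕ) :
    modPlus p q m = ⨆ i : KIndex p q m, LinearMap.range (vecP i) := by
  rw [← range_sumP hp hq, sumP, range_toModule]

theorem exists_sum_vecP (hp : 0 < p) (hq : 0 < q) {f : Smooth p q} (hf : f ∈ modPlus p q m) :
    ∃ (s : Finset (KIndex p q m)) (x : ∀ i : KIndex p q m, Harm i.1.1 p ⊗[ℂ] Harm i.1.2 q),
      ∑ i ∈ s, vecP i (x i) = f := by
  rw [modPlus_eq_iSup hp hq, Submodule.mem_iSup_iff_exists_finsupp] at hf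
  obtain ⟨g, hg, rfl⟩ := hf
  choose x hx using hg
  exact ⟨g.support, x, Finset.sum_congr rfl fun i _ => hx i⟩

theorem vecP_mem_isoE (i : KIndex p q m) (w : Harm i.1.1 p ⊗[ℂ] Harm i.1.2 q) :
    vecP i w ∈ isoE p q i.1 :=
  piece_le_isoE _ _ (vecP_mem_piece i w)

theorem range_vecP_le (hp : 0 < p) (hq : 0 < q) (hN : IsGKStable (piG p q) (piK p q) N)
    (i : KIndex p q m) {w : Harm i.1.1 p ⊗[ℂ] Harm i.1.2 q} (hw : vecP i w ∈ N)
    (h0 : vecP i w ≠ 0) : LinearMap.range (vecP i) ≤ N := by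
  rcases kType_eq_bot_or_eq_top hp hq (N.comap (vecP i)) (fun g w hw => by
    rw [Submodule.mem_comap] at hw ⊢
    rw [← piK_vecP]
    exact hN.2 g _ hw) with h | h
  · have hw' : w ∈ N.comap (vecP i) := hw
    rw [h, Submodule.mem_bot] at hw'
    exact absurd (by rw [hw', map_zero]) h0
  · rintro _ ⟨u, rfl⟩
    have hu : u ∈ N.comap (vecP i) := by rw [h]; exact Submodule.mem_top
    exact hu

theorem exists_eq_vecP (hp : 0 < p) (hq : 0 < q) {f : Smooth p q} (hf : f ∈ modPlus p q m)
    (h0 : f ≠ 0) {t : ℕ × ℕ} (ht : f ∈ isoE p q t) :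
    ∃ i : KIndex p q m, i.1 = t ∧ ∃ w, vecP i w = f := by
  obtain ⟨s, x, rfl⟩ := exists_sum_vecP hp hq hf
  have hz : ∀ i ∈ s, i.1 ≠ t → vecP i (x i) = 0 := by
    intro i hi hit
    obtain ⟨n, hn⟩ := exists_sepVal_ne hp hq hit
    have h1 : ∑ i ∈ s, (sepVal p q n i.1 - sepVal p q n t) • vecP i (x i) = 0 := by
      have h2 := ht n
      rw [map_sum, Finset.smul_sum, ← sub_eq_zero, ← Finset.sum_sub_distrib] at h2
      rw [← h2]
      refine Finset.sum_congr rfl fun i _ => ?_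
      rw [vecP_mem_isoE i (x i) n]
      module
    have h3 := mem_of_sum_mem_of_isGKStable hp hq isGKStable_bot
      (t := fun i : KIndex p q m => i.1) Subtype.val_injective
      (fun i _ => Submodule.smul_mem _ _ (vecP_mem_isoE i (x i))) ((Submodule.mem_bot ℂ).2 h1) i hi
    rw [Submodule.mem_bot] at h3
    exact (smul_eq_zero.1 h3).resolve_left (sub_ne_zero.2 hn)
  obtain ⟨i, hi, hi0⟩ := Finset.exists_ne_zero_of_sum_ne_zero h0
  have hit : i.1 = t := by
    by_contra h
    exact hi0 (hz i hi h)
  refine ⟨i, hit, x i, (Finset.sum_eq_single_of_mem i hi fun j hj hji => hz j hj fun h => ?_).symm⟩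
  exact hji (Subtype.ext (h.trans hit.symm))

/-- The `K`-type `(k, l)` of `M⁺_m` is contained in `N`; here `4 d + 2 l + q = 2 m + 2 k + p`. -/
def Full (N : Submodule ℂ (Smooth p q)) (k l d : ℕ) : Prop :=
  ∀ P ∈ HH p q k l, G (P * rY p q ^ d) (psiE ((k : ℂ) + (p : ℂ) / 2)) ∈ N

theorem dIdx_spec_nat (i : KIndex p q m) :
    4 * dIdx i + 2 * i.1.2 + q = 2 * m + 2 * i.1.1 + p := by
  have h := dIdx_spec i
  have h1 : ((4 * dIdx i + 2 * i.1.2 + q : ℕ) : ℚ) = ((2 * m + 2 * i.1.1 + p : ℕ) : ℚ) := by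
    push_cast
    linarith
  exact_mod_cast h1

theorem full_dIdx_iff (i : KIndex p q m) :
    Full N i.1.1 i.1.2 (dIdx i) ↔ LinearMap.range (vecP i) ≤ N := by
  constructor
  · rintro h _ ⟨w, rfl⟩
    exact h _ (theta_mem_HH w)
  · rintro h _ ⟨w, rfl⟩
    exact h ⟨w, rfl⟩

/-- The type (k, l) occurs once and is irreducible, so one nonzero vector of that type brings in all
of it; the weight equation identifies d. -/
theorem full_of_mem (hp : 0 < p) (hq : 0 < q) (hN : IsGKStable (piG p q) (piK p q) N)
    (hle : N ≤ modPlus p q m) {k l d : ℕ} (hd : 4 * d + 2 * l + q = 2 * m + 2 * k + p)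
    {f : Smooth p q} (hf : f ∈ N) (h0 : f ≠ 0) (ht : f ∈ isoE p q (k, l)) : Full N k l d := by
  obtain ⟨i, hi, w, rfl⟩ := exists_eq_vecP hp hq (hle hf) h0 ht
  have h1 := (full_dIdx_iff i).2 (range_vecP_le hp hq hN i hf h0)
  have h2 := dIdx_spec_nat i
  rw [hi] at h1 h2
  have h3 : dIdx i = d := by
    change 4 * dIdx i + 2 * l + q = 2 * m + 2 * k + p at h2
    omega
  rwa [h3] at h1

theorem G_ne_zero (hp : 0 < p) (hq : 0 < q) {k l : ℕ} {P : Pol p q} (hP : P ∈ HH p q k l)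
    (h0 : P ≠ 0) (d : ℕ) {χ : Ent} (hχ : χ.1 0 ≠ 0) : G (P * rY p q ^ d) χ ≠ 0 := fun h => by
  rw [eq_zero_of_G_eq_zero hp hq hP h0 d h] at hχ
  exact hχ rfl

theorem rename_mul_rename_ne_zero {f : MvPolynomial (Fin p) ℂ} {g : MvPolynomial (Fin q) ℂ}
    (hf : f ≠ 0) (hg : g ≠ 0) : (rename Sum.inl f * rename Sum.inr g : Pol p q) ≠ 0 :=
  mul_ne_zero ((map_ne_zero_iff _ (rename_injective _ Sum.inl_injective)).2 hf)
    ((map_ne_zero_iff _ (rename_injective _ Sum.inr_injective)).2 hg)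

theorem besselOp_psiE_apply_zero {α : ℂ} (hα : GoodParam α) (β : ℂ) :
    (besselOp β (psiE α)).1 0 = -((β - α) / α) := by
  rw [besselOp_psiE_of_ne hα]
  change -((β - α) / α) * (psiE (α + 1)).1 0 = _
  rw [psiE_zero hα.add_one, mul_one]

/-- The four components have distinct K-types, even when truncated subtraction replaces -1 by 0, so
each lies in the stable subspace separately. The two terms of type (k-1, l+1) stay together. -/
theorem boost_components_mem (hp : 0 < p) (hq : 0 < q) (hN : IsGKStable (piG p q) (piK p q) N)
    {k l d : ℕ} {i : Fin p} {j : Fin q} {h₁ a₁ g₁ : MvPolynomial (Fin p) ℂ}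
    {h₂ a₂ g₂ : MvPolynomial (Fin q) ℂ} (H₁ : HarmStep k i h₁ a₁ g₁) (H₂ : HarmStep l j h₂ a₂ g₂)
    {κ κ' : ℂ} (hκ : κ = (k : ℂ) + (p : ℂ) / 2) (hκ' : κ' = (l : ℂ) + (q : ℂ) / 2) {χ : Ent}
    (h : G (rename Sum.inl h₁ * rename Sum.inr h₂ * rY p q ^ d) χ ∈ N) :
    G (rename Sum.inl a₁ * rename Sum.inr a₂ * (rX p q ^ 0 * rY p q ^ d))
        (besselOp (d + 1) χ) ∈ N ∧
      G (rename Sum.inl a₁ * rename Sum.inr g₂ * (rX p q ^ 0 * rY p q ^ (d + 1)))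
        (besselOp (κ' + d) χ) ∈ N ∧
      G (rename Sum.inl g₁ * rename Sum.inr a₂ * (rX p q ^ 0 * rY p q ^ (d - 1)))
          ((d * (κ - 1)) • χ) +
        G (rename Sum.inl g₁ * rename Sum.inr a₂ * (rX p q ^ 1 * rY p q ^ d))
          (besselOp (κ + d) χ) ∈ N ∧
      G (rename Sum.inl g₁ * rename Sum.inr g₂ * (rX p q ^ 0 * rY p q ^ d))
        (((κ - 1) * (κ' - 1 + d)) • χ + entZ * besselOp (κ + κ' + d - 1) χ) ∈ N := by
  have h1 := hN.1 (boost i j) _ h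
  rw [piG_boost_G H₁ H₂ hκ hκ', N.smul_mem_iff Complex.I_ne_zero] at h1
  have m1 := G_mem_isoE (mul_mem_HH H₁.plus_mem H₂.plus_mem) 0 d (besselOp (d + 1) χ)
  have m2 := G_mem_isoE (mul_mem_HH H₁.plus_mem H₂.minus_mem) 0 (d + 1) (besselOp (κ' + d) χ)
  have m3 := add_mem
    (G_mem_isoE (mul_mem_HH H₁.minus_mem H₂.plus_mem) 0 (d - 1) ((d * (κ - 1)) • χ))
    (G_mem_isoE (mul_mem_HH H₁.minus_mem H₂.plus_mem) 1 d (besselOp (κ + d) χ))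
  have m4 := G_mem_isoE (mul_mem_HH H₁.minus_mem H₂.minus_mem) 0 d
    (((κ - 1) * (κ' - 1 + d)) • χ + entZ * besselOp (κ + κ' + d - 1) χ)
  generalize G (rename Sum.inl a₁ * rename Sum.inr a₂ * (rX p q ^ 0 * rY p q ^ d))
    (besselOp (d + 1) χ) = T1 at *
  generalize G (rename Sum.inl a₁ * rename Sum.inr g₂ * (rX p q ^ 0 * rY p q ^ (d + 1)))
    (besselOp (κ' + d) χ) = T2 at *
  generalize G (rename Sum.inl g₁ * rename Sum.inr a₂ * (rX p q ^ 0 * rY p q ^ (d - 1)))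
      ((d * (κ - 1)) • χ) +
    G (rename Sum.inl g₁ * rename Sum.inr a₂ * (rX p q ^ 1 * rY p q ^ d))
      (besselOp (κ + d) χ) = T3 at *
  generalize G (rename Sum.inl g₁ * rename Sum.inr g₂ * (rX p q ^ 0 * rY p q ^ d))
    (((κ - 1) * (κ' - 1 + d)) • χ + entZ * besselOp (κ + κ' + d - 1) χ) = T4 at *
  have key := mem_of_sum_mem_of_isGKStable hp hq hN (ι := Fin 4)
    (t := ![(k + 1, l + 1), (k + 1, l - 1), (k - 1, l + 1), (k - 1, l - 1)])
    (s := Finset.univ) (g := ![T1, T2, T3, T4]) (by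
      intro a b hab
      fin_cases a <;> fin_cases b <;> first | rfl | (simp at hab <;> omega)) (by
      intro a _
      fin_cases a
      exacts [m1, m2, m3, m4]) (by
      rw [Fin.sum_univ_four]
      exact h1)
  exact ⟨key 0 (Finset.mem_univ _), key 1 (Finset.mem_univ _), key 2 (Finset.mem_univ _),
    key 3 (Finset.mem_univ _)⟩

/-- The coefficient vanishes only if 2d + 2 = 2k + p. With the weight equation this gives p + q + 2k
+ 2l = 2m + 4, contrary to p + q ≥ 2m + 6. This is where the bound on m is needed. -/
theorem Full.plus_plus (hp : 2 ≤ p) (hq : 2 ≤ q) (hN : IsGKStable (piG p q) (piK p q) N)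
    (hle : N ≤ modPlus p q m) (hm : 2 * m + 6 ≤ p + q)
    {k l d : ℕ} (hd : 4 * d + 2 * l + q = 2 * m + 2 * k + p)
    (h : Full N k l d) : Full N (k + 1) (l + 1) d := by
  have hp0 : 0 < p := by omega
  have hq0 : 0 < q := by omega
  obtain ⟨i, h₁, a₁, g₁, H₁, n₁⟩ := exists_harmStep_plus_ne_zero hp k
  obtain ⟨j, h₂, a₂, g₂, H₂, n₂⟩ := exists_harmStep_plus_ne_zero hq l
  have hg := goodParam_kappa k hp0
  have hT := (boost_components_mem hp0 hq0 hN H₁ H₂ rfl rfl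
    (h _ (mul_mem_HH H₁.mem H₂.mem))).1
  have hmem := mul_mem_HH H₁.plus_mem H₂.plus_mem
  refine full_of_mem hp0 hq0 hN hle (by omega) hT ?_ (G_mem_isoE hmem _ _ _)
  rw [pow_zero, one_mul]
  refine G_ne_zero hp0 hq0 hmem (rename_mul_rename_ne_zero n₁ n₂) _ ?_
  rw [besselOp_psiE_apply_zero hg]
  refine neg_ne_zero.2 (div_ne_zero (sub_ne_zero.2 fun h' => ?_) hg.ne_zero)
  have h1 : ((2 * d + 2 : ℕ) : ℂ) = ((2 * k + p : ℕ) : ℂ) := by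
    push_cast
    linear_combination 2 * h'
  have h2 : 2 * d + 2 = 2 * k + p := by exact_mod_cast h1
  omega

/-- The coefficient vanishes only if 2(l+1) + q + 2d = 2k + p, which by the weight equation means d
= m, the upper end of the range. -/
theorem Full.plus_minus (hp : 2 ≤ p) (hq : 2 ≤ q) (hN : IsGKStable (piG p q) (piK p q) N)
    (hle : N ≤ modPlus p q m)
    {k l d : ℕ} (hd : 4 * d + 2 * (l + 1) + q = 2 * m + 2 * k + p)
    (hdm : d < m) (h : Full N k (l + 1) d) : Full N (k + 1) l (d + 1) := by
  have hp0 : 0 < p := by omega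
  have hq0 : 0 < q := by omega
  obtain ⟨i, h₁, a₁, g₁, H₁, n₁⟩ := exists_harmStep_plus_ne_zero hp k
  obtain ⟨j, h₂, a₂, g₂, H₂, n₂⟩ := exists_harmStep_minus_ne_zero hq l
  have hg := goodParam_kappa k hp0
  have hT := (boost_components_mem hp0 hq0 hN H₁ H₂ rfl rfl
    (h _ (mul_mem_HH H₁.mem H₂.mem))).2.1
  have hmem := mul_mem_HH H₁.plus_mem H₂.minus_mem
  refine full_of_mem hp0 hq0 hN hle (by omega) hT ?_ (G_mem_isoE hmem _ _ _)
  rw [pow_zero, one_mul]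
  refine G_ne_zero hp0 hq0 hmem (rename_mul_rename_ne_zero n₁ n₂) _ ?_
  rw [besselOp_psiE_apply_zero hg]
  refine neg_ne_zero.2 (div_ne_zero (sub_ne_zero.2 fun h' => ?_) hg.ne_zero)
  have h1 : ((2 * (l + 1) + q + 2 * d : ℕ) : ℂ) = ((2 * k + p : ℕ) : ℂ) := by
    push_cast at h' ⊢
    linear_combination 2 * h'
  have h2 : 2 * (l + 1) + q + 2 * d = 2 * k + p := by exact_mod_cast h1
  omega

/-- The two terms combine after a factor ρ_x ρ_y moves into the entire function, where it vanishes
at 0. What remains is (d + 1)(k + p/2), which is nonzero. -/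
theorem Full.minus_plus (hp : 2 ≤ p) (hq : 2 ≤ q) (hN : IsGKStable (piG p q) (piK p q) N)
    (hle : N ≤ modPlus p q m)
    {k l d : ℕ} (hd : 4 * (d + 1) + 2 * l + q = 2 * m + 2 * (k + 1) + p)
    (h : Full N (k + 1) l (d + 1)) : Full N k (l + 1) d := by
  have hp0 : 0 < p := by omega
  have hq0 : 0 < q := by omega
  obtain ⟨i, h₁, a₁, g₁, H₁, n₁⟩ := exists_harmStep_minus_ne_zero hp k
  obtain ⟨j, h₂, a₂, g₂, H₂, n₂⟩ := exists_harmStep_plus_ne_zero hq l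
  have hg := goodParam_kappa k hp0
  have hT := (boost_components_mem hp0 hq0 hN H₁ H₂ rfl rfl
    (h _ (mul_mem_HH H₁.mem H₂.mem))).2.2.1
  have hmem := mul_mem_HH H₁.minus_mem H₂.plus_mem
  refine full_of_mem hp0 hq0 hN hle (by omega) hT ?_
    (add_mem (G_mem_isoE hmem _ _ _) (G_mem_isoE hmem _ _ _))
  have e : rename Sum.inl g₁ * rename Sum.inr a₂ * (rX p q ^ 1 * rY p q ^ (d + 1)) =
      rename Sum.inl g₁ * rename Sum.inr a₂ * rY p q ^ d * (rX p q * rY p q) := by ring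
  rw [e, G_mul_rho, Nat.add_sub_cancel, pow_zero, one_mul, ← map_add]
  refine G_ne_zero hp0 hq0 hmem (rename_mul_rename_ne_zero n₁ n₂) _ ?_
  change ((d + 1 : ℕ) : ℂ) * (((k + 1 : ℕ) : ℂ) + (p : ℂ) / 2 - 1) *
    (psiE (((k + 1 : ℕ) : ℂ) + (p : ℂ) / 2)).1 0 + 0 * _ ≠ 0
  rw [psiE_zero (goodParam_kappa (k + 1) hp0), zero_mul, add_zero, mul_one]
  refine mul_ne_zero (Nat.cast_ne_zero.2 (Nat.succ_ne_zero d)) ?_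
  have e2 : ((k + 1 : ℕ) : ℂ) + (p : ℂ) / 2 - 1 = (k : ℂ) + (p : ℂ) / 2 := by
    push_cast
    ring
  rw [e2]
  exact hg.ne_zero

/-- At 0 only the constant (k + p/2)(l + d + q/2) survives. -/
theorem Full.minus_minus (hp : 2 ≤ p) (hq : 2 ≤ q) (hN : IsGKStable (piG p q) (piK p q) N)
    (hle : N ≤ modPlus p q m)
    {k l d : ℕ} (hd : 4 * d + 2 * l + q = 2 * m + 2 * k + p)
    (h : Full N (k + 1) (l + 1) d) : Full N k l d := by
  have hp0 : 0 < p := by omega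
  have hq0 : 0 < q := by omega
  obtain ⟨i, h₁, a₁, g₁, H₁, n₁⟩ := exists_harmStep_minus_ne_zero hp k
  obtain ⟨j, h₂, a₂, g₂, H₂, n₂⟩ := exists_harmStep_minus_ne_zero hq l
  have hT := (boost_components_mem hp0 hq0 hN H₁ H₂ rfl rfl
    (h _ (mul_mem_HH H₁.mem H₂.mem))).2.2.2
  have hmem := mul_mem_HH H₁.minus_mem H₂.minus_mem
  refine full_of_mem hp0 hq0 hN hle hd hT ?_ (G_mem_isoE hmem _ _ _)
  rw [pow_zero, one_mul]
  refine G_ne_zero hp0 hq0 hmem (rename_mul_rename_ne_zero n₁ n₂) _ ?_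
  change (((k + 1 : ℕ) : ℂ) + (p : ℂ) / 2 - 1) * (((l + 1 : ℕ) : ℂ) + (q : ℂ) / 2 - 1 + d) *
    (psiE (((k + 1 : ℕ) : ℂ) + (p : ℂ) / 2)).1 0 + 0 * _ ≠ 0
  rw [psiE_zero (goodParam_kappa (k + 1) hp0), zero_mul, add_zero, mul_one]
  have e1 : ((k + 1 : ℕ) : ℂ) + (p : ℂ) / 2 - 1 = (k : ℂ) + (p : ℂ) / 2 := by
    push_cast
    ring
  have e2 : ((l + 1 : ℕ) : ℂ) + (q : ℂ) / 2 - 1 + d = ((l + d : ℕ) : ℂ) + (q : ℂ) / 2 := by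
    push_cast
    ring
  rw [e1, e2]
  exact mul_ne_zero (goodParam_kappa k hp0).ne_zero (goodParam_kappa (l + d) hq0).ne_zero

theorem Full.of_same (hp : 2 ≤ p) (hq : 2 ≤ q) (hN : IsGKStable (piG p q) (piK p q) N)
    (hle : N ≤ modPlus p q m) (hm : 2 * m + 6 ≤ p + q)
    {k l k' l' d : ℕ} (hd : 4 * d + 2 * l + q = 2 * m + 2 * k + p)
    (hd' : 4 * d + 2 * l' + q = 2 * m + 2 * k' + p) (h : Full N k l d) : Full N k' l' d := by
  have up : ∀ n, Full N (k + n) (l + n) d := by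
    intro n
    induction n with
    | zero => exact h
    | succ n ih => exact Full.plus_plus (k := k + n) (l := l + n) hp hq hN hle hm (by omega) ih
  have down : ∀ n a b, 4 * d + 2 * b + q = 2 * m + 2 * a + p → Full N (a + n) (b + n) d →
      Full N a b d := by
    intro n
    induction n with
    | zero => exact fun a b _ h => h
    | succ n ih =>
      intro a b hab h
      exact ih a b hab (Full.minus_minus hp hq hN hle (by omega) h)
  refine down k k' l' hd' ?_
  -- For fixed d the difference k - l is fixed, so climbing k' steps from (k, l) reaches the same
  -- type as climbing k steps from (k', l').
  have h1 := up k'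
  rwa [show k + k' = k' + k by omega, show l + k' = l' + k by omega] at h1

/-- Mixed steps change d by one and lead from each diagonal k - l = const to a neighbouring one. The
route goes down to d = 0, up to the required d', then along that diagonal; a preliminary step to
(k+1, l+1) ensures that the degree to be lowered is positive. -/
theorem Full.all (hp : 2 ≤ p) (hq : 2 ≤ q) (hN : IsGKStable (piG p q) (piK p q) N)
    (hle : N ≤ modPlus p q m) (hm : 2 * m + 6 ≤ p + q)
    {k l d : ℕ} (hd : 4 * d + 2 * l + q = 2 * m + 2 * k + p)
    (h : Full N k l d) {k' l' d' : ℕ} (hd' : 4 * d' + 2 * l' + q = 2 * m + 2 * k' + p)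
    (hdm' : d' ≤ m) : Full N k' l' d' := by
  have down : ∀ n k l, 4 * n + 2 * l + q = 2 * m + 2 * k + p → Full N k l n →
      ∃ k l, 4 * 0 + 2 * l + q = 2 * m + 2 * k + p ∧ Full N k l 0 := by
    intro n
    induction n with
    | zero => exact fun k l h1 h2 => ⟨k, l, h1, h2⟩
    | succ n ih =>
      intro k l h1 h2
      exact ih k (l + 1 + 1) (by omega) (Full.minus_plus hp hq hN hle (by omega)
        (Full.plus_plus hp hq hN hle hm h1 h2))
  obtain ⟨k₀, l₀, h1, h2⟩ := down d k l hd h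
  have up : ∀ n, n ≤ m → ∃ k l, 4 * n + 2 * l + q = 2 * m + 2 * k + p ∧ Full N k l n := by
    intro n
    induction n with
    | zero => exact fun _ => ⟨k₀, l₀, h1, h2⟩
    | succ n ih =>
      intro hn
      obtain ⟨a, b, h3, h4⟩ := ih (by omega)
      exact ⟨a + 1 + 1, b, by omega, Full.plus_minus hp hq hN hle (by omega) (by omega)
        (Full.plus_plus hp hq hN hle hm h3 h4)⟩
  obtain ⟨a, b, h3, h4⟩ := up d' hdm'
  exact Full.of_same hp hq hN hle hm h3 hd' h4

theorem eq_modPlus_of_ne_bot (hp : 2 ≤ p) (hq : 2 ≤ q) (hN : IsGKStable (piG p q) (piK p q) N)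
    (hle : N ≤ modPlus p q m) (hm : 2 * m + 6 ≤ p + q)
    (h0 : N ≠ ⊥) : N = modPlus p q m := by
  have hp0 : 0 < p := by omega
  have hq0 : 0 < q := by omega
  refine le_antisymm hle ?_
  obtain ⟨f, hf, hf0⟩ := Submodule.exists_mem_ne_zero_of_ne_bot h0
  obtain ⟨s, x, rfl⟩ := exists_sum_vecP hp0 hq0 (hle hf)
  obtain ⟨i, hi, hi0⟩ := Finset.exists_ne_zero_of_sum_ne_zero hf0
  have h1 := mem_of_sum_mem_of_isGKStable hp0 hq0 hN (t := fun i : KIndex p q m => i.1)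
    Subtype.val_injective (fun i _ => vecP_mem_isoE i (x i)) hf i hi
  have h2 := (full_dIdx_iff i).2 (range_vecP_le hp0 hq0 hN i h1 hi0)
  rw [modPlus_eq_iSup hp0 hq0]
  exact iSup_le fun j => (full_dIdx_iff j).1
    (Full.all hp hq hN hle hm (dIdx_spec_nat i) h2 (dIdx_spec_nat j) (dIdx_le j))

theorem exists_vecP_ne_zero (hp : 2 ≤ p) (hq : 2 ≤ q) (i : KIndex p q m) :
    ∃ w, vecP i w ≠ 0 := by
  obtain ⟨h₁, m₁, n₁⟩ := exists_harm_ne_zero hp i.1.1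
  obtain ⟨h₂, m₂, n₂⟩ := exists_harm_ne_zero hq i.1.2
  refine ⟨(⟨h₁, m₁⟩ : Harm i.1.1 p) ⊗ₜ[ℂ] (⟨h₂, m₂⟩ : Harm i.1.2 q), fun h => ?_⟩
  have h2 := congrArg (theta i.1.1 i.1.2) (vecP_eq_zero (by omega) (by omega) i h)
  rw [map_zero, theta_tmul] at h2
  exact rename_mul_rename_ne_zero n₁ n₂ h2

theorem modPlus_ne_bot (hp : 2 ≤ p) (hq : 2 ≤ q) (hpq : Even (p + q)) : modPlus p q m ≠ ⊥ := by
  obtain ⟨c, hc⟩ := hpq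
  -- The type with d = 0, k = q and l = m + (p+q)/2; the parity of p + q makes l an integer.
  have hi : (q, m + c) ∈ KIndex p q m := by
    refine ⟨0, Nat.zero_le m, ?_⟩
    have : ((p + q : ℕ) : ℚ) = ((c + c : ℕ) : ℚ) := by rw [hc]
    push_cast at this ⊢
    linarith
  obtain ⟨w, hw⟩ := exists_vecP_ne_zero hp hq ⟨_, hi⟩
  intro h
  have h1 : vecP ⟨_, hi⟩ w ∈ modPlus p q m := by
    rw [modPlus_eq_iSup (by omega) (by omega)]
    exact Submodule.mem_iSup_of_mem ⟨_, hi⟩ ⟨w, rfl⟩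
  rw [h, Submodule.mem_bot] at h1
  exact hw h1

theorem modPlus_irreducible (hp : 2 ≤ p) (hq : 2 ≤ q) (hm : 2 * m + 6 ≤ p + q)
    (hpq : Even (p + q)) :
    IsIrreducibleGKModule (piG p q) (piK p q) (modPlus p q m) :=
  ⟨modPlus_isGKModule (by omega) (by omega) m, modPlus_ne_bot hp hq hpq, fun N hle hN =>
    or_iff_not_imp_left.2 fun h0 => eq_modPlus_of_ne_bot hp hq hN hle hm h0⟩

theorem modMinus_irreducible (hp : 2 ≤ p) (hq : 2 ≤ q) (hm : 2 * m + 6 ≤ p + q)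
    (hpq : Even (p + q)) :
    IsIrreducibleGKModule (piG p q) (piK p q) (modMinus p q m) := by
  refine ⟨modMinus_isGKModule (by omega) (by omega) m, fun h => ?_, fun N hle hN =>
    or_iff_not_imp_left.2 fun h0 => le_antisymm hle ?_⟩
  · apply modPlus_ne_bot (m := m) hp hq hpq
    rw [Submodule.eq_bot_iff]
    intro f hf
    obtain ⟨c, hc, h1⟩ := opXp_pow_opXm_pow hf
    have h2 := opXm_pow_mem_modMinus hf
    rw [h, Submodule.mem_bot] at h2
    rw [h2, map_zero] at h1
    exact (smul_eq_zero.1 h1.symm).resolve_left hc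
  -- (X⁺)^m carries a nonzero stable subspace of M⁻_m to one of M⁺_m, hence onto M⁺_m; applying
  -- (X⁻)^m recovers all of M⁻_m.
  · have hstab := isGKStable_map hN (A := opXp p q ^ m)
      (fun Y => (commute_piG_opXp Y).pow_right m) (fun k => (commute_piK_opXp k).pow_right m)
    have hsub : N.map (opXp p q ^ m) ≤ modPlus p q m := by
      rintro _ ⟨f, hf, rfl⟩
      exact opXp_pow_mem_modPlus (hle hf)
    have hne : N.map (opXp p q ^ m) ≠ ⊥ := by
      intro h
      refine h0 ((Submodule.eq_bot_iff _).2 fun f hf => ?_)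
      obtain ⟨c, hc, h1⟩ := opXm_pow_opXp_pow (hle hf)
      have h2 : (opXp p q ^ m) f ∈ N.map (opXp p q ^ m) := ⟨f, hf, rfl⟩
      rw [h, Submodule.mem_bot] at h2
      rw [h2, map_zero] at h1
      exact (smul_eq_zero.1 h1.symm).resolve_left hc
    have heq := eq_modPlus_of_ne_bot hp hq hstab hsub hm hne
    rw [modMinus_eq_map, ← heq]
    rintro _ ⟨_, ⟨f, hf, rfl⟩, rfl⟩
    obtain ⟨c, -, h1⟩ := opXm_pow_opXp_pow (hle hf)
    rw [h1]
    exact N.smul_mem c hf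

end Irreducible

end OpqModule

end

theorem theorem4p5 (p q m : ℕ) (hp : 1 ≤ p) (hq : 1 ≤ q) (hpq : Even (p + q))
    (hm : (m : ℚ) + 3 ≤ ((p : ℚ) + q) / 2) :
    -- the sets defining `M^±_m`, together with `0`, are linear subspaces
    (OpqModule.modPlus p q m : Set (OpqModule.Smooth p q)) =
        insert 0 (OpqModule.setPlus p q m) ∧
    (OpqModule.modMinus p q m : Set (OpqModule.Smooth p q)) =
        insert 0 (OpqModule.setMinus p q m) ∧
    -- they are `(𝔤, K)`-modules
    OpqModule.IsGKModule (OpqModule.piG p q) (OpqModule.piK p q) (OpqModule.modPlus p q m) ∧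
    OpqModule.IsGKModule (OpqModule.piG p q) (OpqModule.piK p q) (OpqModule.modMinus p q m) ∧
    -- (1) the `K`-type formula
    OpqModule.HasKTypeFormula p q m (OpqModule.modPlus p q m) ∧
    OpqModule.HasKTypeFormula p q m (OpqModule.modMinus p q m) ∧
    OpqModule.MultiplicityFree p q m ∧
    -- (2) irreducibility
    (2 ≤ p → 2 ≤ q →
      OpqModule.IsIrreducibleGKModule (OpqModule.piG p q) (OpqModule.piK p q)
        (OpqModule.modPlus p q m) ∧
      OpqModule.IsIrreducibleGKModule (OpqModule.piG p q) (OpqModule.piK p q)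
        (OpqModule.modMinus p q m)) := by
  have hm' : 2 * m + 6 ≤ p + q := by
    have h : ((2 * m + 6 : ℕ) : ℚ) ≤ ((p + q : ℕ) : ℚ) := by
      push_cast
      linarith
    exact_mod_cast h
  exact ⟨(OpqModule.modPlus_eq_and m).2, (OpqModule.modMinus_eq_and m).2,
    OpqModule.modPlus_isGKModule hp hq m, OpqModule.modMinus_isGKModule hp hq m,
    OpqModule.modPlus_hasKTypeFormula hp hq m, OpqModule.modMinus_hasKTypeFormula hp hq m,
    OpqModule.multiplicityFree hp hq m, fun hp2 hq2 =>
      ⟨OpqModule.modPlus_irreducible hp2 hq2 hm' hpq,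
        OpqModule.modMinus_irreducible hp2 hq2 hm' hpq⟩⟩
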